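/- **Setting.** $\kappa$ is the security parameter. Quantum adversaries, simulators, input samplers and distinguishers are families (indexed by $\kappa$) of poly-size quantum circuits; $\approx_q$ is indistinguishability, up to a negligible advantage, by poly-size families of quantum circuits, and $\approx_s$ is negligible statistical distance. "Poly-time" classical algorithms may be any families of poly-size Boolean circuits. **Witness encoding.** Let $\mathcal R\subset\{0,1\}^*\times\{0,1\}^*$ be a relation with polynomially bounded witnesses: $|w|\le q(|x|)$ for all $(x,w)\in\mathcal R$. A simulatable witness encoding scheme consists of five classical poly-time algorithms: an encoder $E$, giving $e=E(x,w,r')\in\{0,1\}^n$ for $(x,w)\in\mathcal R$, $r'\in\{0,1\}^m$; a decoder $D(x,e)\in\{0,1\}^*$; a selector $S(s)\subset\{1,\dots,n\}$ for challenges $s\in\{0,1\}^\sigma$; a judgment $J(x,s,e_s)\in\{\mathtt{abort},\mathtt{success}\}$, where $e_s=e|_{S(s)}$; and a randomized simulator $\hat E(x,s)$ that outputs bits in the positions $S(s)$. Here $m,n,\sigma$ are polynomially bounded functions of $|x|$. The scheme is *complete* if $J(x,s,e_s)=\mathtt{success}$ for all $(x,w)\in\mathcal R$, all $e=E(x,w,r')$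 and all $s$; *extractable* if $(x,D(x,e))\in\mathcal R$ whenever $J(x,s,e_s)=J(x,s',e_{s'})=\mathtt{success}$ for some $s\neq s'$; *simulatable* if for all $(x,w)\in\mathcal R$ and all $s$, $e_s$ for random $e\leftarrow E(x,w,r')$ and $\hat E(x,s)$ have the same distribution. **Mixed commitments.** A mixed bit commitment scheme consists of poly-time algorithms $\mathcal G_H$, $\mathcal G_B$, $\mathrm{commit}$, $\mathrm{xtr}$. $\mathcal G_H$ outputs a key $pk\in\{0,1\}^\kappa$ with distribution statistically close to uniform, for which $(pk,\mathrm{commit}_{pk}(m_1,r))\approx_s(pk,\mathrm{commit}_{pk}(m_2,r))$ for random $r$ and all $m_1,m_2$. $\mathcal G_B$ outputs pairs $(pk,sk)$ with $\mathrm{xtr}(\mathrm{commit}_{pk}(m,r),sk)=m$ for all $m,r$. Keys $pk$ from $\mathcal G_H$ and from $\mathcal G_B$ are $\approx_q$. **Protocol $\mathtt{ZKPK}(\mathcal R)$** (prover $A$ with input $(x,w)$, verifier $B$), with ideal coin-flipping: both parties obtain a uniform string $h$; if one party is dishonest, it sees $h$ first and decides whether the honest party obtains $h$ or $\bot$, and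 on $\bot$ the honest party aborts. (1) A coin-flip gives $pk\in\{0,1\}^\kappa$. (2) $A$ samples $e=E(x,w,r')$ and sends $x$ and $E_i=\mathrm{commit}_{pk}(e_i,r_i)$ for $i=1,\dots,n$; if $(x,w)\notin\mathcal R$, she sends $x$ and aborts. (3) A coin-flip gives $s\in\{0,1\}^\sigma$. (4) $A$ opens $E_i$ for $i\in S(s)$. (5) $B$ outputs $(x,J(x,s,e_s))$ if all openings are correct, and $(x,\mathtt{abort})$ otherwise (with $x=0\cdots0$ if no instance was received). **Functionality $\mathcal F_{\mathtt{ZKPK}}$.** On input $(x,w)$ from $A$ it outputs $(x,j)$ to $B$, with $j=\mathtt{success}$ if $(x,w)\in\mathcal R$ and $j=\mathtt{abort}$ otherwise. **Theorem.** Let $(E,D,S,J,\hat E)$ be a simulatable witness encoding scheme for $\mathcal R$ that is complete, extractable and simulatable, and let a mixed bit commitment scheme be given. Let the instances have length $\ell(\kappa)$, where $\ell$ is polynomially bounded and the knowledge error $2^{-\sigma(\ell(\kappa))}$ is negligible in $\kappa$. Then, in the hybrid model with ideal coin-flipping, $\mathtt{ZKPK}(\mathcal R)$ securely implements $\mathcal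 F_{\mathtt{ZKPK}}$: * (Correctness) for honest parties and every input distribution, inputs and output are jointly $\approx_s$ to inputs and output of $\mathcal F_{\mathtt{ZKPK}}$; * (Security against dishonest $A'$, and against dishonest $B'$) for every poly-size quantum adversary in the protocol there is a poly-size quantum adversary that interacts only with $\mathcal F_{\mathtt{ZKPK}}$, such that for every poly-size quantum input sampler the joint outputs of the two executions are $\approx_q$. The sampler produces the honest party's classical input ($(x,w)$ for $A$, none for $B$), a classical $Z$ and the dishonest party's quantum input, which given $Z$ does not depend on the honest input; the joint output consists of the honest party's input and output, $Z$, and the dishonest party's quantum output. -/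

import Mathlib

namespace QZK

/-! ## Asymptotics -/

/-- Bit strings of length `n`. -/
abbrev Bits (n : ℕ) : Type := Fin n → Bool

/-- Negligible functions of the security parameter. -/
def Negl (f : ℕ → ℝ) : Prop :=
  Asymptotics.SuperpolynomialDecay Filter.atTop (fun κ : ℕ => (κ : ℝ)) f

/-- `f` is bounded by a polynomial. -/
def PolyBounded (f : ℕ → ℕ) : Prop := ∃ p : Polynomial ℕ, ∀ k, f k ≤ p.eval k

/-! ## Classical poly-size computation -/

/-- A Boolean straight-line program on the wires `ω`: the instruction `(c, a, b)` writes
`NAND (wire a) (wire b)` on wire `c`. -/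
abbrev BoolProg (ω : Type) : Type := List (ω × ω × ω)

/-- Running a straight-line program. -/
def BoolProg.run {ω : Type} [DecidableEq ω] (P : BoolProg ω) (v : ω → Bool) : ω → Bool :=
  P.foldl (fun v g => Function.update v g.1 (!(v g.2.1 && v g.2.2))) v

/-- On the inputs in `dom k`, the functions `f k` are computed by Boolean programs of size
polynomial in `k`. The wires are the input wires `α k`, the output wires `β k` and `W` work wires;
all wires but the inputs start with the value `false`. Every polynomial-time computable family
of functions has this property. -/
def PolySizeOn {α β : ℕ → Type} [∀ k, DecidableEq (α k)] [∀ k, DecidableEq (β k)]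
    (dom : ∀ k, Set (α k → Bool)) (f : ∀ k, (α k → Bool) → (β k → Bool)) : Prop :=
  ∃ p : Polynomial ℕ, ∀ k, ∃ W : ℕ, W ≤ p.eval k ∧
    ∃ P : BoolProg (α k ⊕ (β k ⊕ Fin W)), P.length ≤ p.eval k ∧
      ∀ x ∈ dom k, ∀ b : β k,
        P.run (Sum.elim x (fun _ => false)) (Sum.inr (Sum.inl b)) = f k x b

/-- `PolySizeOn` with no restriction of the inputs. -/
def PolySize {α β : ℕ → Type} [∀ k, DecidableEq (α k)] [∀ k, DecidableEq (β k)]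
    (f : ∀ k, (α k → Bool) → (β k → Bool)) : Prop :=
  PolySizeOn (fun _ => Set.univ) f

/-! ## Statistical distance -/

/-- Statistical (total variation) distance. -/
noncomputable def statDist {A : Type} [Fintype A] (P Q : PMF A) : ℝ :=
  (∑ a, |(P a).toReal - (Q a).toReal|) / 2

/-- Statistical indistinguishability of families of random variables. -/
def StatIndist {A : ℕ → Type} [∀ κ, Fintype (A κ)] (P Q : ∀ κ, PMF (A κ)) : Prop :=
  Negl fun κ => statDist (P κ) (Q κ)

/-! ## Quantum registers and circuits -/

/-- Operators on the qubits (wires) `ω`, in the computational basis `ω → Bool`. -/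
abbrev Op (ω : Type) : Type := Matrix (ω → Bool) (ω → Bool) ℂ

/-- The basis state `|m⟩⟨m|`. -/
def ketBra {ω : Type} [Fintype ω] [DecidableEq ω] (m : ω → Bool) : Op ω :=
  Matrix.single m m 1

/-- The state `|0…0⟩⟨0…0|`. -/
def zeroState (ω : Type) [Fintype ω] [DecidableEq ω] : Op ω := ketBra (fun _ => false)

/-- Tensor product of operators on two registers. -/
def tens {α β : Type} (ρ : Op α) (τ : Op β) : Op (α ⊕ β) := fun p q =>
  ρ (p ∘ Sum.inl) (q ∘ Sum.inl) * τ (p ∘ Sum.inr) (q ∘ Sum.inr)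

/-- Partial trace over the left register. -/
def traceLeft {α β : Type} [Fintype α] [DecidableEq α] (X : Op (α ⊕ β)) : Op β := fun a b =>
  ∑ t : α → Bool, X (Sum.elim t a) (Sum.elim t b)

/-- Partial trace over the right register. -/
def traceRight {α β : Type} [Fintype β] [DecidableEq β] (X : Op (α ⊕ β)) : Op α := fun a b =>
  ∑ t : β → Bool, X (Sum.elim a t) (Sum.elim b t)

/-- Measuring the left register in the computational basis with outcome `r`: the unnormalized
state of the right register, whose trace is the probability of `r`. -/
def outcome {α β : Type} (r : α → Bool) (X : Op (α ⊕ β)) : Op β := fun a b =>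
  X (Sum.elim r a) (Sum.elim r b)

/-- A gate: any unitary on at most three of the qubits `ω`. -/
structure QGate (ω : Type) where
  arity : ℕ
  arity_le : arity ≤ 3
  wires : Fin arity ↪ ω
  unitary : Matrix.unitaryGroup (Bits arity) ℂ

open Classical in
/-- The action of a gate on all the qubits, `unitary ⊗ 1`. -/
noncomputable def QGate.toOp {ω : Type} (g : QGate ω) : Op ω := fun x y =>
  if ∀ i, i ∉ Set.range g.wires → x i = y i then
    (g.unitary : Matrix (Bits g.arity) (Bits g.arity) ℂ) (x ∘ g.wires) (y ∘ g.wires)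
  else 0

/-- A quantum circuit on the qubits `ω`; the head of the list is applied first. -/
abbrev QCircuit (ω : Type) : Type := List (QGate ω)

/-- The unitary of a circuit. -/
noncomputable def QCircuit.toOp {ω : Type} [Fintype ω] [DecidableEq ω] (C : QCircuit ω) : Op ω :=
  C.foldl (fun M g => g.toOp * M) 1

/-- The circuit applied to a state. -/
noncomputable def QCircuit.apply {ω : Type} [Fintype ω] [DecidableEq ω] (C : QCircuit ω)
    (ρ : Op ω) : Op ω :=
  C.toOp * ρ * C.toOp.conjTranspose

/-! ## Quantum poly-time indistinguishability -/

/-- A distinguisher for states of the register `ω`: a circuit on an answer qubit, the register and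
`na` ancillas. -/
structure Distinguisher (ω : Type) where
  na : ℕ
  circ : QCircuit (Unit ⊕ (ω ⊕ Fin na))

/-- The probability that measuring the answer qubit gives `1`. -/
noncomputable def Distinguisher.accept {ω : Type} [Fintype ω] [DecidableEq ω]
    (D : Distinguisher ω) (ρ : Op ω) : ℝ :=
  (Matrix.trace (outcome (fun _ : Unit => true)
    (D.circ.apply (tens (zeroState Unit) (tens ρ (zeroState (Fin D.na))))))).re

/-- `ρ ≈q τ`: no poly-size family of quantum circuits distinguishes the families of states. -/
def QIndist {ω : ℕ → Type} [∀ κ, Fintype (ω κ)] [∀ κ, DecidableEq (ω κ)]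
    (ρ τ : ∀ κ, Op (ω κ)) : Prop :=
  ∀ D : ∀ κ, Distinguisher (ω κ),
    PolyBounded (fun κ => (D κ).na) → PolyBounded (fun κ => (D κ).circ.length) →
    Negl fun κ => |(D κ).accept (ρ κ) - (D κ).accept (τ κ)|

/-- The state of a classical random bit string. -/
noncomputable def classicalState {ω : Type} [Fintype ω] [DecidableEq ω] (P : PMF (ω → Bool)) :
    Op ω :=
  Matrix.diagonal fun m => ((P m).toReal : ℂ)

/-! ## Executions with a dishonest party -/

/-- What a dishonest party talks to: the honest party together with the ideal functionalities.
It has honest input on the wires `ι`, honest output on the wires `ο`, uniform coins in `Ω`, sends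
messages on the wires `α` and receives replies on the wires `β`. In each round it sends a message,
which may depend on the list of the earlier replies (oldest first), and gets one reply. -/
structure System (Ω ι ο α β : Type) where
  rounds : ℕ
  send : (ι → Bool) → Ω → List (β → Bool) → (α → Bool)
  result : (ι → Bool) → Ω → List (β → Bool) → (ο → Bool)

/-- The memory of a dishonest party: classical input `Z`, quantum input, quantum output and
work qubits. -/
abbrev Mem (nz nq no na : ℕ) : Type := Fin nz ⊕ (Fin nq ⊕ (Fin no ⊕ Fin na))

/-- A dishonest quantum party. In round `i` it applies `circ i` to the incoming message, a reply
register (initially zero) and its memory. After the last round it applies `last` to its memory. -/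
structure Adversary (α β : Type) (nz nq no : ℕ) where
  na : ℕ
  circ : ℕ → QCircuit (α ⊕ (β ⊕ Mem nz nq no na))
  last : QCircuit (Mem nz nq no na)

section Execution

variable {Ω ι ο α β : Type} [Fintype Ω]
  [Fintype ι] [DecidableEq ι] [Fintype ο] [DecidableEq ο]
  [Fintype α] [DecidableEq α] [Fintype β] [DecidableEq β] {nz nq no : ℕ}

/-- One round of the dishonest party on message `m`: the unnormalized state of its memory when
measuring the reply register gives `r`. -/
noncomputable def Adversary.step (A : Adversary α β nz nq no) (i : ℕ) (m : α → Bool)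
    (r : β → Bool) (ρ : Op (Mem nz nq no A.na)) : Op (Mem nz nq no A.na) :=
  outcome r (traceLeft ((A.circ i).apply (tens (ketBra m) (tens (zeroState β) ρ))))

/-- The initial memory on classical input `z` and quantum input `ρ`. -/
noncomputable def Adversary.start (A : Adversary α β nz nq no) (z : Bits nz) (ρ : Op (Fin nq)) :
    Op (Mem nz nq no A.na) :=
  tens (ketBra z) (tens ρ (tens (zeroState (Fin no)) (zeroState (Fin A.na))))

/-- The output register at the end. -/
noncomputable def Adversary.finish (A : Adversary α β nz nq no) (ρ : Op (Mem nz nq no A.na)) :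
    Op (Fin no) :=
  traceRight (traceLeft (traceLeft (A.last.apply ρ)))

/-- The last `n` rounds, after the replies `hist`, with fixed coins `c`: for each honest output
`y`, the unnormalized state of the memory of the dishonest party. -/
noncomputable def System.run (M : System Ω ι ο α β) (A : Adversary α β nz nq no)
    (u : ι → Bool) (c : Ω) :
    ℕ → List (β → Bool) → Op (Mem nz nq no A.na) → (ο → Bool) → Op (Mem nz nq no A.na)
  | 0, hist, ρ, y => if M.result u c hist = y then ρ else 0
  | n + 1, hist, ρ, y => ∑ r : β → Bool,
      M.run A u c n (hist ++ [r]) (A.step hist.length (M.send u c hist) r ρ) y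

/-- A circuit that samples the inputs: honest input, classical `Z` and quantum input of the
dishonest party. -/
structure Sampler (ι : Type) (nz nq : ℕ) where
  na : ℕ
  circ : QCircuit (ι ⊕ (Fin nz ⊕ (Fin nq ⊕ Fin na)))

/-- The unnormalized state of the quantum input together with honest input `u` and `Z = z`. -/
noncomputable def Sampler.state (T : Sampler ι nz nq) (u : ι → Bool) (z : Bits nz) :
    Op (Fin nq) :=
  traceRight (outcome z (outcome u (T.circ.apply (zeroState _))))

/-- Conditional independence: given `Z`, the quantum input does not depend on the honest
input, `ρ^{u,z} = ρ^z` (stated without normalization). -/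
def Sampler.IsMarkov (T : Sampler ι nz nq) : Prop :=
  ∀ u z, Matrix.trace (∑ u', T.state u' z) • T.state u z =
    Matrix.trace (T.state u z) • ∑ u', T.state u' z

/-- The joint output of an execution: honest input, `Z`, honest output, and the quantum output of
the dishonest party. -/
noncomputable def System.out (M : System Ω ι ο α β) (A : Adversary α β nz nq no)
    (T : Sampler ι nz nq) : Op (ι ⊕ (Fin nz ⊕ (ο ⊕ Fin no))) :=
  ∑ u : ι → Bool, ∑ z : Bits nz, ∑ y : ο → Bool,
    tens (ketBra u) (tens (ketBra z) (tens (ketBra y)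
      ((Fintype.card Ω : ℂ)⁻¹ • ∑ c : Ω,
        A.finish (M.run A u c M.rounds [] (A.start z (T.state u z)) y))))

end Execution

/-- A family of dishonest parties is poly-size. -/
def AdvPoly {α β : ℕ → Type} {nz nq no : ℕ → ℕ}
    (A : ∀ κ, Adversary (α κ) (β κ) (nz κ) (nq κ) (no κ)) : Prop :=
  ∃ p : Polynomial ℕ, ∀ κ, nz κ ≤ p.eval κ ∧ nq κ ≤ p.eval κ ∧ no κ ≤ p.eval κ ∧
    (A κ).na ≤ p.eval κ ∧ (∀ i, ((A κ).circ i).length ≤ p.eval κ) ∧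
    (A κ).last.length ≤ p.eval κ

/-- A family of input samplers is poly-size. -/
def SamplerPoly {ι : ℕ → Type} {nz nq : ℕ → ℕ} (T : ∀ κ, Sampler (ι κ) (nz κ) (nq κ)) : Prop :=
  ∃ p : Polynomial ℕ, ∀ κ, (T κ).na ≤ p.eval κ ∧ (T κ).circ.length ≤ p.eval κ

/-- Computational security against a dishonest party: `real` and `ideal` are what the dishonest
party talks to in the real and in the ideal world. -/
def SecureAgainst {Ω₁ Ω₂ ι ο α₁ β₁ α₂ β₂ : ℕ → Type}
    [∀ κ, Fintype (Ω₁ κ)] [∀ κ, Fintype (Ω₂ κ)]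
    [∀ κ, Fintype (ι κ)] [∀ κ, DecidableEq (ι κ)] [∀ κ, Fintype (ο κ)] [∀ κ, DecidableEq (ο κ)]
    [∀ κ, Fintype (α₁ κ)] [∀ κ, DecidableEq (α₁ κ)] [∀ κ, Fintype (β₁ κ)]
    [∀ κ, DecidableEq (β₁ κ)] [∀ κ, Fintype (α₂ κ)] [∀ κ, DecidableEq (α₂ κ)]
    [∀ κ, Fintype (β₂ κ)] [∀ κ, DecidableEq (β₂ κ)]
    (real : ∀ κ, System (Ω₁ κ) (ι κ) (ο κ) (α₁ κ) (β₁ κ))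
    (ideal : ∀ κ, System (Ω₂ κ) (ι κ) (ο κ) (α₂ κ) (β₂ κ)) : Prop :=
  ∀ (nz nq no : ℕ → ℕ) (A : ∀ κ, Adversary (α₁ κ) (β₁ κ) (nz κ) (nq κ) (no κ)), AdvPoly A →
    ∃ A' : ∀ κ, Adversary (α₂ κ) (β₂ κ) (nz κ) (nq κ) (no κ), AdvPoly A' ∧
      ∀ T : ∀ κ, Sampler (ι κ) (nz κ) (nq κ), SamplerPoly T → (∀ κ, (T κ).IsMarkov) →
        QIndist (fun κ => (real κ).out (A κ) (T κ)) (fun κ => (ideal κ).out (A' κ) (T κ))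

/-- Correctness, for honest parties: for all distributions of the input, input and output are
jointly statistically indistinguishable from input and output of the functionality. -/
def Correct {A B : ℕ → Type} [∀ κ, Fintype (A κ)] [∀ κ, Fintype (B κ)]
    (prot func : ∀ κ, A κ → PMF (B κ)) : Prop :=
  ∀ P : ∀ κ, PMF (A κ),
    StatIndist (fun κ => (P κ).bind fun u => (prot κ u).map fun y => (u, y))
      (fun κ => (P κ).bind fun u => (func κ u).map fun y => (u, y))

/-! ## Mixed bit commitments -/

/-- The algorithms of a mixed bit commitment scheme. The key generators get their random bits as an
argument; public keys have length `κ`. -/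
structure CommitScheme where
  hcoins : ℕ → ℕ
  bcoins : ℕ → ℕ
  sklen : ℕ → ℕ
  rlen : ℕ → ℕ
  clen : ℕ → ℕ
  genH : ∀ κ, Bits (hcoins κ) → Bits κ
  genB : ∀ κ, Bits (bcoins κ) → Bits κ × Bits (sklen κ)
  commit : ∀ κ, Bits κ → Bool → Bits (rlen κ) → Bits (clen κ)
  xtr : ∀ κ, Bits (sklen κ) → Bits (clen κ) → Bool

/-- The algorithms are poly-time and form a mixed commitment scheme. -/
structure CommitScheme.IsMixed (C : CommitScheme) : Prop where
  hcoins_poly : PolyBounded C.hcoins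
  bcoins_poly : PolyBounded C.bcoins
  sklen_poly : PolyBounded C.sklen
  rlen_poly : PolyBounded C.rlen
  clen_poly : PolyBounded C.clen
  genH_poly : PolySize (α := fun κ => Fin (C.hcoins κ)) (β := fun κ => Fin κ) C.genH
  genB_poly : PolySize (α := fun κ => Fin (C.bcoins κ)) (β := fun κ => Fin κ ⊕ Fin (C.sklen κ))
    fun κ v => Sum.elim (C.genB κ v).1 (C.genB κ v).2
  commit_poly : PolySize (α := fun κ => Fin κ ⊕ (Unit ⊕ Fin (C.rlen κ)))
    (β := fun κ => Fin (C.clen κ))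
    fun κ v => C.commit κ (fun i => v (.inl i)) (v (.inr (.inl ()))) (fun i => v (.inr (.inr i)))
  xtr_poly : PolySize (α := fun κ => Fin (C.sklen κ) ⊕ Fin (C.clen κ)) (β := fun _ => Unit)
    fun κ v _ => C.xtr κ (fun i => v (.inl i)) (fun i => v (.inr i))
  /-- Unconditionally hiding for keys from `genH`. -/
  hides : ∀ m₁ m₂ : Bool, StatIndist
    (fun κ => (PMF.uniformOfFintype (Bits (C.hcoins κ) × Bits (C.rlen κ))).map
      fun t => (C.genH κ t.1, C.commit κ (C.genH κ t.1) m₁ t.2))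
    (fun κ => (PMF.uniformOfFintype (Bits (C.hcoins κ) × Bits (C.rlen κ))).map
      fun t => (C.genH κ t.1, C.commit κ (C.genH κ t.1) m₂ t.2))
  /-- Extractability for key pairs from `genB`. -/
  extract : ∀ κ (t : Bits (C.bcoins κ)) (m : Bool) (r : Bits (C.rlen κ)),
    C.xtr κ (C.genB κ t).2 (C.commit κ (C.genB κ t).1 m r) = m
  /-- Key indistinguishability. -/
  key_indist : QIndist (ω := fun κ => Fin κ)
    (fun κ => classicalState
      ((PMF.uniformOfFintype (Bits (C.bcoins κ))).map fun t => (C.genB κ t).1))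
    (fun κ => classicalState ((PMF.uniformOfFintype (Bits (C.hcoins κ))).map (C.genH κ)))
  /-- Hiding keys are statistically close to uniform. -/
  key_uniform : StatIndist
    (fun κ => (PMF.uniformOfFintype (Bits (C.hcoins κ))).map (C.genH κ))
    (fun κ => PMF.uniformOfFintype (Bits κ))

/-! ## Simulatable witness encodings -/

/-- A string `w` of length at most `q` as `q + 1` bits: `w`, then a one, then zeros. -/
def encodeWit (q : ℕ) (w : List Bool) : Bits (q + 1) := fun i =>
  (w ++ [true]).getD i false

/-- The string encoded by `v`; the all-zero `v` encodes nothing. -/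
def decodeWit {k : ℕ} (v : Bits k) : Option (List Bool) :=
  match (List.ofFn v).reverse.dropWhile (fun b => !b) with
  | [] => none
  | _ :: t => some t.reverse

/-- The algorithms `(E, D, S, J, Ê)` of a witness encoding, on instances of length `k`, with
`m k` and `mhat k` random bits for `E` and `Ê`, encodings of length `n k` and challenges of
length `sig k`. The bits of an encoding in the positions `S k s` are functions on `S k s`. -/
structure WitnessEncoding where
  m : ℕ → ℕ
  mhat : ℕ → ℕ
  n : ℕ → ℕ
  sig : ℕ → ℕ
  E : ∀ k, Bits k → List Bool → Bits (m k) → Bits (n k)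
  D : ∀ k, Bits k → Bits (n k) → List Bool
  S : ∀ k, Bits (sig k) → Finset (Fin (n k))
  J : ∀ k, Bits k → (s : Bits (sig k)) → (S k s → Bool) → Bool
  Ehat : ∀ k, Bits k → (s : Bits (sig k)) → Bits (mhat k) → (S k s → Bool)

/-- The restriction of a bit string to a set of positions. -/
def restrict {n : ℕ} (e : Bits n) (A : Finset (Fin n)) : A → Bool := fun i => e i

/-- Bits in the positions `A`, written into a string that is zero elsewhere. -/
def fill {n : ℕ} (A : Finset (Fin n)) (f : A → Bool) : Bits n := fun i =>
  if h : i ∈ A then f ⟨i, h⟩ else false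

/-- The five algorithms of an encoding for `R` are poly-time. Witnesses and decoded strings have
length at most `q k`. -/
structure WitnessEncoding.IsPoly (W : WitnessEncoding) (R : Set (List Bool × List Bool))
    (q : ℕ → ℕ) : Prop where
  m_poly : PolyBounded W.m
  mhat_poly : PolyBounded W.mhat
  n_poly : PolyBounded W.n
  sig_poly : PolyBounded W.sig
  D_length : ∀ k (x : Bits k) (e : Bits (W.n k)), (W.D k x e).length ≤ q k
  E_poly : ∃ f : ∀ k, ((Fin k ⊕ (Fin (q k + 1) ⊕ Fin (W.m k))) → Bool) → Bits (W.n k),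
    PolySize (α := fun k => Fin k ⊕ (Fin (q k + 1) ⊕ Fin (W.m k))) (β := fun k => Fin (W.n k)) f ∧
    ∀ k (x : Bits k) (w : List Bool) (r : Bits (W.m k)), (List.ofFn x, w) ∈ R →
      f k (Sum.elim x (Sum.elim (encodeWit (q k) w) r)) = W.E k x w r
  D_poly : PolySize (α := fun k => Fin k ⊕ Fin (W.n k)) (β := fun k => Fin (q k + 1))
    fun k v => encodeWit (q k) (W.D k (fun i => v (.inl i)) (fun i => v (.inr i)))
  S_poly : PolySize (α := fun k => Fin (W.sig k)) (β := fun k => Fin (W.n k))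
    fun k s i => decide (i ∈ W.S k s)
  J_poly : ∃ f : ∀ k, ((Fin k ⊕ (Fin (W.sig k) ⊕ Fin (W.n k))) → Bool) → (Unit → Bool),
    PolySize (α := fun k => Fin k ⊕ (Fin (W.sig k) ⊕ Fin (W.n k))) (β := fun _ => Unit) f ∧
    ∀ k (x : Bits k) (s : Bits (W.sig k)) (t : W.S k s → Bool),
      f k (Sum.elim x (Sum.elim s (fill (W.S k s) t))) () = W.J k x s t
  Ehat_poly : PolySize (α := fun k => Fin k ⊕ (Fin (W.sig k) ⊕ Fin (W.mhat k)))
    (β := fun k => Fin (W.n k))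
    fun k v => fill _ (W.Ehat k (fun i => v (.inl i)) (fun i => v (.inr (.inl i)))
      (fun i => v (.inr (.inr i))))

/-- Completeness: correct encodings pass the judgment for all challenges. -/
def WitnessEncoding.Complete (W : WitnessEncoding) (R : Set (List Bool × List Bool)) : Prop :=
  ∀ k (x : Bits k) (w : List Bool) (r : Bits (W.m k)) (s : Bits (W.sig k)),
    (List.ofFn x, w) ∈ R → W.J k x s (restrict (W.E k x w r) (W.S k s)) = true

/-- `e` is admissible for `x`: it passes the judgment for two distinct challenges. -/
def WitnessEncoding.Admissible (W : WitnessEncoding) {k : ℕ} (x : Bits k) (e : Bits (W.n k)) :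
    Prop :=
  ∃ s s' : Bits (W.sig k), s ≠ s' ∧ W.J k x s (restrict e (W.S k s)) = true ∧
    W.J k x s' (restrict e (W.S k s')) = true

/-- Extractability: admissible encodings decode to a witness. -/
def WitnessEncoding.Extractable (W : WitnessEncoding) (R : Set (List Bool × List Bool)) : Prop :=
  ∀ k (x : Bits k) (e : Bits (W.n k)), W.Admissible x e → (List.ofFn x, W.D k x e) ∈ R

/-- Simulatability: for each challenge, `Ê` has the distribution of the bits of a random encoding
in the selected positions. -/
def WitnessEncoding.Simulatable (W : WitnessEncoding) (R : Set (List Bool × List Bool)) : Prop :=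
  ∀ k (x : Bits k) (w : List Bool) (s : Bits (W.sig k)), (List.ofFn x, w) ∈ R →
    (PMF.uniformOfFintype (Bits (W.m k))).map (fun r => restrict (W.E k x w r) (W.S k s)) =
      (PMF.uniformOfFintype (Bits (W.mhat k))).map (W.Ehat k x s)

/-! ## The ideal functionality -/

/-- The wires of the prover's input `(x, w)`. -/
abbrev InW (k q : ℕ) : Type := Fin k ⊕ Fin (q + 1)

/-- The wires of the verifier's output `(x, j)`; `true` is `success`, `false` is `abort`. -/
abbrev OutW (k : ℕ) : Type := Fin k ⊕ Unit

/-- Writing `(x, j)` on the output wires. -/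
def verdict {k : ℕ} (o : Bits k × Bool) : OutW k → Bool := Sum.elim o.1 (fun _ => o.2)

open Classical in
/-- The witness contained in the input `(x, w)`, if `(x, w) ∈ R`. -/
noncomputable def validWit (R : Set (List Bool × List Bool)) {k q : ℕ} (u : InW k q → Bool) :
    Option (List Bool) :=
  match decodeWit (fun i => u (.inr i)) with
  | none => none
  | some w => if (List.ofFn (fun i => u (.inl i)), w) ∈ R then some w else none

/-- The functionality for zero-knowledge proofs of knowledge: on input `(x, w)` from the prover,
the verifier obtains `(x, j)`, with `j = success` if and only if `(x, w) ∈ R`. -/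
noncomputable def funcZKPK (R : Set (List Bool × List Bool)) {k q : ℕ} (u : InW k q → Bool) :
    Bits k × Bool :=
  (fun i => u (.inl i), (validWit R u).isSome)

/-- The ideal world with dishonest prover: she sends `(x, w)` to the functionality, and the honest
verifier outputs what he obtains. -/
noncomputable def idealProver (R : Set (List Bool × List Bool)) (k q : ℕ) :
    System Unit Empty (OutW k) Empty (InW k q) where
  rounds := 1
  send _ _ _ := Empty.elim
  result _ _ hist := match hist with
    | [u] => verdict (funcZKPK R u)
    | _ => fun _ => false

/-- The ideal world with dishonest verifier: he obtains `(x, j)`; the prover has no output. -/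
noncomputable def idealVerifier (R : Set (List Bool × List Bool)) (k q : ℕ) :
    System Unit (InW k q) Empty (OutW k) Empty where
  rounds := 1
  send u _ _ := verdict (funcZKPK R u)
  result _ _ _ := Empty.elim

/-! ## The protocol -/

/-- The prover's first message: the instance, and the commitments unless she aborts. -/
structure ProverMsg (k n c : ℕ) where
  inst : Bits k
  com : Option (Fin n → Bits c)

/-- Wires of the first message: a flag (`true` if commitments follow), instance, commitments. -/
abbrev MsgW (k n c : ℕ) : Type := Unit ⊕ (Fin k ⊕ (Fin n × Fin c))

/-- The opening: bit and randomness of the commitments. Only the positions selected by the challenge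
carry information; an honest prover writes zeros in the others, and the verifier ignores them. -/
abbrev Opening (n l : ℕ) : Type := Fin n → Bool × Bits l

/-- Wires of the opening: a flag (`false` for an abort), bits, randomness. -/
abbrev OpenW (n l : ℕ) : Type := Unit ⊕ (Fin n ⊕ (Fin n × Fin l))

/-- Writing the first message on wires. -/
def ProverMsg.write {k n c : ℕ} (M : ProverMsg k n c) : MsgW k n c → Bool :=
  match M.com with
  | none => Sum.elim (fun _ => false) (Sum.elim M.inst (fun _ => false))
  | some F => Sum.elim (fun _ => true) (Sum.elim M.inst (fun ij => F ij.1 ij.2))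

/-- Reading the first message from wires. -/
def ProverMsg.read {k n c : ℕ} (v : MsgW k n c → Bool) : ProverMsg k n c where
  inst := fun i => v (.inr (.inl i))
  com := if v (.inl ()) then some (fun i j => v (.inr (.inr (i, j)))) else none

/-- Writing an opening on wires. -/
def writeOpening {n l : ℕ} (o : Option (Opening n l)) : OpenW n l → Bool :=
  match o with
  | none => fun _ => false
  | some f => Sum.elim (fun _ => true) (Sum.elim (fun i => (f i).1) (fun ij => (f ij.1).2 ij.2))

/-- Reading an opening from wires. -/
def readOpening {n l : ℕ} (v : OpenW n l → Bool) : Option (Opening n l) :=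
  if v (.inl ()) then some (fun i => (v (.inr (.inl i)), fun j => v (.inr (.inr (i, j)))))
  else none

/-- The outcome of the ideal coin-flip for the honest party: the dishonest party, who has seen the
coin `h`, replies `⊤` or `⊥`. -/
def coin {l : ℕ} (h : Bits l) (reply : Bool) : Option (Bits l) := if reply then some h else none

section Protocol

variable (R : Set (List Bool × List Bool)) (W : WitnessEncoding) (C : CommitScheme) (κ k q : ℕ)

/-- The honest prover's randomness: for the encoding and for the `n` commitments. -/
abbrev ProverCoins : Type := Bits (W.m k) × (Fin (W.n k) → Bits (C.rlen κ))

/-- The prover's first message, given the outcome of the first coin-flip. She sends the instance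
and commitments to the bits of a random encoding of the witness. She sends an abort with the
instance if `(x, w) ∉ R`, and an empty abort if the coin-flip failed. -/
noncomputable def proverMsg (u : InW k q → Bool) (pk : Option (Bits κ))
    (t : ProverCoins W C κ k) : ProverMsg k (W.n k) (C.clen κ) :=
  match pk, validWit R u with
  | none, _ => ⟨fun _ => false, none⟩
  | some _, none => ⟨fun i => u (.inl i), none⟩
  | some pk, some w => ⟨fun i => u (.inl i), some fun i =>
      C.commit κ pk (W.E k (fun i => u (.inl i)) w t.1 i) (t.2 i)⟩

/-- The prover's opening of the positions `S(s)`. -/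
noncomputable def proverOpen (u : InW k q → Bool) (pk : Option (Bits κ))
    (s : Option (Bits (W.sig k))) (t : ProverCoins W C κ k) :
    Option (Opening (W.n k) (C.rlen κ)) :=
  match pk, validWit R u, s with
  | some _, some w, some s => some fun i =>
      if i ∈ W.S k s then (W.E k (fun i => u (.inl i)) w t.1 i, t.2 i) else (false, fun _ => false)
  | _, _, _ => none

open Classical in
/-- The honest verifier's output `(x, j)`. If the protocol stops before he has seen an instance,
he outputs `abort` with the all-zero instance. -/
noncomputable def verifierOut (pk : Option (Bits κ)) (M : ProverMsg k (W.n k) (C.clen κ))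
    (s : Option (Bits (W.sig k))) (o : Option (Opening (W.n k) (C.rlen κ))) : Bits k × Bool :=
  match pk, M.com, s, o with
  | none, _, _, _ => (fun _ => false, false)
  | some pk, some F, some s, some f =>
      (M.inst, decide (∀ i ∈ W.S k s, C.commit κ pk (f i).1 (f i).2 = F i) &&
        W.J k M.inst s (restrict (fun i => (f i).1) (W.S k s)))
  | _, _, _, _ => (M.inst, false)

/-- The protocol between honest parties on input `(x, w)`. -/
noncomputable def honestZKPK (u : InW k q → Bool) : PMF (Bits k × Bool) :=
  (PMF.uniformOfFintype (Bits κ × Bits (W.sig k) × ProverCoins W C κ k)).map fun c =>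
    verifierOut W C κ k (some c.1) (proverMsg R W C κ k q u (some c.1) c.2.2) (some c.2.1)
      (proverOpen R W C κ k q u (some c.1) (some c.2.1) c.2.2)

/-- Wires to a dishonest prover: the two coins. -/
abbrev ToProverW : Type := Fin κ ⊕ Fin (W.sig k)

/-- Wires from a dishonest prover: reply to a coin-flip, first message, opening. -/
abbrev FromProverW : Type :=
  Unit ⊕ (MsgW k (W.n k) (C.clen κ) ⊕ OpenW (W.n k) (C.rlen κ))

/-- The protocol in the hybrid model with dishonest prover. In the four rounds she obtains the key
and replies `⊤` or `⊥`, sends her first message, obtains the challenge and replies `⊤` or `⊥`,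
and sends the opening. Wires that are not in use carry zeros and are ignored. -/
noncomputable def realProver :
    System (Bits κ × Bits (W.sig k)) Empty (OutW k) (ToProverW W κ k) (FromProverW W C κ k) where
  rounds := 4
  send _ c hist := match hist with
    | [] => Sum.elim c.1 (fun _ => false)
    | [r₀, r₁] =>
        if r₀ (.inl ()) ∧ (ProverMsg.read fun i => r₁ (.inr (.inl i))).com.isSome then
          Sum.elim (fun _ => false) c.2
        else fun _ => false
    | _ => fun _ => false
  result _ c hist := match hist with
    | [r₀, r₁, r₂, r₃] => verdict (verifierOut W C κ k (coin c.1 (r₀ (.inl ())))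
        (ProverMsg.read fun i => r₁ (.inr (.inl i))) (coin c.2 (r₂ (.inl ())))
        (readOpening fun i => r₃ (.inr (.inr i))))
    | _ => fun _ => false

/-- Wires to a dishonest verifier: the two coins, first message, opening. -/
abbrev ToVerifierW : Type :=
  Fin κ ⊕ (Fin (W.sig k) ⊕ (MsgW k (W.n k) (C.clen κ) ⊕ OpenW (W.n k) (C.rlen κ)))

/-- The protocol in the hybrid model with dishonest verifier. In the four rounds he obtains the key
and replies `⊤` or `⊥`, obtains the first message, obtains the challenge and replies `⊤` or `⊥`,
and obtains the opening. Wires that are not in use carry zeros. -/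
noncomputable def realVerifier :
    System (Bits κ × Bits (W.sig k) × ProverCoins W C κ k) (InW k q) Empty
      (ToVerifierW W C κ k) Unit where
  rounds := 4
  send u c hist := match hist with
    | [] => Sum.elim c.1 (fun _ => false)
    | [r₀] => Sum.elim (fun _ => false) (Sum.elim (fun _ => false) (Sum.elim
        (proverMsg R W C κ k q u (coin c.1 (r₀ ())) c.2.2).write (fun _ => false)))
    | [r₀, _] =>
        if (proverMsg R W C κ k q u (coin c.1 (r₀ ())) c.2.2).com.isSome then
          Sum.elim (fun _ => false) (Sum.elim c.2.1 (fun _ => false))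
        else fun _ => false
    | [r₀, _, r₂] => Sum.elim (fun _ => false) (Sum.elim (fun _ => false) (Sum.elim
        (fun _ => false) (writeOpening (proverOpen R W C κ k q u (coin c.1 (r₀ ()))
          (coin c.2.1 (r₂ ())) c.2.2))))
    | _ => fun _ => false
  result _ _ _ := Empty.elim

end Protocol

/-- The protocol with instances of length `ℓ κ` securely implements the functionality: it is
correct, and computationally secure against a dishonest prover and against a dishonest verifier. -/
def SecurelyImplementsZKPK (R : Set (List Bool × List Bool)) (W : WitnessEncoding)
    (C : CommitScheme) (q ℓ : ℕ → ℕ) : Prop :=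
  Correct (A := fun κ => InW (ℓ κ) (q (ℓ κ)) → Bool) (B := fun κ => Bits (ℓ κ) × Bool)
      (fun κ => honestZKPK R W C κ (ℓ κ) (q (ℓ κ))) (fun _ u => PMF.pure (funcZKPK R u)) ∧
    SecureAgainst (fun κ => realProver W C κ (ℓ κ))
      (fun κ => idealProver R (ℓ κ) (q (ℓ κ))) ∧
    SecureAgainst (fun κ => realVerifier R W C κ (ℓ κ) (q (ℓ κ)))
      (fun κ => idealVerifier R (ℓ κ) (q (ℓ κ)))

end QZK

/-!
The protocol is compared with the functionality through simulators that run the dishonest party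
once, without rewinding; this is what makes the argument go through for quantum adversaries.

*Circuits.* `Implements s inp out` says that one circuit with at most `s` gates and at most `s`
ancillas maps the operators `inp i` to `out i` for all `i`. The relation is closed under
composition, under tensoring with an untouched register and under sums, and contains all Boolean
maps that have small circuits. Executions are written with explicit operators, and their
implementations are assembled from these rules (`poly_implements_exec4`), which yields the
simulators (`Implements.exists_adversary`) and the reductions (`Implements.exists_distinguisher`) as families
of poly-size circuits.

*Correctness* is an identity of distributions, by completeness (`honestZKPK_eq_pure`).

*Dishonest verifier.* The simulator draws the key and the challenge `s` itself, before committing.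
It commits to the bits of `Ê(x, s)` in the positions that `s` selects and to zeros elsewhere. For
fixed sampler outcomes, the probability that a distinguisher accepts is a bounded function of the
classical messages sent to the verifier. Replacing the uniform key by a hiding key costs
`keyError`; under a hiding key the unopened commitments are exchanged one at a time, at
`hidingError` each (`abs_expect_committed_sub_le`); the opened bits have the right distribution by
simulatability (`abs_expect_real_sub_sim_le`). The bound at each sampler outcome is weighted with
the trace of the sampler's state, and these traces sum to `1`, so the total is negligible.

*Dishonest prover.* The simulator uses a binding key with its secret key, plays the honest
verifier, extracts the committed bits, and sends the decoded witness to the functionality if the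
verifier would accept, and an invalid witness otherwise. Uniform keys are replaced by hiding keys
statistically, and those by binding keys computationally: the sampler, the execution and the
distinguisher together form a distinguisher of keys (`negl_accept_sub_of_qIndist`). Under a
binding key, opened bits are equal to extracted bits, so the outputs differ only if the verifier
accepts while the extracted bits do not decode to a witness. The commitments are fixed before the
challenge, so by extractability this happens for at most one challenge and has probability at most
`2⁻¹ ^ σ` (`expect_extractionFails_le`).
-/

set_option linter.unusedSectionVars false

namespace QZK
open Matrix
open scoped ComplexOrder BigOperators

/-! ### Operators embedded into larger registers -/

section Embedding

variable {ω ω' ω'' : Type}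

open Classical in
/-- The operator `U ⊗ 1` on the wires `ω'`, with `U` acting on the image of `f`. -/
noncomputable def embedOp (f : ω ↪ ω') (U : Op ω) : Op ω' := fun x y =>
  if ∀ j, j ∉ Set.range f → x j = y j then U (x ∘ f) (y ∘ f) else 0

theorem embedOp_apply_of {f : ω ↪ ω'} {x y : ω' → Bool}
    (h : ∀ j, j ∉ Set.range f → x j = y j) (U : Op ω) :
    embedOp f U x y = U (x ∘ f) (y ∘ f) := if_pos h

theorem embedOp_apply_of_not {f : ω ↪ ω'} {x y : ω' → Bool}
    (h : ¬ ∀ j, j ∉ Set.range f → x j = y j) (U : Op ω) :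
    embedOp f U x y = 0 := if_neg h

theorem embedOp_trans (f : ω ↪ ω') (g : ω' ↪ ω'') (U : Op ω) :
    embedOp (f.trans g) U = embedOp g (embedOp f U) := by
  ext x y
  by_cases h : ∀ j, j ∉ Set.range (f.trans g) → x j = y j
  · have h1 : ∀ j, j ∉ Set.range g → x j = y j := fun j hj => h j (by
      rintro ⟨i, rfl⟩; exact hj ⟨f i, rfl⟩)
    have h2 : ∀ j, j ∉ Set.range f → (x ∘ g) j = (y ∘ g) j := fun j hj => h (g j) (by
      rintro ⟨i, hi⟩; exact hj ⟨i, g.injective hi⟩)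
    rw [embedOp_apply_of h, embedOp_apply_of h1, embedOp_apply_of h2]; rfl
  · rw [embedOp_apply_of_not h]
    by_cases h1 : ∀ j, j ∉ Set.range g → x j = y j
    · rw [embedOp_apply_of h1, embedOp_apply_of_not]
      intro h2
      apply h
      intro j hj
      by_cases hg : j ∈ Set.range g
      · obtain ⟨i, rfl⟩ := hg
        exact h2 i (by rintro ⟨k, rfl⟩; exact hj ⟨k, rfl⟩)
      · exact h1 j hg
    · rw [embedOp_apply_of_not h1]

theorem embedOp_one [Fintype ω] [DecidableEq ω] [Fintype ω'] [DecidableEq ω'] (f : ω ↪ ω') :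
    embedOp f (1 : Op ω) = 1 := by
  classical
  ext x y
  simp only [embedOp, Matrix.one_apply]
  by_cases h : x = y
  · subst h; simp
  · rw [if_neg h]
    split_ifs with h1 h2
    · exfalso; apply h; funext j
      by_cases hj : j ∈ Set.range f
      · obtain ⟨i, rfl⟩ := hj; exact congrFun h2 i
      · exact h1 j hj
    · rfl
    · rfl

theorem embedOp_conjTranspose (f : ω ↪ ω') (U : Op ω) :
    (embedOp f U)ᴴ = embedOp f Uᴴ := by
  classical
  ext x y
  simp only [embedOp, Matrix.conjTranspose_apply]
  have : (∀ j, j ∉ Set.range f → y j = x j) ↔ (∀ j, j ∉ Set.range f → x j = y j) :=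
    ⟨fun h j hj => (h j hj).symm, fun h j hj => (h j hj).symm⟩
  simp only [this]
  split_ifs <;> simp

theorem embedOp_mul [Fintype ω] [DecidableEq ω] [Fintype ω'] [DecidableEq ω'] (f : ω ↪ ω')
    (U V : Op ω) : embedOp f (U * V) = embedOp f U * embedOp f V := by
  classical
  ext x z
  rw [Matrix.mul_apply]
  by_cases h : ∀ j, j ∉ Set.range f → x j = z j
  · have : embedOp f (U * V) x z = ∑ w, U (x ∘ f) w * V w (z ∘ f) := by
      rw [embedOp_apply_of h, Matrix.mul_apply]
    rw [this]
    refine Finset.sum_of_injOn (fun w => Function.extend f w x) ?_ (by simp) ?_ ?_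
    · intro w _ w' _ hw
      funext i
      have := congrFun hw (f i)
      simpa [f.injective.extend_apply] using this
    · intro y _ hy
      by_cases hxy : ∀ j, j ∉ Set.range f → x j = y j
      · exfalso
        apply hy
        refine ⟨y ∘ f, by simp, ?_⟩
        funext j
        by_cases hj : j ∈ Set.range f
        · obtain ⟨i, rfl⟩ := hj
          exact f.injective.extend_apply _ _ _
        · exact (Function.extend_apply' _ _ _ hj).trans (hxy j hj)
      · rw [embedOp_apply_of_not hxy, zero_mul]
    · intro w _
      have h1 : Function.extend f w x ∘ f = w := by
        funext i; exact f.injective.extend_apply _ _ _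
      have h2 : ∀ j, j ∉ Set.range f → Function.extend f w x j = x j := fun j hj =>
        Function.extend_apply' _ _ _ hj
      rw [embedOp_apply_of (fun j hj => (h2 j hj).symm),
        embedOp_apply_of (fun j hj => (h2 j hj).trans (h j hj)), h1]
  · symm
    rw [embedOp_apply_of_not h]
    refine Finset.sum_eq_zero fun y _ => ?_
    by_cases h1 : ∀ j, j ∉ Set.range f → x j = y j
    · rw [embedOp_apply_of_not (x := y) (fun h2 => h fun j hj => (h1 j hj).trans (h2 j hj)),
        mul_zero]
    · rw [embedOp_apply_of_not h1, zero_mul]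

/-- Renaming the wires of an operator. -/
def reix (e : ω ≃ ω') (X : Op ω) : Op ω' := fun p q => X (p ∘ e) (q ∘ e)

theorem embedOp_equiv (e : ω ≃ ω') (U : Op ω) : embedOp e.toEmbedding U = reix e U := by
  ext x y
  exact embedOp_apply_of (fun j hj => absurd ⟨e.symm j, by simp⟩ hj) U

theorem reix_mul [Fintype ω] [DecidableEq ω] [Fintype ω'] [DecidableEq ω'] (e : ω ≃ ω')
    (U V : Op ω) : reix e (U * V) = reix e U * reix e V := by
  simp only [← embedOp_equiv, embedOp_mul]

theorem reix_conjTranspose (e : ω ≃ ω') (U : Op ω) : (reix e U)ᴴ = reix e Uᴴ := by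
  simp only [← embedOp_equiv, embedOp_conjTranspose]

end Embedding

theorem sum_sumArrow {α β : Type} [Fintype α] [DecidableEq α] [Fintype β] [DecidableEq β]
    {M : Type*} [AddCommMonoid M] (F : (α ⊕ β → Bool) → M) :
    ∑ p, F p = ∑ a : α → Bool, ∑ b : β → Bool, F (Sum.elim a b) := by
  rw [← Fintype.sum_prod_type']
  exact Fintype.sum_equiv (Equiv.sumArrowEquivProdArrow α β Bool) _ _ (fun p => by
    congr 1; funext i; cases i <;> rfl)

theorem sum_elim_eq_iff {α β γ : Type*} {a a' : α → γ} {b b' : β → γ} :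
    Sum.elim a b = Sum.elim a' b' ↔ a = a' ∧ b = b' := by
  constructor
  · intro h
    exact ⟨funext fun i => congrFun h (.inl i), funext fun i => congrFun h (.inr i)⟩
  · rintro ⟨rfl, rfl⟩; rfl

/-! ### The unitary of a circuit -/

section Circuits

variable {ω ω' ω'' : Type}

/-- A gate moved along an embedding of wires. -/
def QGate.map (f : ω ↪ ω') (g : QGate ω) : QGate ω' where
  arity := g.arity
  arity_le := g.arity_le
  wires := g.wires.trans f
  unitary := g.unitary

/-- A circuit moved along an embedding of wires. -/
def QCircuit.map (f : ω ↪ ω') (C : QCircuit ω) : QCircuit ω' := List.map (QGate.map f) C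

@[simp] theorem QCircuit.length_map (f : ω ↪ ω') (C : QCircuit ω) :
    (QCircuit.map f C).length = C.length := List.length_map _

theorem QGate.toOp_eq_embedOp (g : QGate ω) : g.toOp = embedOp g.wires g.unitary := rfl

theorem QGate.toOp_map (f : ω ↪ ω') (g : QGate ω) : (g.map f).toOp = embedOp f g.toOp := by
  rw [QGate.toOp_eq_embedOp, QGate.toOp_eq_embedOp, ← embedOp_trans]; rfl

variable [Fintype ω] [DecidableEq ω] [Fintype ω'] [DecidableEq ω']

theorem QGate.toOp_unitary (g : QGate ω) : g.toOpᴴ * g.toOp = 1 := by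
  rw [QGate.toOp_eq_embedOp, embedOp_conjTranspose, ← embedOp_mul, ← embedOp_one g.wires]
  congr 1
  exact (Matrix.mem_unitaryGroup_iff'.1 g.unitary.2)

theorem QCircuit.toOp_nil : QCircuit.toOp ([] : QCircuit ω) = 1 := rfl

theorem QCircuit.foldl_toOp (C : QCircuit ω) (M : Op ω) :
    C.foldl (fun M g => g.toOp * M) M = QCircuit.toOp C * M := by
  induction C generalizing M with
  | nil => simp [QCircuit.toOp_nil]
  | cons g C ih =>
    simp only [QCircuit.toOp, List.foldl_cons]
    rw [ih, ih (g.toOp * 1)]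
    simp [Matrix.mul_assoc]

theorem QCircuit.toOp_cons (g : QGate ω) (C : QCircuit ω) :
    QCircuit.toOp (g :: C) = QCircuit.toOp C * g.toOp := by
  have := QCircuit.foldl_toOp C g.toOp
  rw [← this]
  simp [QCircuit.toOp]

theorem QCircuit.toOp_append (C C' : QCircuit ω) :
    QCircuit.toOp (C ++ C') = QCircuit.toOp C' * QCircuit.toOp C := by
  induction C with
  | nil => simp [QCircuit.toOp_nil]
  | cons g C ih => rw [List.cons_append, toOp_cons, toOp_cons, ih, Matrix.mul_assoc]

theorem QCircuit.toOp_map (f : ω ↪ ω') (C : QCircuit ω) :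
    QCircuit.toOp (QCircuit.map f C) = embedOp f (QCircuit.toOp C) := by
  induction C with
  | nil => simp [QCircuit.map, QCircuit.toOp_nil, embedOp_one]
  | cons g C ih =>
    have : QCircuit.map f (g :: C) = g.map f :: QCircuit.map f C := rfl
    rw [this, toOp_cons, toOp_cons, ih, embedOp_mul, QGate.toOp_map]

theorem QCircuit.toOp_unitary (C : QCircuit ω) :
    (QCircuit.toOp C)ᴴ * QCircuit.toOp C = 1 := by
  induction C with
  | nil => simp [QCircuit.toOp_nil]
  | cons g C ih =>
    rw [toOp_cons, Matrix.conjTranspose_mul, Matrix.mul_assoc, ← Matrix.mul_assoc _ _ g.toOp, ih,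
      Matrix.one_mul, QGate.toOp_unitary]

theorem QCircuit.apply_nil (ρ : Op ω) : QCircuit.apply ([] : QCircuit ω) ρ = ρ := by
  simp [QCircuit.apply, QCircuit.toOp_nil]

theorem QCircuit.apply_append (C C' : QCircuit ω) (ρ : Op ω) :
    QCircuit.apply (C ++ C') ρ = QCircuit.apply C' (QCircuit.apply C ρ) := by
  simp only [QCircuit.apply, toOp_append, Matrix.conjTranspose_mul, Matrix.mul_assoc]

theorem QCircuit.apply_map_equiv (e : ω ≃ ω') (C : QCircuit ω) (ρ : Op ω) :
    QCircuit.apply (QCircuit.map e.toEmbedding C) (reix e ρ) = reix e (QCircuit.apply C ρ) := by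
  simp only [QCircuit.apply, toOp_map, embedOp_equiv, reix_mul, reix_conjTranspose]

end Circuits

/-! ### Circuits acting on one of two registers -/

section TwoRegisters

variable {α β γ : Type} [Fintype α] [DecidableEq α] [Fintype β] [DecidableEq β]
  [Fintype γ] [DecidableEq γ]

theorem embedOp_inl_apply (U : Op α) (a a' : α → Bool) (b b' : β → Bool) :
    embedOp (Function.Embedding.inl : α ↪ α ⊕ β) U (Sum.elim a b) (Sum.elim a' b') =
      if b = b' then U a a' else 0 := by
  have : (∀ j, j ∉ Set.range (Function.Embedding.inl : α ↪ α ⊕ β) →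
      (Sum.elim a b : α ⊕ β → Bool) j = (Sum.elim a' b' : α ⊕ β → Bool) j) ↔ b = b' := by
    constructor
    · intro h; funext i; simpa using h (.inr i) (by simp)
    · rintro rfl j hj
      cases j with
      | inl i => exact absurd ⟨i, rfl⟩ hj
      | inr i => rfl
  by_cases h : b = b'
  · rw [embedOp_apply_of (this.2 h), if_pos h]; rfl
  · rw [embedOp_apply_of_not (mt this.1 h), if_neg h]

theorem elim_comp_inl_inr {δ : Type*} (p : α ⊕ β → δ) :
    Sum.elim (p ∘ Sum.inl) (p ∘ Sum.inr) = p := by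
  funext i; cases i <;> rfl

theorem Op.ext_elim {X Y : Op (α ⊕ β)}
    (h : ∀ a b a' b', X (Sum.elim a b) (Sum.elim a' b') = Y (Sum.elim a b) (Sum.elim a' b')) :
    X = Y := by
  ext p q
  rw [← elim_comp_inl_inr p, ← elim_comp_inl_inr q]; exact h _ _ _ _

theorem tens_apply_elim (ρ : Op α) (τ : Op β) (a a' : α → Bool) (b b' : β → Bool) :
    tens ρ τ (Sum.elim a b) (Sum.elim a' b') = ρ a a' * τ b b' := rfl

theorem conj_inl_apply (U : Op α) (X : Op (α ⊕ β)) (a a' : α → Bool) (b b' : β → Bool) :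
    (embedOp Function.Embedding.inl U * X * (embedOp Function.Embedding.inl U)ᴴ :
      Op (α ⊕ β)) (Sum.elim a b) (Sum.elim a' b') =
    ∑ c', (∑ c, U a c * X (Sum.elim c b) (Sum.elim c' b')) * Uᴴ c' a' := by
  rw [embedOp_conjTranspose]
  simp only [Matrix.mul_apply, sum_sumArrow, embedOp_inl_apply, ite_mul, zero_mul, mul_ite, mul_zero]
  refine Finset.sum_congr rfl fun c _ => ?_
  simp [Finset.sum_ite_eq]

theorem QCircuit.tens_apply_left (C : QCircuit α) (ρ : Op α) (τ : Op β) :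
    tens (QCircuit.apply C ρ) τ =
      QCircuit.apply (QCircuit.map Function.Embedding.inl C) (tens ρ τ) := by
  apply Op.ext_elim
  intro a b a' b'
  rw [QCircuit.apply, QCircuit.apply, toOp_map, conj_inl_apply, tens_apply_elim]
  simp only [tens_apply_elim, Matrix.mul_apply, Finset.sum_mul]
  exact Finset.sum_congr rfl fun _ _ => Finset.sum_congr rfl fun _ _ => by ring

theorem QCircuit.traceRight_apply (C : QCircuit α) (X : Op (α ⊕ β)) :
    traceRight (QCircuit.apply (QCircuit.map Function.Embedding.inl C) X) =
      QCircuit.apply C (traceRight X) := by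
  ext a a'
  simp only [traceRight, QCircuit.apply, toOp_map, conj_inl_apply]
  simp only [Matrix.mul_apply, traceRight]
  rw [Finset.sum_comm]
  refine Finset.sum_congr rfl fun c _ => ?_
  rw [← Finset.sum_mul]
  congr 1
  rw [Finset.sum_comm]
  refine Finset.sum_congr rfl fun d _ => ?_
  rw [Finset.mul_sum]

theorem reix_tens {α' β' : Type} (e : α ≃ α') (f : β ≃ β') (ρ : Op α) (τ : Op β) :
    reix (Equiv.sumCongr e f) (tens ρ τ) = tens (reix e ρ) (reix f τ) := rfl

theorem reix_sumComm (ρ : Op α) (τ : Op β) :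
    reix (Equiv.sumComm α β) (tens ρ τ) = tens τ ρ := by
  ext p q; simp only [reix, tens]; rw [mul_comm]; rfl

theorem reix_sumAssoc (ρ : Op α) (τ : Op β) (υ : Op γ) :
    reix (Equiv.sumAssoc α β γ) (tens (tens ρ τ) υ) = tens ρ (tens τ υ) := by
  ext p q; simp only [reix, tens]; rw [mul_assoc]; rfl

theorem reix_sumAssoc_symm (ρ : Op α) (τ : Op β) (υ : Op γ) :
    reix (Equiv.sumAssoc α β γ).symm (tens ρ (tens τ υ)) = tens (tens ρ τ) υ := by
  ext p q; simp only [reix, tens]; rw [mul_assoc]; rfl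

theorem reix_reix {α β γ : Type} (e : α ≃ β) (f : β ≃ γ) (X : Op α) :
    reix f (reix e X) = reix (e.trans f) X := rfl

theorem reix_refl {α : Type} (X : Op α) : reix (Equiv.refl α) X = X := rfl

theorem ketBra_apply (m x y : α → Bool) : ketBra m x y = if m = x ∧ m = y then 1 else 0 := by
  simp [ketBra, Matrix.single_apply]

theorem tens_ketBra (a : α → Bool) (b : β → Bool) :
    tens (ketBra a) (ketBra b) = ketBra (Sum.elim a b) := by
  apply Op.ext_elim
  intro x y x' y'
  simp only [tens_apply_elim, ketBra_apply, sum_elim_eq_iff]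
  split_ifs <;> first | (exfalso; tauto) | simp

theorem reix_ketBra (e : α ≃ β) (m : α → Bool) : reix e (ketBra m) = ketBra (m ∘ e.symm) := by
  ext x y
  simp only [reix, ketBra_apply]
  have (x : β → Bool) : m = x ∘ e ↔ m ∘ e.symm = x := by
    constructor
    · rintro rfl; funext i; simp
    · rintro rfl; funext i; simp
  simp only [this]

theorem tens_zeroState : tens (zeroState α) (zeroState β) = zeroState (α ⊕ β) := by
  rw [zeroState, zeroState, tens_ketBra, zeroState]
  congr 1; funext i; cases i <;> rfl

theorem reix_zeroState (e : α ≃ β) : reix e (zeroState α) = zeroState β := by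
  rw [zeroState, reix_ketBra]; rfl

theorem traceRight_tens (ρ : Op α) (τ : Op β) :
    traceRight (tens ρ τ) = Matrix.trace τ • ρ := by
  ext a b
  simp only [traceRight, tens_apply_elim, ← Finset.mul_sum, Matrix.smul_apply, smul_eq_mul,
    Matrix.trace, Matrix.diag]
  rw [mul_comm]

theorem traceLeft_tens (ρ : Op α) (τ : Op β) :
    traceLeft (tens ρ τ) = Matrix.trace ρ • τ := by
  ext a b
  simp only [traceLeft, tens_apply_elim, ← Finset.sum_mul, Matrix.smul_apply, smul_eq_mul,
    Matrix.trace, Matrix.diag]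

theorem trace_ketBra (a : α → Bool) : Matrix.trace (ketBra a) = 1 := by
  simp [ketBra]

theorem outcome_tens (r : α → Bool) (ρ : Op α) (τ : Op β) :
    outcome r (tens ρ τ) = ρ r r • τ := rfl

theorem outcome_tens_ketBra (r a : α → Bool) (τ : Op β) :
    outcome r (tens (ketBra a) τ) = if a = r then τ else 0 := by
  rw [outcome_tens, ketBra_apply]
  split_ifs <;> simp_all

end TwoRegisters

/-! ### Positivity and traces -/

section Positivity

variable {α β : Type} [Fintype α] [DecidableEq α] [Fintype β] [DecidableEq β]

theorem posSemidef_outcome {X : Op (α ⊕ β)} (hX : X.PosSemidef) (r : α → Bool) :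
    (outcome r X).PosSemidef := hX.submatrix (Sum.elim r)

theorem posSemidef_traceLeft {X : Op (α ⊕ β)} (hX : X.PosSemidef) : (traceLeft X).PosSemidef := by
  have : traceLeft X = ∑ t : α → Bool, outcome t X := by
    ext a b; rw [Matrix.sum_apply]; rfl
  rw [this]
  exact Matrix.posSemidef_sum _ fun t _ => posSemidef_outcome hX t

theorem posSemidef_traceRight {X : Op (α ⊕ β)} (hX : X.PosSemidef) :
    (traceRight X).PosSemidef := by
  have : traceRight X = ∑ t : β → Bool, X.submatrix (fun a => Sum.elim a t)
      (fun a => Sum.elim a t) := by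
    ext a b; rw [Matrix.sum_apply]; rfl
  rw [this]
  exact Matrix.posSemidef_sum _ fun t _ => hX.submatrix _

theorem posSemidef_apply (C : QCircuit α) {X : Op α} (hX : X.PosSemidef) :
    (QCircuit.apply C X).PosSemidef := hX.mul_mul_conjTranspose_same _

theorem posSemidef_tens {ρ : Op α} {τ : Op β} (hρ : ρ.PosSemidef) (hτ : τ.PosSemidef) :
    (tens ρ τ).PosSemidef :=
  (hρ.kronecker hτ).submatrix (fun p => (p ∘ Sum.inl, p ∘ Sum.inr))

theorem posSemidef_ketBra (m : α → Bool) : (ketBra m).PosSemidef := by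
  have : ketBra m = Matrix.diagonal (fun x => if x = m then (1 : ℂ) else 0) := by
    ext x y; rw [ketBra_apply, Matrix.diagonal_apply]
    by_cases h : x = y
    · subst h; simp [eq_comm]
    · rw [if_neg h, if_neg]; rintro ⟨rfl, rfl⟩; exact h rfl
  rw [this]
  apply Matrix.PosSemidef.diagonal
  intro x; dsimp; split_ifs <;> simp

theorem trace_traceLeft (X : Op (α ⊕ β)) : (traceLeft X).trace = X.trace := by
  simp only [Matrix.trace, Matrix.diag, sum_sumArrow, traceLeft]
  rw [Finset.sum_comm]

theorem trace_traceRight (X : Op (α ⊕ β)) : (traceRight X).trace = X.trace := by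
  simp only [Matrix.trace, Matrix.diag, sum_sumArrow, traceRight]

theorem sum_trace_outcome (X : Op (α ⊕ β)) : ∑ r, (outcome r X).trace = X.trace := by
  simp only [Matrix.trace, Matrix.diag, sum_sumArrow, outcome]

theorem trace_apply (C : QCircuit α) (X : Op α) : (QCircuit.apply C X).trace = X.trace := by
  rw [QCircuit.apply, Matrix.trace_mul_comm, ← Matrix.mul_assoc, QCircuit.toOp_unitary,
    Matrix.one_mul]

theorem trace_tens (ρ : Op α) (τ : Op β) : (tens ρ τ).trace = ρ.trace * τ.trace := by
  rw [← trace_traceLeft, traceLeft_tens, Matrix.trace_smul, smul_eq_mul]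

theorem re_trace_nonneg {X : Op α} (hX : X.PosSemidef) : 0 ≤ X.trace.re :=
  (Complex.le_def.1 hX.trace_nonneg).1

end Positivity

/-! ### Maps between registers that are implemented by circuits -/

section Realization

variable {α β γ δ Z G Z' G' : Type} [Fintype α] [DecidableEq α] [Fintype β] [DecidableEq β]
  [Fintype γ] [DecidableEq γ] [Fintype δ] [DecidableEq δ]
  [Fintype Z] [DecidableEq Z] [Fintype G] [DecidableEq G]
  [Fintype Z'] [DecidableEq Z'] [Fintype G'] [DecidableEq G']

theorem tens_add_left (ρ ρ' : Op α) (τ : Op β) : tens (ρ + ρ') τ = tens ρ τ + tens ρ' τ := by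
  ext p q; simp [tens, add_mul]

theorem tens_smul_left (c : ℂ) (ρ : Op α) (τ : Op β) : tens (c • ρ) τ = c • tens ρ τ := by
  ext p q; simp [tens, mul_assoc]

theorem tens_smul_right (c : ℂ) (ρ : Op α) (τ : Op β) : tens ρ (c • τ) = c • tens ρ τ := by
  ext p q; simp [tens]; ring

theorem tens_sum_left {J : Type*} (s : Finset J) (ρ : J → Op α) (τ : Op β) :
    tens (∑ j ∈ s, ρ j) τ = ∑ j ∈ s, tens (ρ j) τ := by
  ext p q; simp [tens, Matrix.sum_apply, Finset.sum_mul]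

theorem tens_sum_right {J : Type*} (s : Finset J) (ρ : Op α) (τ : J → Op β) :
    tens ρ (∑ j ∈ s, τ j) = ∑ j ∈ s, tens ρ (τ j) := by
  ext p q; simp [tens, Matrix.sum_apply, Finset.mul_sum]

theorem tens_zero_right (ρ : Op α) : tens ρ (0 : Op β) = 0 := by
  ext p q; simp [tens]

theorem reix_sum {J : Type*} (s : Finset J) (e : α ≃ β) (X : J → Op α) :
    reix e (∑ j ∈ s, X j) = ∑ j ∈ s, reix e (X j) := by
  ext p q; simp [reix, Matrix.sum_apply]

/-- The linear map realized by a circuit: append zero wires `Z`, run the circuit `C`, rename the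
wires by `e` and trace out the wires `G`. -/
noncomputable def runL (e : α ⊕ Z ≃ β ⊕ G) (C : QCircuit (α ⊕ Z)) : Op α →ₗ[ℂ] Op β where
  toFun ρ := traceRight (reix e (C.apply (tens ρ (zeroState Z))))
  map_add' ρ ρ' := by
    rw [tens_add_left]
    ext a b
    simp only [QCircuit.apply, Matrix.mul_add, Matrix.add_mul, reix, traceRight, Matrix.add_apply,
      Finset.sum_add_distrib]
  map_smul' c ρ := by
    rw [tens_smul_left]
    ext a b
    simp only [QCircuit.apply, Matrix.mul_smul, Matrix.smul_mul, reix, traceRight,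
      Matrix.smul_apply, RingHom.id_apply, Finset.smul_sum]

theorem runL_apply (e : α ⊕ Z ≃ β ⊕ G) (C : QCircuit (α ⊕ Z)) (ρ : Op α) :
    runL e C ρ = traceRight (reix e (C.apply (tens ρ (zeroState Z)))) := rfl

/-- Exchange of the second and the third of three registers. -/
def swapR (α β γ : Type) : (α ⊕ β) ⊕ γ ≃ (α ⊕ γ) ⊕ β :=
  (Equiv.sumAssoc α β γ).trans
    ((Equiv.sumCongr (Equiv.refl α) (Equiv.sumComm β γ)).trans (Equiv.sumAssoc α γ β).symm)

theorem reix_swapR (ρ : Op α) (τ : Op β) (υ : Op γ) :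
    reix (swapR α β γ) (tens (tens ρ τ) υ) = tens (tens ρ υ) τ := by
  ext p q
  change ρ _ _ * τ _ _ * υ _ _ = ρ _ _ * υ _ _ * τ _ _
  rw [mul_right_comm]; rfl

theorem traceRight_reix_swapR (X : Op (α ⊕ β)) (τ : Op γ) :
    traceRight (reix (swapR α β γ) (tens X τ)) = tens (traceRight X) τ := by
  apply Op.ext_elim
  intro a c a' c'
  simp only [traceRight, tens_apply_elim, Finset.sum_mul]
  refine Finset.sum_congr rfl fun t _ => ?_
  simp only [reix]
  have h (a : α → Bool) (c : γ → Bool) : (Sum.elim (Sum.elim a c) t) ∘ swapR α β γ =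
      Sum.elim (Sum.elim a t) c := by
    funext i; rcases i with (i | i) | i <;> rfl
  rw [h, h]; rfl

theorem traceRight_reix_sumAssoc (X : Op ((α ⊕ β) ⊕ γ)) :
    traceRight (reix (Equiv.sumAssoc α β γ) X) = traceRight (traceRight X) := by
  ext a a'
  simp only [traceRight, sum_sumArrow, reix]
  refine Finset.sum_congr rfl fun t _ => Finset.sum_congr rfl fun t' _ => ?_
  congr 1 <;> (funext i; rcases i with (i | i) | i <;> rfl)

theorem traceRight_reix_sumCongr (e : α ≃ β) (X : Op (α ⊕ γ)) :
    traceRight (reix (Equiv.sumCongr e (Equiv.refl γ)) X) = reix e (traceRight X) := by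
  ext a a'
  simp only [traceRight, reix]
  refine Finset.sum_congr rfl fun t _ => ?_
  congr 1 <;> (funext i; rcases i with i | i <;> rfl)

/-- Run one circuit after the other on the union of the ancillas: the wires that the first one
discards are left alone by the second. -/
theorem runL_comp (e : α ⊕ Z ≃ β ⊕ G) (C : QCircuit (α ⊕ Z)) (e' : β ⊕ Z' ≃ γ ⊕ G')
    (C' : QCircuit (β ⊕ Z')) : ∃ (e'' : α ⊕ (Z ⊕ Z') ≃ γ ⊕ (G' ⊕ G))
      (C'' : QCircuit (α ⊕ (Z ⊕ Z'))), C''.length = C.length + C'.length ∧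
      ∀ ρ, runL e'' C'' ρ = runL e' C' (runL e C ρ) := by
  let a := Equiv.sumAssoc α Z Z'
  let h : (α ⊕ Z) ⊕ Z' ≃ (β ⊕ Z') ⊕ G :=
    (Equiv.sumCongr e (Equiv.refl Z')).trans (swapR β G Z')
  refine ⟨a.symm.trans (h.trans ((Equiv.sumCongr e' (Equiv.refl G)).trans
      (Equiv.sumAssoc γ G' G))),
    QCircuit.map a.toEmbedding (QCircuit.map Function.Embedding.inl C) ++
      QCircuit.map (h.symm.trans a).toEmbedding (QCircuit.map Function.Embedding.inl C'),
    by simp, fun ρ => ?_⟩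
  rw [runL_apply, QCircuit.apply_append, ← tens_zeroState, ← reix_sumAssoc,
    QCircuit.apply_map_equiv, ← QCircuit.tens_apply_left]
  set Y := QCircuit.apply C (tens ρ (zeroState Z))
  have h1 : reix a (tens Y (zeroState Z')) =
      reix (h.symm.trans a) (reix h (tens Y (zeroState Z'))) := by
    rw [reix_reix]; congr 1; ext i; simp
  rw [h1, QCircuit.apply_map_equiv, reix_reix]
  have h2 : (h.symm.trans a).trans (a.symm.trans (h.trans ((Equiv.sumCongr e' (Equiv.refl G)).trans
      (Equiv.sumAssoc γ G' G)))) = (Equiv.sumCongr e' (Equiv.refl G)).trans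
      (Equiv.sumAssoc γ G' G) := by ext i; simp
  rw [h2, ← reix_reix, traceRight_reix_sumAssoc, traceRight_reix_sumCongr,
    QCircuit.traceRight_apply]
  have h3 : reix h (tens Y (zeroState Z')) = reix (swapR β G Z') (tens (reix e Y) (zeroState Z')) := rfl
  rw [h3, traceRight_reix_swapR]
  rfl

/-- A circuit can be run next to a register that it does not touch. -/
theorem runL_frame (e : α ⊕ Z ≃ β ⊕ G) (C : QCircuit (α ⊕ Z)) :
    ∃ (e'' : (α ⊕ δ) ⊕ Z ≃ (β ⊕ δ) ⊕ G) (C'' : QCircuit ((α ⊕ δ) ⊕ Z)),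
      C''.length = C.length ∧ ∀ ρ (τ : Op δ), runL e'' C'' (tens ρ τ) = tens (runL e C ρ) τ := by
  refine ⟨(swapR α δ Z).trans ((Equiv.sumCongr e (Equiv.refl δ)).trans (swapR β G δ)),
    QCircuit.map (swapR α Z δ).toEmbedding (QCircuit.map Function.Embedding.inl C), by simp,
    fun ρ τ => ?_⟩
  rw [runL_apply, ← reix_swapR, QCircuit.apply_map_equiv, ← QCircuit.tens_apply_left]
  set Y := QCircuit.apply C (tens ρ (zeroState Z))
  rw [reix_reix]
  have h2 : (swapR α Z δ).trans ((swapR α δ Z).trans ((Equiv.sumCongr e (Equiv.refl δ)).trans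
      (swapR β G δ))) = (Equiv.sumCongr e (Equiv.refl δ)).trans (swapR β G δ) := by
    ext i; rcases i with (i | i) | i <;> rfl
  rw [h2, ← reix_reix, reix_tens, traceRight_reix_swapR]
  rfl

end Realization

section Implements

variable {α β γ δ : Type} [Fintype α] [DecidableEq α] [Fintype β] [DecidableEq β]
  [Fintype γ] [DecidableEq γ] [Fintype δ] [DecidableEq δ] {I K : Type} {s t : ℕ}

/-- Some circuit with at most `s` gates and `s` ancillas, followed by a partial trace, takes the
state `inp i` to `out i` for every `i`. -/
def Implements (s : ℕ) (inp : I → Op α) (out : I → Op β) : Prop :=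
  ∃ (Z G : Type) (_ : Fintype Z) (_ : DecidableEq Z) (_ : Fintype G) (_ : DecidableEq G)
    (e : α ⊕ Z ≃ β ⊕ G) (C : QCircuit (α ⊕ Z)), Fintype.card Z ≤ s ∧ C.length ≤ s ∧
      ∀ i, runL e C (inp i) = out i

theorem Implements.mono {inp : I → Op α} {out : I → Op β} (h : Implements s inp out)
    (hst : s ≤ t) : Implements t inp out := by
  obtain ⟨Z, G, iZ, dZ, iG, dG, e, C, h1, h2, h3⟩ := h
  exact ⟨Z, G, iZ, dZ, iG, dG, e, C, h1.trans hst, h2.trans hst, h3⟩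

theorem Implements.congr {inp inp' : I → Op α} {out out' : I → Op β} (h : Implements s inp out)
    (h1 : ∀ i, inp' i = inp i) (h2 : ∀ i, out' i = out i) : Implements s inp' out' := by
  obtain rfl : inp' = inp := funext h1
  obtain rfl : out' = out := funext h2
  exact h

theorem Implements.trans {inp : I → Op α} {mid : I → Op β} {out : I → Op γ}
    (h : Implements s inp mid) (h' : Implements t mid out) : Implements (s + t) inp out := by
  obtain ⟨Z, G, iZ, dZ, iG, dG, e, C, h1, h2, h3⟩ := h
  obtain ⟨Z', G', _, _, _, _, e', C', h1', h2', h3'⟩ := h'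
  obtain ⟨e'', C'', hl, h''⟩ := runL_comp e C e' C'
  refine ⟨Z ⊕ Z', G' ⊕ G, inferInstance, inferInstance, inferInstance, inferInstance, e'', C'',
    ?_, ?_, fun i => ?_⟩
  · rw [Fintype.card_sum]; omega
  · omega
  · rw [h'', h3, h3']

/-- An implemented map may be run next to an arbitrary operator on a further register. -/
theorem Implements.frame {inp : I → Op α} {out : I → Op β} (h : Implements s inp out) :
    Implements s (fun p : I × Op δ => tens (inp p.1) p.2) (fun p => tens (out p.1) p.2) := by
  obtain ⟨Z, G, iZ, dZ, iG, dG, e, C, h1, h2, h3⟩ := h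
  obtain ⟨e'', C'', hl, h''⟩ := runL_frame (δ := δ) e C
  exact ⟨Z, G, iZ, dZ, iG, dG, e'', C'', h1, hl.trans_le h2, fun p => by rw [h'', h3]⟩

theorem Implements.comap {inp : I → Op α} {out : I → Op β} (h : Implements s inp out)
    (f : K → I) : Implements s (fun k => inp (f k)) (fun k => out (f k)) := by
  obtain ⟨Z, G, iZ, dZ, iG, dG, e, C, h1, h2, h3⟩ := h
  exact ⟨Z, G, iZ, dZ, iG, dG, e, C, h1, h2, fun k => h3 _⟩

theorem Implements.sum {inp : I → Op α} {out : I → Op β} (h : Implements s inp out) {J : Type}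
    [Fintype J] (f : K → J → I) :
    Implements s (fun k => ∑ j, inp (f k j)) (fun k => ∑ j, out (f k j)) := by
  obtain ⟨Z, G, iZ, dZ, iG, dG, e, C, h1, h2, h3⟩ := h
  exact ⟨Z, G, iZ, dZ, iG, dG, e, C, h1, h2, fun k => by simp only [map_sum, h3]⟩

theorem Implements.smul {inp : I → Op α} {out : I → Op β} (h : Implements s inp out) (c : I → ℂ) :
    Implements s (fun i => c i • inp i) (fun i => c i • out i) := by
  obtain ⟨Z, G, iZ, dZ, iG, dG, e, C, h1, h2, h3⟩ := h
  exact ⟨Z, G, iZ, dZ, iG, dG, e, C, h1, h2, fun k => by rw [map_smul, h3]⟩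

theorem tens_zeroState_empty (ρ : Op α) :
    tens ρ (zeroState Empty) = reix (Equiv.sumEmpty α Empty).symm ρ := by
  ext p q
  simp only [tens, zeroState, ketBra_apply, reix]
  rw [if_pos ⟨Subsingleton.elim _ _, Subsingleton.elim _ _⟩, mul_one]; rfl

theorem traceRight_empty (X : Op (α ⊕ Empty)) :
    traceRight X = reix (Equiv.sumEmpty α Empty) X := by
  ext a b
  simp only [traceRight, reix, Finset.univ_unique, Finset.sum_singleton]
  congr 1 <;> (funext i; rcases i with i | i <;> [rfl; exact i.elim])

theorem implements_reix (e : α ≃ β) : Implements 0 (fun ρ : Op α => ρ) (fun ρ => reix e ρ) := by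
  refine ⟨Empty, Empty, inferInstance, inferInstance, inferInstance, inferInstance,
    Equiv.sumCongr e (Equiv.refl Empty), [], by simp, by simp, fun ρ => ?_⟩
  rw [runL_apply, QCircuit.apply_nil, tens_zeroState_empty, traceRight_empty, reix_reix, reix_reix]
  rfl

theorem implements_refl : Implements 0 (fun ρ : Op α => ρ) (fun ρ => ρ) :=
  implements_reix (Equiv.refl α)

theorem implements_tens_zeroState :
    Implements (Fintype.card β) (fun ρ : Op α => ρ) (fun ρ => tens ρ (zeroState β)) := by
  refine ⟨β, Empty, inferInstance, inferInstance, inferInstance, inferInstance,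
    (Equiv.sumEmpty (α ⊕ β) Empty).symm, [], le_rfl, by simp, fun ρ => ?_⟩
  rw [runL_apply, QCircuit.apply_nil, traceRight_empty, reix_reix]
  simp [reix_refl]

theorem implements_traceRight :
    Implements 0 (fun ρ : Op (α ⊕ β) => ρ) (fun ρ => traceRight ρ) := by
  refine ⟨Empty, β, inferInstance, inferInstance, inferInstance, inferInstance,
    (Equiv.sumEmpty (α ⊕ β) Empty), [], by simp, by simp, fun ρ => ?_⟩
  rw [runL_apply, QCircuit.apply_nil, tens_zeroState_empty, reix_reix]
  simp [reix_refl]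

theorem implements_apply (C : QCircuit α) :
    Implements C.length (fun ρ : Op α => ρ) (fun ρ => C.apply ρ) := by
  refine ⟨Empty, Empty, inferInstance, inferInstance, inferInstance, inferInstance,
    Equiv.refl _, QCircuit.map Function.Embedding.inl C, by simp, by simp, fun ρ => ?_⟩
  rw [runL_apply, ← QCircuit.tens_apply_left, tens_zeroState_empty, traceRight_empty, reix_reix,
    reix_reix]
  simp [reix_refl]

theorem Implements.reix {inp : I → Op α} {out : I → Op β} (h : Implements s inp out) (e : β ≃ γ) :
    Implements s inp (fun i => QZK.reix e (out i)) :=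
  (h.trans ((implements_reix e).comap out)).mono le_rfl

theorem Implements.traceRight {inp : I → Op α} {out : I → Op (β ⊕ γ)}
    (h : Implements s inp out) : Implements s inp (fun i => traceRight (out i)) :=
  (h.trans (implements_traceRight.comap out)).mono le_rfl

theorem Implements.apply {inp : I → Op α} {out : I → Op β} (h : Implements s inp out)
    (C : QCircuit β) : Implements (s + C.length) inp (fun i => C.apply (out i)) :=
  h.trans ((implements_apply C).comap out)

theorem Implements.tens_zeroState {inp : I → Op α} {out : I → Op β} (h : Implements s inp out)
    (γ : Type) [Fintype γ] [DecidableEq γ] :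
    Implements (s + Fintype.card γ) inp (fun i => tens (out i) (zeroState γ)) :=
  h.trans ((implements_tens_zeroState).comap out)

theorem Implements.pre_reix {inp : I → Op α} {out : I → Op β} (h : Implements s inp out)
    (e : α ≃ γ) : Implements s (fun i => QZK.reix e (inp i)) out := by
  have h1 := ((implements_reix e.symm).comap (fun i => QZK.reix e (inp i)))
  have h2 := h1.trans (h.congr (fun i => by rw [reix_reix]; simp [reix_refl]) (fun i => rfl))
  exact h2.mono (by omega)

theorem traceLeft_eq_traceRight (X : Op (α ⊕ β)) :
    traceLeft X = QZK.traceRight (QZK.reix (Equiv.sumComm α β) X) := by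
  ext a b
  simp only [traceLeft, QZK.traceRight, QZK.reix]
  refine Finset.sum_congr rfl fun t _ => ?_
  congr 1 <;> (funext i; rcases i with i | i <;> rfl)

theorem Implements.traceLeft {inp : I → Op α} {out : I → Op (β ⊕ γ)}
    (h : Implements s inp out) : Implements s inp (fun i => traceLeft (out i)) :=
  ((h.reix (Equiv.sumComm β γ)).traceRight).congr (fun _ => rfl)
    (fun _ => traceLeft_eq_traceRight _)

theorem Implements.frameLeft {inp : I → Op α} {out : I → Op β} (h : Implements s inp out) :
    Implements s (fun p : Op δ × I => tens p.1 (inp p.2)) (fun p => tens p.1 (out p.2)) := by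
  have h1 := (h.frame (δ := δ)).comap (fun p : Op δ × I => (p.2, p.1))
  exact ((h1.reix (Equiv.sumComm β δ)).pre_reix (Equiv.sumComm α δ)).congr
    (fun p => (reix_sumComm _ _).symm) (fun p => (reix_sumComm _ _).symm)

end Implements

/-! ### Elementary gates -/

section Gates

variable {α β γ ω : Type} [Fintype α] [DecidableEq α] [Fintype β] [DecidableEq β]
  [Fintype γ] [DecidableEq γ] [Fintype ω] [DecidableEq ω] {n : ℕ}

/-- The matrix that maps the basis state `x` to `π x`. -/
def permMatrix (π : Bits n → Bits n) : Matrix (Bits n) (Bits n) ℂ :=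
  Matrix.of fun a b => if a = π b then 1 else 0

theorem permMatrix_mem {π : Bits n → Bits n} (hπ : Function.Involutive π) :
    permMatrix π ∈ Matrix.unitaryGroup (Bits n) ℂ := by
  rw [Matrix.mem_unitaryGroup_iff]
  ext a b
  rw [Matrix.mul_apply, Matrix.one_apply, Finset.sum_eq_single (π a)]
  · simp only [permMatrix, Matrix.of_apply, hπ a, if_true, one_mul, Matrix.star_apply]
    by_cases h : a = b
    · simp [h]
    · simp [h, Ne.symm h]
  · intro c _ hc
    simp only [permMatrix, Matrix.of_apply]
    rw [if_neg, zero_mul]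
    rintro rfl
    exact hc (hπ c).symm
  · simp

/-- The gate that replaces the value `x` of the wires `f` by `π x`, for an involution `π`. -/
def permGate (f : Fin n ↪ ω) (hn : n ≤ 3) (π : Bits n → Bits n) (hπ : Function.Involutive π) :
    QGate ω where
  arity := n
  arity_le := hn
  wires := f
  unitary := ⟨permMatrix π, permMatrix_mem hπ⟩

theorem permGate_apply (f : Fin n ↪ ω) (hn : n ≤ 3) (π : Bits n → Bits n)
    (hπ : Function.Involutive π) (X : Op ω) (p q : ω → Bool) :
    QCircuit.apply [permGate f hn π hπ] X p q =
      X (Function.extend f (π (p ∘ f)) p) (Function.extend f (π (q ∘ f)) q) := by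
  have key : ∀ x y : ω → Bool, (permGate f hn π hπ).toOp x y =
      if y = Function.extend f (π (x ∘ f)) x then 1 else 0 := by
    intro x y
    have hop : (permGate f hn π hπ).toOp = embedOp f (permMatrix π) := rfl
    rw [hop]
    have hiff : y = Function.extend f (π (x ∘ f)) x ↔
        (∀ j, j ∉ Set.range f → x j = y j) ∧ x ∘ f = π (y ∘ f) := by
      constructor
      · rintro rfl
        refine ⟨fun j hj => (Function.extend_apply' _ _ _ hj).symm, ?_⟩
        have : Function.extend f (π (x ∘ f)) x ∘ f = π (x ∘ f) := by
          funext i; exact f.injective.extend_apply _ _ _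
        rw [this, hπ]
      · rintro ⟨h1, h2⟩
        funext j
        by_cases hj : j ∈ Set.range f
        · obtain ⟨i, rfl⟩ := hj
          rw [f.injective.extend_apply, h2, hπ]; rfl
        · rw [Function.extend_apply' _ _ _ hj, h1 j hj]
    by_cases h : ∀ j, j ∉ Set.range f → x j = y j
    · rw [embedOp_apply_of h]
      exact if_congr (by rw [hiff]; exact ⟨fun h' => ⟨h, h'⟩, fun h' => h'.2⟩) rfl rfl
    · rw [embedOp_apply_of_not h, if_neg]
      rw [hiff]; exact fun h' => h h'.1
  rw [QCircuit.apply, QCircuit.toOp_cons, QCircuit.toOp_nil, Matrix.one_mul, Matrix.mul_apply]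
  simp only [Matrix.conjTranspose_apply, key, Matrix.mul_apply]
  rw [Finset.sum_eq_single (Function.extend f (π (q ∘ f)) q)]
  · rw [Finset.sum_eq_single (Function.extend f (π (p ∘ f)) p)]
    · simp
    · intro c _ hc; rw [if_neg hc, zero_mul]
    · simp
  · intro c _ hc; rw [if_neg hc]; simp
  · simp

/-- The gate that adds `g` of the other wires to the first of the wires `f`. -/
def toggleGate (f : Fin (n + 1) ↪ ω) (hn : n + 1 ≤ 3) (g : Bits n → Bool) : QGate ω :=
  permGate f hn (fun x => Fin.cons (x 0 ^^ g (Fin.tail x)) (Fin.tail x)) (fun x => by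
    simp [Fin.cons_self_tail])

/-- The basis state produced by `toggleGate`. -/
def toggle (f : Fin (n + 1) ↪ ω) (g : Bits n → Bool) (p : ω → Bool) : ω → Bool :=
  Function.update p (f 0) (p (f 0) ^^ g (fun i => p (f i.succ)))

theorem toggle_toggle (f : Fin (n + 1) ↪ ω) (g : Bits n → Bool) (p : ω → Bool) :
    toggle f g (toggle f g p) = p := by
  simp [toggle]

theorem toggleGate_apply (f : Fin (n + 1) ↪ ω) (hn : n + 1 ≤ 3) (g : Bits n → Bool) (X : Op ω)
    (p q : ω → Bool) : QCircuit.apply [toggleGate f hn g] X p q =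
      X (toggle f g p) (toggle f g q) := by
  have h : ∀ p : ω → Bool, Function.extend f (Fin.cons ((p ∘ f) 0 ^^ g (Fin.tail (p ∘ f)))
      (Fin.tail (p ∘ f))) p = toggle f g p := by
    intro p
    funext j
    by_cases hj : j ∈ Set.range f
    · obtain ⟨i, rfl⟩ := hj
      rw [f.injective.extend_apply]
      refine Fin.cases ?_ (fun i => ?_) i
      · simp [toggle]; rfl
      · simp [toggle, Fin.tail]
    · rw [Function.extend_apply' _ _ _ hj, toggle, Function.update_of_ne]
      rintro rfl; exact hj ⟨0, rfl⟩
  exact (permGate_apply f hn _ _ X p q).trans (by rw [h, h])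

theorem toggleGate_ketBra (f : Fin (n + 1) ↪ ω) (hn : n + 1 ≤ 3) (g : Bits n → Bool)
    (m : ω → Bool) : QCircuit.apply [toggleGate f hn g] (ketBra m) = ketBra (toggle f g m) := by
  ext p q
  rw [toggleGate_apply, ketBra_apply, ketBra_apply]
  have h (p : ω → Bool) : m = toggle f g p ↔ toggle f g m = p :=
    ⟨fun h => by rw [h, toggle_toggle], fun h => by rw [← h, toggle_toggle]⟩
  simp only [h]

/-- A new wire, followed by the wires `c`. -/
def freshWires (c : Fin n ↪ ω) : Fin (n + 1) ↪ ω ⊕ Unit where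
  toFun := Fin.cons (.inr ()) (fun i => .inl (c i))
  inj' := by
    rw [Fin.cons_injective_iff]
    refine ⟨by simp, fun i j h => c.injective (by simpa using h)⟩

theorem toggle_freshWires (c : Fin n ↪ ω) (g : Bits n → Bool) (x : ω → Bool) (y : Unit → Bool) :
    toggle (freshWires c) g (Sum.elim x y) =
      Sum.elim x (fun _ => y () ^^ g (fun i => x (c i))) := by
  funext j
  rcases j with j | j
  · rw [toggle, Function.update_of_ne (by simp [freshWires])]; rfl
  · simp [toggle, freshWires]

theorem implements_appendBit (c : Fin n ↪ ω) (hn : n + 1 ≤ 3) (g : Bits n → Bool) :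
    Implements 2 (fun x : ω → Bool => ketBra x)
      (fun x => ketBra (Sum.elim x (fun _ : Unit => g (fun i => x (c i))))) := by
  have h := ((implements_tens_zeroState (α := ω) (β := Unit)).comap
    (fun x : ω → Bool => ketBra x)).apply [toggleGate (freshWires c) hn g]
  refine (h.mono (by simp)).congr (fun _ => rfl) (fun x => ?_)
  rw [zeroState, tens_ketBra, toggleGate_ketBra, toggle_freshWires]
  simp

theorem sum_unit {M : Type*} [AddCommMonoid M] (F : (Unit → Bool) → M) :
    ∑ t, F t = F (fun _ => true) + F (fun _ => false) := by
  rw [Fintype.sum_equiv (Equiv.funUnique Unit Bool) F (fun b => F (fun _ => b)) (fun x => by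
    congr 1), Fintype.sum_bool]

/-- Setting to zero the entries of an operator that are off-diagonal in the wires `L`. -/
noncomputable def dephase (L : List ω) (X : Op ω) : Op ω := fun p q =>
  if ∀ i ∈ L, p i = q i then X p q else 0

/-- Copying a wire to an ancilla that is then discarded measures the wire. -/
theorem implements_dephase_one (i : ω) :
    Implements 2 (fun X : Op ω => X) (fun X => dephase [i] X) := by
  let c : Fin 1 ↪ ω := ⟨fun _ => i, fun _ _ _ => Subsingleton.elim _ _⟩
  have h := ((implements_tens_zeroState (α := ω) (β := Unit)).apply
    [toggleGate (freshWires c) (by norm_num) (fun x => x 0)]).traceRight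
  refine (h.mono (by simp)).congr (fun _ => rfl) (fun X => ?_)
  ext p q
  simp only [traceRight, toggleGate_apply, toggle_freshWires, tens_apply_elim, zeroState,
    ketBra_apply, dephase, List.mem_singleton, forall_eq, sum_unit, funext_iff, forall_const]
  change (if p i = q i then X p q else 0) = X p q * (if _ = (_ ^^ p i) ∧ _ = (_ ^^ q i) then 1 else 0) +
    X p q * (if _ = (_ ^^ p i) ∧ _ = (_ ^^ q i) then 1 else 0)
  cases p i <;> cases q i <;> simp

theorem implements_dephase (L : List ω) :
    Implements (2 * L.length) (fun X : Op ω => X) (fun X => dephase L X) := by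
  induction L with
  | nil => exact implements_refl.congr (fun _ => rfl) (fun X => by ext p q; simp [dephase])
  | cons i L ih =>
    refine ((ih.trans ((implements_dephase_one i).comap (fun X => dephase L X))).mono
      (by simp; omega)).congr (fun _ => rfl) (fun X => ?_)
    ext p q
    simp only [dephase, List.mem_cons, forall_eq_or_imp, List.not_mem_nil, or_false, forall_eq]
    split_ifs <;> first | rfl | (exfalso; tauto)

/-- Measuring the left register, with the outcome kept. -/
theorem implements_measureLeft :
    Implements (2 * Fintype.card α) (fun X : Op (α ⊕ β) => X)
      (fun X => ∑ r : α → Bool, tens (ketBra r) (outcome r X)) := by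
  have h := implements_dephase ((Finset.univ : Finset α).toList.map (Sum.inl : α → α ⊕ β))
  refine (h.mono (by simp)).congr (fun _ => rfl) (fun X => ?_)
  apply Op.ext_elim
  intro a b a' b'
  rw [Matrix.sum_apply]
  simp only [tens_apply_elim, dephase, ketBra_apply, List.mem_map, Finset.mem_toList,
    Finset.mem_univ, true_and, forall_exists_index, forall_apply_eq_imp_iff, Sum.elim_inl]
  by_cases h : a = a'
  · subst h
    rw [Finset.sum_eq_single a]
    · simp [outcome]
    · intro c _ hc; simp [hc]
    · simp
  · rw [if_neg (fun h' => h (funext h'))]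
    apply Finset.sum_eq_zero
    intro r _
    rw [if_neg, zero_mul]
    rintro ⟨rfl, h2⟩; exact h h2

theorem inv_sqrt_two_mul_self : ((√2 : ℝ) : ℂ)⁻¹ * ((√2 : ℝ) : ℂ)⁻¹ = 2⁻¹ := by
  rw [← mul_inv, ← Complex.ofReal_mul, Real.mul_self_sqrt (by norm_num)]; simp

/-- The Hadamard matrix. -/
noncomputable def hadamard : Matrix (Bits 1) (Bits 1) ℂ :=
  Matrix.of fun a b => ((√2 : ℝ) : ℂ)⁻¹ * if a 0 && b 0 then -1 else 1

theorem hadamard_mem : hadamard ∈ Matrix.unitaryGroup (Bits 1) ℂ := by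
  rw [Matrix.mem_unitaryGroup_iff]
  ext a b
  rw [Matrix.mul_apply, Fintype.sum_equiv (Equiv.funUnique (Fin 1) Bool) _
    (fun c => (((√2 : ℝ) : ℂ)⁻¹ * if a 0 && c then -1 else 1) *
      (((√2 : ℝ) : ℂ)⁻¹ * if b 0 && c then -1 else 1)), Fintype.sum_bool, Matrix.one_apply]
  · have hab : a = b ↔ a 0 = b 0 :=
      ⟨fun h => by rw [h], fun h => funext fun i => by rw [Subsingleton.elim i 0, h]⟩
    rw [if_congr hab rfl rfl]
    have h1 (x y : ℂ) : ((√2 : ℝ) : ℂ)⁻¹ * x * (((√2 : ℝ) : ℂ)⁻¹ * y) = 2⁻¹ * (x * y) := by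
      rw [mul_mul_mul_comm, inv_sqrt_two_mul_self]
    rw [h1, h1]
    cases a 0 <;> cases b 0 <;> simp <;> norm_num
  · intro c
    simp only [Matrix.star_apply, hadamard, Matrix.of_apply]
    congr 1
    simp only [Complex.star_def, map_mul, map_inv₀, Complex.conj_ofReal]
    congr 1
    have : (Equiv.funUnique (Fin 1) Bool) c = c 0 := rfl
    rw [this]
    cases b 0 <;> cases c 0 <;> simp

/-- The Hadamard gate on a single wire. -/
noncomputable def hadamardGate (i : ω) : QGate ω where
  arity := 1
  arity_le := by norm_num
  wires := ⟨fun _ => i, fun _ _ _ => Subsingleton.elim _ _⟩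
  unitary := ⟨hadamard, hadamard_mem⟩

/-- Uniformly random bits on the wires `ω`. -/
noncomputable def uniformState (ω : Type) [Fintype ω] [DecidableEq ω] : Op ω :=
  (Fintype.card (ω → Bool) : ℂ)⁻¹ • ∑ c : ω → Bool, ketBra c

theorem uniformState_apply (p q : ω → Bool) :
    uniformState ω p q = if p = q then (Fintype.card (ω → Bool) : ℂ)⁻¹ else 0 := by
  rw [uniformState, Matrix.smul_apply, Matrix.sum_apply, smul_eq_mul]
  simp only [ketBra_apply]
  by_cases h : p = q
  · subst h; simp
  · rw [if_neg h, Finset.sum_eq_zero, mul_zero]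
    intro c _; rw [if_neg]; rintro ⟨rfl, h2⟩; exact h h2

theorem tens_uniformState : tens (uniformState α) (uniformState β) = uniformState (α ⊕ β) := by
  apply Op.ext_elim
  intro a b a' b'
  simp only [tens_apply_elim, uniformState_apply, sum_elim_eq_iff]
  by_cases h1 : a = a' <;> by_cases h2 : b = b' <;> simp [h1, h2, pow_add, mul_comm]

theorem reix_uniformState (e : α ≃ β) : reix e (uniformState α) = uniformState β := by
  ext p q
  simp only [reix, uniformState_apply]
  have : p ∘ e = q ∘ e ↔ p = q := e.surjective.injective_comp_right.eq_iff
  simp only [this, Fintype.card_fun, Fintype.card_congr e]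

theorem implements_uniform_one :
    Implements 4 (fun ρ : Op α => ρ) (fun ρ => tens ρ (uniformState Unit)) := by
  have h1 := (implements_refl (α := Unit)).comap (fun _ : Unit => zeroState Unit)
  have h2 := (h1.apply [hadamardGate ()])
  have h3 := h2.trans ((implements_dephase_one ()).comap (fun _ : Unit =>
    QCircuit.apply [hadamardGate ()] (zeroState Unit)))
  have h4 : dephase [()] (QCircuit.apply [hadamardGate ()] (zeroState Unit)) =
      uniformState Unit := by
    have hs := inv_sqrt_two_mul_self
    have hop : ∀ x y : Unit → Bool, (hadamardGate ()).toOp x y =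
        ((√2 : ℝ) : ℂ)⁻¹ * if x () && y () then -1 else 1 := by
      intro x y
      have hr : ∀ j, j ∉ Set.range (hadamardGate ()).wires → x j = y j :=
        fun j hj => absurd ⟨(0 : Fin 1), rfl⟩ hj
      exact if_pos hr
    ext p q
    rw [uniformState_apply]
    have hpq : (∀ i ∈ [()], p i = q i) ↔ p = q :=
      ⟨fun h => funext fun i => h i (by simp), fun h i _ => by rw [h]⟩
    simp only [dephase, hpq]
    by_cases h : p = q
    · rw [if_pos h, if_pos h, QCircuit.apply, QCircuit.toOp_cons, QCircuit.toOp_nil,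
        Matrix.one_mul, Matrix.mul_apply]
      simp only [Matrix.conjTranspose_apply, Matrix.mul_apply, hop, sum_unit, zeroState,
        ketBra_apply]
      simp [funext_iff, hs]
    · rw [if_neg h, if_neg h]
  have h5 := ((h3.frameLeft (δ := α)).comap (fun ρ : Op α => (ρ, ())))
  have h6 := (implements_tens_zeroState (α := α) (β := Unit)).trans h5
  exact (h6.mono (by simp)).congr (fun _ => rfl) (fun ρ => by rw [h4])

theorem implements_uniform_fin (m : ℕ) :
    Implements (4 * m) (fun ρ : Op α => ρ) (fun ρ => tens ρ (uniformState (Fin m))) := by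
  induction m with
  | zero =>
    refine ((implements_reix (Equiv.sumEmpty α (Fin 0)).symm)).congr (fun _ => rfl) (fun ρ => ?_)
    ext p q
    simp only [tens, uniformState_apply, reix]
    rw [if_pos (Subsingleton.elim _ _)]
    simp; rfl
  | succ m ih =>
    have h := ih.trans ((implements_uniform_one (α := α ⊕ Fin m)).comap
      (fun ρ : Op α => tens ρ (uniformState (Fin m))))
    have h2 := h.reix ((Equiv.sumAssoc α (Fin m) Unit).trans
      (Equiv.sumCongr (Equiv.refl α) ((Fintype.equivFinOfCardEq (by simp) :
        Fin m ⊕ Unit ≃ Fin (m + 1)))))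
    refine (h2.mono (by omega)).congr (fun _ => rfl) (fun ρ => ?_)
    rw [← reix_reix, reix_sumAssoc, reix_tens, reix_refl, tens_uniformState, reix_uniformState]

theorem implements_uniform :
    Implements (4 * Fintype.card β) (fun ρ : Op α => ρ) (fun ρ => tens ρ (uniformState β)) := by
  refine ((implements_uniform_fin (α := α) (Fintype.card β)).reix
    (Equiv.sumCongr (Equiv.refl α) (Fintype.equivFin β).symm)).congr (fun _ => rfl) (fun ρ => ?_)
  rw [reix_tens, reix_refl, reix_uniformState]

end Gates

/-! ### Bits computed from a classical register -/

section Classical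

variable {α β γ ω : Type} [Fintype α] [DecidableEq α] [Fintype β] [DecidableEq β]
  [Fintype γ] [DecidableEq γ] [Fintype ω] [DecidableEq ω] {s t : ℕ}

/-- The bit `f x` can be appended to the basis state `x` with at most `s` gates and ancillas. -/
def BitComp (s : ℕ) (f : (α → Bool) → Bool) : Prop :=
  Implements s (fun x : α → Bool => ketBra x)
    (fun x => ketBra (Sum.elim x (fun _ : Unit => f x)))

theorem BitComp.mono {f : (α → Bool) → Bool} (h : BitComp s f) (hst : s ≤ t) : BitComp t f :=
  Implements.mono h hst

theorem bitComp_const (b : Bool) : BitComp 2 (fun _ : α → Bool => b) :=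
  implements_appendBit (n := 0) ⟨Fin.elim0, fun i => i.elim0⟩ (by norm_num) (fun _ => b)

theorem bitComp_var (a : α) : BitComp 2 (fun x : α → Bool => x a) :=
  implements_appendBit (n := 1) ⟨fun _ => a, fun _ _ _ => Subsingleton.elim _ _⟩ (by norm_num)
    (fun y => y 0)

theorem bitComp_nand_var (a b : α) : BitComp 2 (fun x : α → Bool => !(x a && x b)) := by
  by_cases h : a = b
  · subst h
    exact implements_appendBit (n := 1) ⟨fun _ => a, fun _ _ _ => Subsingleton.elim _ _⟩
      (by norm_num) (fun y => !(y 0 && y 0))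
  · refine implements_appendBit (n := 2) ⟨![a, b], ?_⟩ (by norm_num) (fun y => !(y 0 && y 1))
    intro i j hij
    fin_cases i <;> fin_cases j <;> simp_all

theorem Implements.tens_trace {I : Type} {inp : I → Op α} {out : I → Op β} {τ : I → Op γ}
    (h : Implements s inp (fun i => tens (out i) (τ i))) (hτ : ∀ i, (τ i).trace = 1) :
    Implements s inp out :=
  h.traceRight.congr (fun _ => rfl) (fun i => by rw [traceRight_tens, hτ, one_smul])

theorem Implements.ketBra_inl {I : Type} {inp : I → Op α} {x : I → β → Bool} {y : I → γ → Bool}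
    (h : Implements s inp (fun i => ketBra (Sum.elim (x i) (y i)))) :
    Implements s inp (fun i => ketBra (x i)) :=
  Implements.tens_trace (τ := fun i => ketBra (y i))
    (h.congr (fun _ => rfl) (fun _ => tens_ketBra _ _)) (fun _ => trace_ketBra _)

theorem Implements.reix_ketBra {I : Type} {inp : I → Op α} {x : I → β → Bool}
    (h : Implements s inp (fun i => ketBra (x i))) (e : β ≃ γ) :
    Implements s inp (fun i => ketBra (x i ∘ e.symm)) :=
  (h.reix e).congr (fun _ => rfl) (fun _ => (QZK.reix_ketBra _ _).symm)

theorem Implements.ketBra_inr {I : Type} {inp : I → Op α} {x : I → β → Bool} {y : I → γ → Bool}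
    (h : Implements s inp (fun i => ketBra (Sum.elim (x i) (y i)))) :
    Implements s inp (fun i => ketBra (y i)) := by
  refine Implements.ketBra_inl (y := x) ((h.reix_ketBra (Equiv.sumComm β γ)).congr (fun _ => rfl)
    (fun i => ?_))
  congr 1; funext j; rcases j with j | j <;> rfl

/-- Running one instruction of a Boolean program. -/
theorem implements_instruction (c a b : ω) :
    Implements 2 (fun v : ω → Bool => ketBra v)
      (fun v => ketBra (Function.update v c (!(v a && v b)))) := by
  refine Implements.ketBra_inl (γ := Unit) (y := fun v _ => v c)
    ((Implements.reix_ketBra (bitComp_nand_var a b)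
      (Equiv.swap (.inl c : ω ⊕ Unit) (.inr ()))).congr (fun _ => rfl) (fun v => ?_))
  congr 1
  funext j
  rw [Function.comp_apply, Equiv.symm_swap]
  rcases j with j | j
  · by_cases hj : j = c
    · subst hj; simp
    · rw [Equiv.swap_apply_of_ne_of_ne (by simpa using hj) (by simp)]
      simp [Function.update_of_ne hj]
  · obtain rfl : j = () := rfl
    simp

theorem implements_run (P : BoolProg ω) :
    Implements (2 * P.length) (fun v : ω → Bool => ketBra v) (fun v => ketBra (P.run v)) := by
  induction P with
  | nil => exact (implements_refl.comap _)
  | cons g P ih =>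
    exact (((implements_instruction g.1 g.2.1 g.2.2).trans (ih.comap _)).mono
      (by simp; omega)).congr (fun _ => rfl) (fun v => rfl)

theorem implements_program {W : ℕ} (P : BoolProg (α ⊕ (β ⊕ Fin W)))
    {f : (α → Bool) → (β → Bool)}
    (hf : ∀ x b, P.run (Sum.elim x (fun _ => false)) (Sum.inr (Sum.inl b)) = f x b) :
    Implements (Fintype.card β + W + 2 * P.length) (fun x : α → Bool => ketBra x)
      (fun x => ketBra (f x)) := by
  have h1 : Implements (Fintype.card β + W) (fun x : α → Bool => ketBra x)
      (fun x => ketBra (Sum.elim x (fun _ : β ⊕ Fin W => false))) :=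
    ((implements_tens_zeroState (α := α) (β := β ⊕ Fin W)).mono (by simp)).comap _ |>.congr
      (fun _ => rfl) (fun x => by rw [zeroState, tens_ketBra])
  have h2 := h1.trans ((implements_run P).comap _)
  have h3 : Implements _ (fun x : α → Bool => ketBra x) _ :=
    Implements.ketBra_inr (β := α) (γ := β ⊕ Fin W)
      (x := fun x : α → Bool => (P.run (Sum.elim x fun _ => false)) ∘ Sum.inl)
      (y := fun x : α → Bool => (P.run (Sum.elim x fun _ => false)) ∘ Sum.inr)
      (h2.congr (fun _ => rfl) (fun x => by rw [elim_comp_inl_inr]))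
  refine Implements.ketBra_inl (γ := Fin W)
    (y := fun x => (P.run (Sum.elim x fun _ => false)) ∘ Sum.inr ∘ Sum.inr)
    (h3.congr (fun _ => rfl) (fun x => ?_))
  congr 1
  funext j
  rcases j with j | j
  · exact (hf x j).symm
  · rfl

theorem Implements.frame_ketBra {x : (α → Bool) → (β → Bool)}
    (h : Implements s (fun a : α → Bool => ketBra a) (fun a => ketBra (x a))) :
    Implements s (fun p : α ⊕ γ → Bool => ketBra p)
      (fun p => ketBra (Sum.elim (x (p ∘ Sum.inl)) (p ∘ Sum.inr))) :=
  ((h.frame (δ := γ)).comap (fun p : α ⊕ γ → Bool => (p ∘ Sum.inl, ketBra (p ∘ Sum.inr)))).congr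
    (fun p => by rw [tens_ketBra, elim_comp_inl_inr]) (fun p => by rw [tens_ketBra])

theorem Implements.frameLeft_ketBra {x : (α → Bool) → (β → Bool)}
    (h : Implements s (fun a : α → Bool => ketBra a) (fun a => ketBra (x a))) :
    Implements s (fun p : γ ⊕ α → Bool => ketBra p)
      (fun p => ketBra (Sum.elim (p ∘ Sum.inl) (x (p ∘ Sum.inr)))) :=
  ((h.frameLeft (δ := γ)).comap (fun p : γ ⊕ α → Bool => (ketBra (p ∘ Sum.inl), p ∘ Sum.inr))).congr
    (fun p => by rw [tens_ketBra, elim_comp_inl_inr]) (fun p => by rw [tens_ketBra])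

theorem implements_bits_fin {n : ℕ} {f : Fin n → (α → Bool) → Bool} (hf : ∀ b, BitComp s (f b)) :
    Implements (n * s) (fun x : α → Bool => ketBra x)
      (fun x => ketBra (Sum.elim x (fun b => f b x))) := by
  induction n with
  | zero =>
    exact (((implements_refl (α := α)).comap (fun x : α → Bool => ketBra x)).reix_ketBra
      (Equiv.sumEmpty α (Fin 0)).symm |>.mono (by simp)).congr (fun _ => rfl) (fun x => by
        congr 1; funext j; rcases j with j | j
        · rfl
        · exact j.elim0)
  | succ n ih =>
    have h1 := ih (fun b => hf b.castSucc)
    have h2 := (Implements.frame_ketBra (γ := Fin n) (hf (Fin.last n)))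
    have h3 := h1.trans (h2.comap _)
    let e : (α ⊕ Unit) ⊕ Fin n ≃ α ⊕ Fin (n + 1) :=
      (Equiv.sumAssoc α Unit (Fin n)).trans (Equiv.sumCongr (Equiv.refl α)
        ((Equiv.sumComm Unit (Fin n)).trans ((Equiv.optionEquivSumPUnit (Fin n)).symm.trans
          finSuccEquivLast.symm)))
    refine ((h3.reix_ketBra e).mono (by rw [Nat.succ_mul])).congr (fun _ => rfl) (fun x => ?_)
    congr 1
    rw [Equiv.eq_comp_symm]
    funext j
    rcases j with (j | j) | j
    · simp [e]
    · simp [e]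
    · simp [e]

/-- Poly-many bits can be appended one after the other. -/
theorem implements_bits {f : β → (α → Bool) → Bool} (hf : ∀ b, BitComp s (f b)) :
    Implements (Fintype.card β * s) (fun x : α → Bool => ketBra x)
      (fun x => ketBra (Sum.elim x (fun b => f b x))) := by
  let e := Fintype.equivFin β
  refine ((implements_bits_fin (f := fun i => f (e.symm i)) (fun b => hf _)).reix_ketBra
    (Equiv.sumCongr (Equiv.refl α) e.symm)).congr (fun _ => rfl) (fun x => ?_)
  congr 1
  rw [Equiv.eq_comp_symm]
  funext j
  rcases j with j | j <;> rfl

theorem BitComp.subst {f : β → (α → Bool) → Bool} {g : (β → Bool) → Bool}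
    (hf : ∀ b, BitComp s (f b))
    (hg : Implements t (fun y : β → Bool => ketBra y) (fun y => ketBra (fun _ : Unit => g y))) :
    BitComp (Fintype.card β * s + t) (fun x => g (fun b => f b x)) :=
  ((implements_bits hf).trans ((Implements.frameLeft_ketBra (γ := α) hg).comap _))

theorem BitComp.value {f : (α → Bool) → Bool} (hf : BitComp s f) :
    Implements s (fun x : α → Bool => ketBra x) (fun x => ketBra (fun _ : Unit => f x)) :=
  Implements.ketBra_inr hf

theorem BitComp.nand {f g : (α → Bool) → Bool} (hf : BitComp s f) (hg : BitComp t g) :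
    BitComp (s + t + 2) (fun x => !(f x && g x)) := by
  have h1 := Implements.trans hf ((Implements.frame_ketBra (γ := Unit) hg).comap _)
  have h2 := h1.trans ((bitComp_nand_var (α := (α ⊕ Unit) ⊕ Unit) (.inr ())
    (.inl (.inr ()))).comap _)
  let e : ((α ⊕ Unit) ⊕ Unit) ⊕ Unit ≃ (α ⊕ Unit) ⊕ (Unit ⊕ Unit) :=
    { toFun := Sum.elim (Sum.elim (Sum.elim (fun a => .inl (.inl a)) (fun _ => .inr (.inl ())))
        (fun _ => .inr (.inr ()))) (fun _ => .inl (.inr ()))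
      invFun := Sum.elim (Sum.elim (fun a => .inl (.inl (.inl a))) (fun _ => .inr ()))
        (Sum.elim (fun _ => .inl (.inl (.inr ()))) (fun _ => .inl (.inr ())))
      left_inv := by rintro (((_ | _) | _) | _) <;> rfl
      right_inv := by rintro ((_ | _) | (_ | _)) <;> rfl }
  refine Implements.ketBra_inl (y := fun x => Sum.elim (fun _ => g x) (fun _ => f x))
    ((h2.reix_ketBra e).congr (fun _ => rfl) (fun x => ?_))
  congr 1
  funext j
  rcases j with (j | j) | (j | j) <;> rfl

end Classical

/-! ### From implemented maps to distinguishers and adversaries -/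

section NormalForm

variable {α β γ ω G G' : Type} [Fintype α] [DecidableEq α] [Fintype β] [DecidableEq β]
  [Fintype γ] [DecidableEq γ] [Fintype ω] [DecidableEq ω] [Fintype G] [DecidableEq G]
  [Fintype G'] [DecidableEq G'] {I : Type} {s : ℕ}

theorem exists_swap_circuit (a b : ω) :
    ∃ C : QCircuit ω, C.length ≤ 1 ∧ ∀ X, C.apply X = reix (Equiv.swap a b) X := by
  by_cases h : a = b
  · subst h
    refine ⟨[], by simp, fun X => ?_⟩
    rw [QCircuit.apply_nil, Equiv.swap_self, reix_refl]
  · let f : Fin 2 ↪ ω := ⟨![a, b], by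
      intro i j hij
      fin_cases i <;> fin_cases j <;> simp_all⟩
    refine ⟨[permGate f (by norm_num) (fun x => ![x 1, x 0]) (fun x => by
      funext i; fin_cases i <;> rfl)], by simp, fun X => ?_⟩
    ext p q
    have key : ∀ p : ω → Bool, Function.extend f (![(p ∘ f) 1, (p ∘ f) 0] : Fin 2 → Bool) p =
        p ∘ Equiv.swap a b := by
      intro p
      funext j
      by_cases hj : j ∈ Set.range f
      · obtain ⟨i, rfl⟩ := hj
        rw [f.injective.extend_apply]
        fin_cases i
        · change p b = p (Equiv.swap a b a); simp
        · change p a = p (Equiv.swap a b b); simp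
      · rw [Function.extend_apply' _ _ _ hj, Function.comp_apply, Equiv.swap_apply_of_ne_of_ne]
        · rintro rfl; exact hj ⟨0, rfl⟩
        · rintro rfl; exact hj ⟨1, rfl⟩
    exact (permGate_apply f _ _ _ X p q).trans (by rw [key, key]; rfl)

/-- Swap gates move the wires `c b` to the wires `a b`. -/
theorem exists_move_circuit (a c : β → ω) (ha : Function.Injective a) (hc : Function.Injective c)
    (hac : ∀ b b', a b ≠ c b') :
    ∃ (C : QCircuit ω) (π : ω ≃ ω), C.length ≤ Fintype.card β ∧
      (∀ X, C.apply X = reix π X) ∧ ∀ b, π (c b) = a b := by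
  have key : ∀ L : List β, L.Nodup → ∃ (C : QCircuit ω) (π : ω ≃ ω), C.length ≤ L.length ∧
      (∀ X, C.apply X = reix π X) ∧ (∀ b ∈ L, π (c b) = a b) ∧ ∀ b, b ∉ L → π (c b) = c b := by
    intro L
    induction L with
    | nil =>
      intro _
      exact ⟨[], Equiv.refl ω, le_rfl, fun X => by rw [QCircuit.apply_nil, reix_refl],
        fun b hb => by simp at hb, fun b _ => rfl⟩
    | cons b L ih =>
      intro hL
      rw [List.nodup_cons] at hL
      obtain ⟨C, π, h1, h2, h3, h4⟩ := ih hL.2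
      obtain ⟨C', h1', h2'⟩ := exists_swap_circuit (c b) (a b)
      refine ⟨C ++ C', π.trans (Equiv.swap (c b) (a b)), ?_, fun X => ?_, ?_, ?_⟩
      · simp; omega
      · rw [QCircuit.apply_append, h2, h2', reix_reix]
      · intro b' hb'
        rw [List.mem_cons] at hb'
        rcases hb' with rfl | hb'
        · simp [h4 _ hL.1]
        · rw [Equiv.trans_apply, h3 _ hb', Equiv.swap_apply_of_ne_of_ne (hac _ _)]
          intro h
          exact hL.1 (ha h ▸ hb')
      · intro b' hb'
        rw [List.mem_cons, not_or] at hb'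
        rw [Equiv.trans_apply, h4 _ hb'.2, Equiv.swap_apply_of_ne_of_ne]
        · exact fun h => hb'.1 (hc h)
        · exact (hac _ _).symm
  obtain ⟨C, π, h1, h2, h3, -⟩ := key _ (Finset.univ : Finset β).nodup_toList
  exact ⟨C, π, by simpa using h1, h2, fun b => h3 b (by simp)⟩

/-- A partial trace only depends on the wires that are kept. -/
theorem traceRight_reix_congr (e : ω ≃ β ⊕ G) (e' : ω ≃ β ⊕ G')
    (h : ∀ b, e.symm (.inl b) = e'.symm (.inl b)) (X : Op ω) :
    traceRight (reix e X) = traceRight (reix e' X) := by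
  have h1 : ∀ g, ∃ g', e' (e.symm (.inr g)) = .inr g' := by
    intro g
    rcases hg : e' (e.symm (.inr g)) with b | g'
    · exfalso
      have : e.symm (.inr g) = e.symm (.inl b) := by rw [h, ← hg]; simp
      simpa using e.symm.injective this
    · exact ⟨g', rfl⟩
  have h2 : ∀ g', ∃ g, e (e'.symm (.inr g')) = .inr g := by
    intro g
    rcases hg : e (e'.symm (.inr g)) with b | g'
    · exfalso
      have : e'.symm (.inr g) = e'.symm (.inl b) := by rw [← h, ← hg]; simp
      simpa using e'.symm.injective this
    · exact ⟨g', rfl⟩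
  choose k hk using h1
  choose k' hk' using h2
  let K : G ≃ G' := ⟨k, k', fun g => by
      have : e (e'.symm (.inr (k g))) = .inr g := by rw [← hk]; simp
      rw [hk'] at this; simpa using this,
    fun g => by
      have : e' (e.symm (.inr (k' g))) = .inr g := by rw [← hk']; simp
      rw [hk] at this; simpa using this⟩
  ext p q
  simp only [traceRight, reix]
  refine Fintype.sum_equiv (K.arrowCongr (Equiv.refl Bool)) _ _ fun t => ?_
  have key : ∀ p : β → Bool, (Sum.elim p t : β ⊕ G → Bool) ∘ e =
      (Sum.elim p ((K.arrowCongr (Equiv.refl Bool)) t) : β ⊕ G' → Bool) ∘ e' := by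
    intro p
    funext w
    simp only [Function.comp_apply]
    obtain ⟨x, rfl⟩ := e.symm.surjective w
    rcases x with b | g
    · rw [Equiv.apply_symm_apply, h b, Equiv.apply_symm_apply]; rfl
    · rw [hk]
      have : K.symm (k g) = g := K.symm_apply_apply g
      simp [Equiv.arrowCongr, this]
  rw [key, key]

/-- An implemented map in normal form: the result appears on zeroed wires of its own, to which it
is swapped at the end, and all other wires are discarded. -/
theorem Implements.exists_circuit {inp : I → Op α} {out : I → Op β} (h : Implements s inp out) :
    ∃ (na : ℕ) (C : QCircuit (α ⊕ (β ⊕ Fin na))), na ≤ s ∧ C.length ≤ s + Fintype.card β ∧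
      ∀ i, QZK.traceRight (QZK.traceLeft
        (C.apply (tens (inp i) (tens (zeroState β) (zeroState (Fin na)))))) = out i := by
  obtain ⟨Z, G, iZ, dZ, iG, dG, e, C, h1, h2, h3⟩ := h
  let ζ := Fintype.equivFin Z
  -- the wires of the realization together with fresh output wires
  let g : (α ⊕ Z) ⊕ β ≃ α ⊕ (β ⊕ Fin (Fintype.card Z)) :=
    (Equiv.sumAssoc α Z β).trans (Equiv.sumCongr (Equiv.refl α)
      ((Equiv.sumComm Z β).trans (Equiv.sumCongr (Equiv.refl β) ζ)))
  obtain ⟨C', π, hl, hC', hπ⟩ := exists_move_circuit (ω := α ⊕ (β ⊕ Fin (Fintype.card Z)))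
    (fun b : β => .inr (.inl b)) (fun b => g (.inl (e.symm (.inl b))))
    (fun b b' h => by simpa using h)
    (fun b b' h => by simpa using h) (fun b b' h => by
      have : (.inl (e.symm (.inl b')) : (α ⊕ Z) ⊕ β) = .inr b := by
        rw [← g.symm_apply_apply (.inl (e.symm (.inl b'))), ← h]; rfl
      simp at this)
  refine ⟨Fintype.card Z,
    QCircuit.map g.toEmbedding (QCircuit.map Function.Embedding.inl C) ++ C', h1, ?_, fun i => ?_⟩
  · simp; omega
  have hin : tens (inp i) (tens (zeroState β) (zeroState (Fin (Fintype.card Z)))) =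
      QZK.reix g (tens (tens (inp i) (zeroState Z)) (zeroState β)) := by
    have : QZK.reix g (tens (tens (inp i) (zeroState Z)) (zeroState β)) =
      QZK.reix (Equiv.sumCongr (Equiv.refl α) ((Equiv.sumComm Z β).trans
        (Equiv.sumCongr (Equiv.refl β) ζ))) (QZK.reix (Equiv.sumAssoc α Z β)
        (tens (tens (inp i) (zeroState Z)) (zeroState β))) := rfl
    rw [this, reix_sumAssoc, reix_tens, reix_refl, ← reix_reix, reix_sumComm, reix_tens,
      reix_refl, reix_zeroState]
  rw [hin, QCircuit.apply_append, QCircuit.apply_map_equiv, ← QCircuit.tens_apply_left, hC',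
    ← h3 i, runL_apply]
  set Y := QCircuit.apply C (tens (inp i) (zeroState Z))
  rw [traceLeft_eq_traceRight, reix_reix, reix_reix]
  -- both sides are partial traces of `Y ⊗ 0` that keep the same wires
  have hL : ∀ X : Op ((β ⊕ Fin (Fintype.card Z)) ⊕ α),
      QZK.traceRight (QZK.traceRight X) =
        QZK.traceRight (QZK.reix (Equiv.sumAssoc _ _ _) X) :=
    fun X => (traceRight_reix_sumAssoc X).symm
  have hR : QZK.traceRight (QZK.reix e Y) = QZK.traceRight (QZK.reix
      ((Equiv.sumCongr e (Equiv.refl β)).trans (Equiv.sumAssoc β G β)) (tens Y (zeroState β))) := by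
    rw [← reix_reix, traceRight_reix_sumAssoc, reix_tens, traceRight_tens, reix_refl, zeroState,
      trace_ketBra, one_smul]
  rw [hL, hR, reix_reix]
  refine traceRight_reix_congr _ _ (fun b => ?_) _
  simp only [Equiv.symm_trans_apply]
  rw [Equiv.symm_apply_eq, Equiv.symm_apply_eq]
  exact (hπ b).symm

/-- A map to a single qubit, read as an accepting probability. -/
theorem Implements.exists_distinguisher {inp : I → Op α} {out : I → Op Unit}
    (h : Implements s inp out) : ∃ D : Distinguisher α, D.na ≤ s ∧ D.circ.length ≤ s + 1 ∧
      ∀ i, D.accept (inp i) = (out i (fun _ => true) (fun _ => true)).re := by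
  obtain ⟨na, C, h1, h2, h3⟩ := h.exists_circuit
  let u : α ⊕ (Unit ⊕ Fin na) ≃ Unit ⊕ (α ⊕ Fin na) :=
    (Equiv.sumAssoc α Unit (Fin na)).symm.trans
      ((Equiv.sumCongr (Equiv.sumComm α Unit) (Equiv.refl _)).trans
        (Equiv.sumAssoc Unit α (Fin na)))
  refine ⟨⟨na, QCircuit.map u.toEmbedding C⟩, h1, by simpa using h2, fun i => ?_⟩
  have hin : tens (zeroState Unit) (tens (inp i) (zeroState (Fin na))) =
      QZK.reix u (tens (inp i) (tens (zeroState Unit) (zeroState (Fin na)))) := by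
    rw [← reix_reix, reix_sumAssoc_symm, ← reix_reix, reix_tens, reix_sumComm, reix_refl,
      reix_sumAssoc]
  rw [← h3 i, Distinguisher.accept]
  congr 1
  simp only
  rw [hin, QCircuit.apply_map_equiv]
  set X := QCircuit.apply C (tens (inp i) (tens (zeroState Unit) (zeroState (Fin na))))
  simp only [Matrix.trace, Matrix.diag, outcome, QZK.reix, QZK.traceRight, QZK.traceLeft,
    sum_sumArrow]
  rw [Finset.sum_comm]
  refine Finset.sum_congr rfl fun t _ => Finset.sum_congr rfl fun t' _ => ?_
  have : (Sum.elim (fun _ => true) (Sum.elim t' t) : Unit ⊕ (α ⊕ Fin na) → Bool) ∘ u =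
      Sum.elim t' (Sum.elim (fun _ => true) t) := by
    funext j; rcases j with j | j | j <;> rfl
  rw [this]

theorem sum_reverse {J K L : Type*} [Fintype J] [Fintype K] [Fintype L] {M : Type*}
    [AddCommMonoid M] (F : J → K → L → M) :
    ∑ l, ∑ k, ∑ j, F j k l = ∑ j, ∑ k, ∑ l, F j k l := by
  simp only [Finset.sum_comm (f := fun k j => F j k _)]
  rw [Finset.sum_comm]
  exact Finset.sum_congr rfl fun j _ => Finset.sum_comm

/-- The adversary for an execution in a single round: each step maps the message, the classical
and the quantum input to a reply and an output register. -/
theorem Implements.exists_adversary {nz nq no : ℕ}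
    {out : (α → Bool) × Bits nz × Op (Fin nq) → Op (β ⊕ Fin no)}
    (h : Implements s (fun i : (α → Bool) × Bits nz × Op (Fin nq) =>
      tens (ketBra i.1) (tens (ketBra i.2.1) i.2.2)) out) :
    ∃ A : Adversary α β nz nq no, A.na ≤ s ∧
      (∀ i, (A.circ i).length ≤ s + (Fintype.card β + no)) ∧ A.last.length = 0 ∧
      ∀ m z ρ r i, A.finish (A.step i m r (A.start z ρ)) = outcome r (out (m, z, ρ)) := by
  obtain ⟨na, C, h1, h2, h3⟩ := h.exists_circuit
  let v : (α ⊕ (Fin nz ⊕ Fin nq)) ⊕ ((β ⊕ Fin no) ⊕ Fin na) ≃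
      α ⊕ (β ⊕ Mem nz nq no na) :=
    { toFun := Sum.elim (Sum.elim (fun a => .inl a) (Sum.elim (fun z => .inr (.inr (.inl z)))
          (fun q => .inr (.inr (.inr (.inl q))))))
        (Sum.elim (Sum.elim (fun b => .inr (.inl b)) (fun o => .inr (.inr (.inr (.inr (.inl o))))))
          (fun a => .inr (.inr (.inr (.inr (.inr a))))))
      invFun := Sum.elim (fun a => .inl (.inl a)) (Sum.elim (fun b => .inr (.inl (.inl b)))
        (Sum.elim (fun z => .inl (.inr (.inl z))) (Sum.elim (fun q => .inl (.inr (.inr q)))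
          (Sum.elim (fun o => .inr (.inl (.inr o))) (fun a => .inr (.inr a))))))
      left_inv := by rintro ((_ | _ | _) | (_ | _) | _) <;> rfl
      right_inv := by rintro (_ | _ | _ | _ | _ | _) <;> rfl }
  refine ⟨⟨na, fun _ => QCircuit.map v.toEmbedding C, []⟩, h1, fun _ => by simpa using h2, rfl,
    fun m z ρ r i => ?_⟩
  rw [← h3 (m, z, ρ)]
  simp only [Adversary.finish, Adversary.step, Adversary.start, QCircuit.apply_nil]
  have hin : tens (ketBra m) (tens (zeroState β) (tens (ketBra z) (tens ρ
      (tens (zeroState (Fin no)) (zeroState (Fin na)))))) =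
      QZK.reix v (tens (tens (ketBra m) (tens (ketBra z) ρ))
        (tens (zeroState (β ⊕ Fin no)) (zeroState (Fin na)))) := by
    rw [← QZK.tens_zeroState]
    ext p q
    simp only [tens, QZK.reix]
    rw [mul_assoc, mul_assoc (ketBra z _ _)]
    congr 1
    rw [mul_left_comm]; congr 1
    rw [mul_left_comm]; congr 1
    rw [mul_assoc]; rfl
  rw [hin, QCircuit.apply_map_equiv]
  set X := QCircuit.apply C (tens (tens (ketBra m) (tens (ketBra z) ρ))
        (tens (zeroState (β ⊕ Fin no)) (zeroState (Fin na))))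
  ext a b
  simp only [QZK.traceRight, QZK.traceLeft, outcome, QZK.reix, sum_sumArrow]
  refine Finset.sum_congr rfl fun t _ => ?_
  have key : ∀ (a : Bits no) (x : α → Bool) (y : Bits nz) (w : Bits nq),
      (Sum.elim x (Sum.elim r (Sum.elim y (Sum.elim w (Sum.elim a t)))) :
        α ⊕ (β ⊕ Mem nz nq no na) → Bool) ∘ v =
      Sum.elim (Sum.elim x (Sum.elim y w)) (Sum.elim (Sum.elim r a) t) := by
    intro a x y w
    funext j; rcases j with (_ | _ | _) | (_ | _) | _ <;> rfl
  simp only [key]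
  exact sum_reverse (fun x y w => X (Sum.elim (Sum.elim x (Sum.elim y w))
    (Sum.elim (Sum.elim r a) t)) (Sum.elim (Sum.elim x (Sum.elim y w)) (Sum.elim (Sum.elim r b) t)))

end NormalForm

/-! ### Executions with four rounds -/

section Linear

variable {α β : Type} [Fintype α] [DecidableEq α] [Fintype β] [DecidableEq β] {J : Type*}

theorem traceLeft_sum (s : Finset J) (X : J → Op (α ⊕ β)) :
    traceLeft (∑ j ∈ s, X j) = ∑ j ∈ s, traceLeft (X j) := by
  ext a b
  simp only [traceLeft, Matrix.sum_apply]
  exact Finset.sum_comm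

theorem traceRight_sum (s : Finset J) (X : J → Op (α ⊕ β)) :
    traceRight (∑ j ∈ s, X j) = ∑ j ∈ s, traceRight (X j) := by
  ext a b
  simp only [traceRight, Matrix.sum_apply]
  exact Finset.sum_comm

theorem outcome_sum (s : Finset J) (r : α → Bool) (X : J → Op (α ⊕ β)) :
    outcome r (∑ j ∈ s, X j) = ∑ j ∈ s, outcome r (X j) := by
  ext a b
  simp only [outcome, Matrix.sum_apply]

theorem outcome_smul (c : ℂ) (r : α → Bool) (X : Op (α ⊕ β)) :
    outcome r (c • X) = c • outcome r X := rfl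

theorem apply_sum (s : Finset J) (C : QCircuit α) (X : J → Op α) :
    C.apply (∑ j ∈ s, X j) = ∑ j ∈ s, C.apply (X j) := by
  simp only [QCircuit.apply, Matrix.mul_sum, Matrix.sum_mul]

end Linear

section Executions

variable {Ω ι ο α β γ χ : Type} [Fintype Ω]
  [Fintype ι] [DecidableEq ι] [Fintype ο] [DecidableEq ο]
  [Fintype α] [DecidableEq α] [Fintype β] [DecidableEq β] [Fintype γ] [DecidableEq γ]
  [Fintype χ] [DecidableEq χ] {nz nq no s t : ℕ}

theorem Adversary.finish_sum {J : Type*} (S : Finset J) (A : Adversary α β nz nq no)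
    (X : J → Op (Mem nz nq no A.na)) :
    A.finish (∑ j ∈ S, X j) = ∑ j ∈ S, A.finish (X j) := by
  simp only [Adversary.finish, apply_sum, traceLeft_sum, traceRight_sum]

theorem Adversary.finish_zero (A : Adversary α β nz nq no) :
    A.finish (0 : Op (Mem nz nq no A.na)) = 0 := by
  simpa using A.finish_sum ∅ (fun _ : Unit => 0)

/-- The memory of the dishonest party after the replies `r₀`, `r₁`, `r₂`, `r₃`. -/
noncomputable def System.mem4 (M : System Ω ι ο α β) (A : Adversary α β nz nq no) (u : ι → Bool)
    (c : Ω) (ρ : Op (Mem nz nq no A.na)) (r₀ r₁ r₂ r₃ : β → Bool) : Op (Mem nz nq no A.na) :=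
  A.step 3 (M.send u c [r₀, r₁, r₂]) r₃ (A.step 2 (M.send u c [r₀, r₁]) r₂
    (A.step 1 (M.send u c [r₀]) r₁ (A.step 0 (M.send u c []) r₀ ρ)))

/-- The honest output and the output of the dishonest party for fixed inputs, in an execution
with four rounds. -/
noncomputable def System.exec4 (M : System Ω ι ο α β) (A : Adversary α β nz nq no) (u : ι → Bool)
    (ρ : Op (Mem nz nq no A.na)) : Op (ο ⊕ Fin no) :=
  (Fintype.card Ω : ℂ)⁻¹ • ∑ c : Ω, ∑ r₀, ∑ r₁, ∑ r₂, ∑ r₃,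
    tens (ketBra (M.result u c [r₀, r₁, r₂, r₃])) (A.finish (M.mem4 A u c ρ r₀ r₁ r₂ r₃))

theorem sum_tens_ketBra_ite (y₀ : ο → Bool) (X : Op α) :
    ∑ y : ο → Bool, tens (ketBra y) (if y₀ = y then X else 0) = tens (ketBra y₀) X := by
  rw [Finset.sum_eq_single y₀]
  · rw [if_pos rfl]
  · intro y _ hy; rw [if_neg (Ne.symm hy), tens_zero_right]
  · simp

theorem System.out_four (M : System Ω ι ο α β) (hM : M.rounds = 4) (A : Adversary α β nz nq no)
    (T : Sampler ι nz nq) : M.out A T = ∑ u : ι → Bool, ∑ z : Bits nz,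
      tens (ketBra u) (tens (ketBra z) (M.exec4 A u (A.start z (T.state u z)))) := by
  rw [System.out]
  refine Finset.sum_congr rfl fun u _ => Finset.sum_congr rfl fun z _ => ?_
  rw [← tens_sum_right, ← tens_sum_right, System.exec4]
  congr 2
  simp only [tens_smul_right, ← Finset.smul_sum, tens_sum_right]
  rw [Finset.sum_comm]
  congr 1
  refine Finset.sum_congr rfl fun c _ => ?_
  simp only [hM, System.run, List.length_nil, List.nil_append, List.cons_append, List.length_cons,
    Nat.zero_add, Nat.reduceAdd, Adversary.finish_sum, tens_sum_right]
  have hite : ∀ (y : ο → Bool) (r₀ r₁ r₂ r₃ : β → Bool) (X : Op (Mem nz nq no A.na)),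
      A.finish (if M.result u c [r₀, r₁, r₂, r₃] = y then X else 0) =
        if M.result u c [r₀, r₁, r₂, r₃] = y then A.finish X else 0 := by
    intro y r₀ r₁ r₂ r₃ X
    split_ifs
    · rfl
    · exact A.finish_zero
  simp only [hite]
  rw [Finset.sum_comm]; refine Finset.sum_congr rfl fun r₀ _ => ?_
  rw [Finset.sum_comm]; refine Finset.sum_congr rfl fun r₁ _ => ?_
  rw [Finset.sum_comm]; refine Finset.sum_congr rfl fun r₂ _ => ?_
  rw [Finset.sum_comm]; refine Finset.sum_congr rfl fun r₃ _ => ?_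
  rw [sum_tens_ketBra_ite]
  rfl

theorem System.out_one (M : System Ω ι ο α β) (hM : M.rounds = 1) (A : Adversary α β nz nq no)
    (T : Sampler ι nz nq) : M.out A T = ∑ u : ι → Bool, ∑ z : Bits nz,
      tens (ketBra u) (tens (ketBra z) ((Fintype.card Ω : ℂ)⁻¹ • ∑ c : Ω, ∑ r,
        tens (ketBra (M.result u c [r])) (A.finish
          (A.step 0 (M.send u c []) r (A.start z (T.state u z)))))) := by
  rw [System.out]
  refine Finset.sum_congr rfl fun u _ => Finset.sum_congr rfl fun z _ => ?_
  rw [← tens_sum_right, ← tens_sum_right]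
  congr 2
  simp only [tens_smul_right, ← Finset.smul_sum, tens_sum_right]
  rw [Finset.sum_comm]
  congr 1
  refine Finset.sum_congr rfl fun c _ => ?_
  simp only [hM, System.run, List.length_nil, List.nil_append, Adversary.finish_sum,
    tens_sum_right]
  have hite : ∀ (y : ο → Bool) (r : β → Bool) (X : Op (Mem nz nq no A.na)),
      A.finish (if M.result u c [r] = y then X else 0) =
        if M.result u c [r] = y then A.finish X else 0 := by
    intro y r X
    split_ifs
    · rfl
    · exact A.finish_zero
  simp only [hite]
  rw [Finset.sum_comm]; refine Finset.sum_congr rfl fun r₀ _ => ?_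
  rw [sum_tens_ketBra_ite]

/-- A map applied after a measurement with outcome `j`, whose state is `mid (f i j)`. -/
theorem Implements.bind {I K : Type} {inp : I → Op α} {mid : K → Op β} {out : K → Op γ} {J : Type}
    [Fintype J] {f : I → J → K} (h : Implements s inp (fun i => ∑ j, mid (f i j)))
    (h' : Implements t mid out) : Implements (s + t) inp (fun i => ∑ j, out (f i j)) :=
  h.trans (h'.sum f)

theorem implements_step (A : Adversary α β nz nq no) (i : ℕ) :
    Implements (3 * Fintype.card β + (A.circ i).length)
      (fun p : (α → Bool) × Op (Mem nz nq no A.na) => tens (ketBra p.1) p.2)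
      (fun p => ∑ r : β → Bool, tens (ketBra r) (A.step i p.1 r p.2)) := by
  have h1 := (implements_tens_zeroState (α := α ⊕ Mem nz nq no A.na) (β := β)).comap
    (fun p : (α → Bool) × Op (Mem nz nq no A.na) => tens (ketBra p.1) p.2)
  have h2 := (h1.reix ((Equiv.sumAssoc α _ β).trans
    (Equiv.sumCongr (Equiv.refl α) (Equiv.sumComm _ β))))
  have h3 : Implements _ _ (fun p : (α → Bool) × Op (Mem nz nq no A.na) =>
      tens (ketBra p.1) (tens (zeroState β) p.2)) := h2.congr (fun _ => rfl) (fun p => by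
    rw [← reix_reix, reix_sumAssoc, reix_tens, reix_sumComm, reix_refl])
  have h4 := ((h3.apply (A.circ i)).traceLeft).trans (implements_measureLeft.comap _)
  exact (h4.mono (by omega)).congr (fun _ => rfl) (fun _ => rfl)

/-- One round of the dishonest party, on a message `m g` that is computed from a classical
register `g`; the reply is added to the register. -/
theorem implements_round (A : Adversary α β nz nq no) (i : ℕ)
    (m : (γ → Bool) → (α → Bool)) (hm : ∀ a, BitComp s (fun g => m g a)) :
    Implements (Fintype.card α * s + (3 * Fintype.card β + (A.circ i).length))
      (fun p : (γ → Bool) × Op (Mem nz nq no A.na) => tens (ketBra p.1) p.2)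
      (fun p => ∑ r : β → Bool, tens (ketBra (Sum.elim p.1 r)) (A.step i (m p.1) r p.2)) := by
  have h1 := (implements_bits hm).frame (δ := Mem nz nq no A.na)
  have h2 := h1.reix (Equiv.sumAssoc γ α _)
  have h3 : Implements _ _ (fun p : (γ → Bool) × Op (Mem nz nq no A.na) =>
      tens (ketBra p.1) (tens (ketBra (m p.1)) p.2)) := h2.congr (fun _ => rfl) (fun p => by
    rw [← tens_ketBra, reix_sumAssoc])
  have h4 := ((implements_step A i).frameLeft (δ := γ)).comap
    (fun p : (γ → Bool) × Op (Mem nz nq no A.na) => (ketBra p.1, (m p.1, p.2)))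
  refine ((h3.trans h4).reix (Equiv.sumAssoc γ β _).symm).congr (fun _ => rfl) (fun p => ?_)
  simp only [tens_sum_right, reix_sum, reix_sumAssoc_symm, tens_ketBra]

theorem implements_finish (A : Adversary α β nz nq no) :
    Implements A.last.length (fun ρ : Op (Mem nz nq no A.na) => ρ) (fun ρ => A.finish ρ) :=
  (((implements_apply A.last).traceLeft).traceLeft).traceRight

/-- The output of the honest party is computed from the classical register, and the dishonest party
computes its output. -/
theorem implements_outputs (A : Adversary α β nz nq no)
    (f : (γ → Bool) → (ο → Bool)) (hf : ∀ o, BitComp s (fun g => f g o)) :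
    Implements (Fintype.card ο * s + A.last.length)
      (fun p : (γ → Bool) × Op (Mem nz nq no A.na) => tens (ketBra p.1) p.2)
      (fun p => tens (ketBra (f p.1)) (A.finish p.2)) := by
  have h1 : Implements _ (fun g : γ → Bool => ketBra g) (fun g => ketBra (f g)) :=
    Implements.ketBra_inr (implements_bits hf)
  have h2 := h1.frame (δ := Mem nz nq no A.na)
  exact h2.trans (((implements_finish A).frameLeft (δ := ο)).comap
    (fun p : (γ → Bool) × Op (Mem nz nq no A.na) => (ketBra (f p.1), p.2)))

theorem implements_start (A : Adversary α β nz nq no) (χ : Type) [Fintype χ] [DecidableEq χ] :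
    Implements (4 * Fintype.card χ + (no + A.na))
      (fun p : (ι → Bool) × Bits nz × Op (Fin nq) =>
        tens (ketBra p.1) (tens (ketBra p.2.1) p.2.2))
      (fun p => (Fintype.card (χ → Bool) : ℂ)⁻¹ • ∑ c : χ → Bool,
        tens (ketBra (Sum.elim p.1 c)) (A.start p.2.1 p.2.2)) := by
  have h1 := (((implements_uniform (α := ι) (β := χ)).comap (fun u : ι → Bool => ketBra u)).frame
    (δ := Fin nz ⊕ Fin nq)).comap (fun p : (ι → Bool) × Bits nz × Op (Fin nq) =>
      (p.1, tens (ketBra p.2.1) p.2.2))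
  have h2 := ((implements_tens_zeroState (α := Fin nz ⊕ Fin nq) (β := Fin no ⊕ Fin A.na)).reix
    (Equiv.sumAssoc _ _ _)).frameLeft (δ := ι ⊕ χ) |>.comap
      (fun p : (ι → Bool) × Bits nz × Op (Fin nq) =>
        (tens (ketBra p.1) (uniformState χ), tens (ketBra p.2.1) p.2.2))
  refine ((h1.trans h2).mono (by simp)).congr (fun _ => rfl) (fun p => ?_)
  rw [reix_sumAssoc, ← tens_zeroState, uniformState, tens_smul_right, tens_smul_left,
    tens_sum_right, tens_sum_left]
  simp only [tens_ketBra]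
  rfl

set_option synthInstance.maxSize 1000 in
/-- An execution with four rounds is implemented by a circuit if the honest party's messages and
output are computed by circuits from its input, its coins and the earlier replies. -/
theorem implements_exec4 (A : Adversary α β nz nq no) (M : System (χ → Bool) ι ο α β) {L : ℕ}
    (hL : ∀ i, (A.circ i).length ≤ L)
    (h0 : ∀ a, BitComp s (fun x : ι ⊕ χ → Bool => M.send (x ∘ .inl) (x ∘ .inr) [] a))
    (h1 : ∀ a, BitComp s (fun x : (ι ⊕ χ) ⊕ β → Bool =>
      M.send (x ∘ .inl ∘ .inl) (x ∘ .inl ∘ .inr) [x ∘ .inr] a))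
    (h2 : ∀ a, BitComp s (fun x : ((ι ⊕ χ) ⊕ β) ⊕ β → Bool =>
      M.send (x ∘ .inl ∘ .inl ∘ .inl) (x ∘ .inl ∘ .inl ∘ .inr) [x ∘ .inl ∘ .inr, x ∘ .inr] a))
    (h3 : ∀ a, BitComp s (fun x : (((ι ⊕ χ) ⊕ β) ⊕ β) ⊕ β → Bool =>
      M.send (x ∘ .inl ∘ .inl ∘ .inl ∘ .inl) (x ∘ .inl ∘ .inl ∘ .inl ∘ .inr)
        [x ∘ .inl ∘ .inl ∘ .inr, x ∘ .inl ∘ .inr, x ∘ .inr] a))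
    (hr : ∀ o, BitComp s (fun x : ((((ι ⊕ χ) ⊕ β) ⊕ β) ⊕ β) ⊕ β → Bool =>
      M.result (x ∘ .inl ∘ .inl ∘ .inl ∘ .inl ∘ .inl) (x ∘ .inl ∘ .inl ∘ .inl ∘ .inl ∘ .inr)
        [x ∘ .inl ∘ .inl ∘ .inl ∘ .inr, x ∘ .inl ∘ .inl ∘ .inr, x ∘ .inl ∘ .inr, x ∘ .inr] o)) :
    Implements (4 * Fintype.card χ + (no + A.na) +
        4 * (Fintype.card α * s + (3 * Fintype.card β + L)) +
        (Fintype.card ο * s + A.last.length))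
      (fun p : (ι → Bool) × Bits nz × Op (Fin nq) =>
        tens (ketBra p.1) (tens (ketBra p.2.1) p.2.2))
      (fun p => M.exec4 A p.1 (A.start p.2.1 p.2.2)) := by
  have e0 := implements_round A 0 _ h0
  have e1 := implements_round A 1 _ h1
  have e2 := implements_round A 2 _ h2
  have e3 := implements_round A 3 _ h3
  have e4 := implements_outputs A _ hr
  have f3 := Implements.bind (f := fun (p : (_ → Bool) × Op (Mem nz nq no A.na)) r => (_, _)) e3 e4
  have f2 := Implements.bind (f := fun (p : (_ → Bool) × Op (Mem nz nq no A.na)) r => (_, _)) e2 f3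
  have f1 := Implements.bind (f := fun (p : (_ → Bool) × Op (Mem nz nq no A.na)) r => (_, _)) e1 f2
  have f0 := Implements.bind (f := fun (p : (_ → Bool) × Op (Mem nz nq no A.na)) r => (_, _)) e0 f1
  have g := (f0.sum (K := (ι → Bool) × Bits nz × Op (Fin nq)) (J := χ → Bool)
    (fun p c => (Sum.elim p.1 c, A.start p.2.1 p.2.2))).smul
      (fun _ => (Fintype.card (χ → Bool) : ℂ)⁻¹)
  have l0 := hL 0
  have l1 := hL 1
  have l2 := hL 2
  have l3 := hL 3
  refine (((implements_start A χ).trans g).mono ?_).congr (fun _ => rfl) (fun p => ?_)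
  · omega
  · rw [System.exec4]
    rfl

end Executions

/-! ### Polynomially bounded and negligible functions -/

section Asymptotics

theorem polynomial_eval_mono (p : Polynomial ℕ) {a b : ℕ} (h : a ≤ b) : p.eval a ≤ p.eval b := by
  rw [Polynomial.eval_eq_sum_range, Polynomial.eval_eq_sum_range]
  gcongr

theorem PolyBounded.mono {f g : ℕ → ℕ} (hg : PolyBounded g) (h : ∀ k, f k ≤ g k) :
    PolyBounded f := by
  obtain ⟨p, hp⟩ := hg
  exact ⟨p, fun k => (h k).trans (hp k)⟩

theorem polyBounded_const (c : ℕ) : PolyBounded (fun _ => c) := ⟨Polynomial.C c, by simp⟩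

theorem polyBounded_id : PolyBounded (fun k => k) := ⟨Polynomial.X, by simp⟩

theorem PolyBounded.add {f g : ℕ → ℕ} (hf : PolyBounded f) (hg : PolyBounded g) :
    PolyBounded (fun k => f k + g k) := by
  obtain ⟨p, hp⟩ := hf
  obtain ⟨p', hp'⟩ := hg
  exact ⟨p + p', fun k => by rw [Polynomial.eval_add]; exact Nat.add_le_add (hp k) (hp' k)⟩

theorem PolyBounded.mul {f g : ℕ → ℕ} (hf : PolyBounded f) (hg : PolyBounded g) :
    PolyBounded (fun k => f k * g k) := by
  obtain ⟨p, hp⟩ := hf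
  obtain ⟨p', hp'⟩ := hg
  exact ⟨p * p', fun k => by rw [Polynomial.eval_mul]; exact Nat.mul_le_mul (hp k) (hp' k)⟩

theorem PolyBounded.eval {f : ℕ → ℕ} (hf : PolyBounded f) (p : Polynomial ℕ) :
    PolyBounded (fun k => p.eval (f k)) := by
  obtain ⟨p', hp'⟩ := hf
  exact ⟨p.comp p', fun k => by
    rw [Polynomial.eval_comp]; exact polynomial_eval_mono p (hp' k)⟩

theorem PolyBounded.comp {f g : ℕ → ℕ} (hg : PolyBounded g) (hf : PolyBounded f) :
    PolyBounded (fun k => g (f k)) := by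
  obtain ⟨p, hp⟩ := hg
  exact (hf.eval p).mono fun k => hp _

theorem Negl.of_abs_le {f g : ℕ → ℝ} (hg : Negl g) (h : ∀ k, |f k| ≤ g k) : Negl f :=
  Asymptotics.SuperpolynomialDecay.trans_abs_le hg
    (fun k => (h k).trans (le_abs_self _))

theorem Negl.add {f g : ℕ → ℝ} (hf : Negl f) (hg : Negl g) : Negl (fun k => f k + g k) :=
  Asymptotics.SuperpolynomialDecay.add hf hg

theorem Negl.const_mul {f : ℕ → ℝ} (hf : Negl f) (c : ℝ) : Negl (fun k => c * f k) :=
  Asymptotics.SuperpolynomialDecay.const_mul hf c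

theorem Negl.polyBounded_mul {f : ℕ → ℝ} {n : ℕ → ℕ} (hf : Negl f) (hn : PolyBounded n) :
    Negl (fun k => (n k : ℝ) * f k) := by
  obtain ⟨p, hp⟩ := hn
  have h := Asymptotics.SuperpolynomialDecay.polynomial_mul hf (p.map (Nat.castRingHom ℝ))
  refine Asymptotics.SuperpolynomialDecay.trans_abs_le h fun k => ?_
  have : (p.map (Nat.castRingHom ℝ)).eval (k : ℝ) = ((p.eval k : ℕ) : ℝ) := by
    rw [Polynomial.eval_map]
    simp
  rw [abs_mul, abs_mul, this]
  gcongr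
  exact hp k

end Asymptotics

/-! ### Averages and statistical distance -/

section Probability

variable {A B S T : Type} [Fintype A] [Fintype B] [Fintype S] [Fintype T]

theorem statDist_nonneg (P Q : PMF A) : 0 ≤ statDist P Q := by
  unfold statDist; positivity

theorem abs_sum_sub_le_statDist (P Q : PMF A) (f : A → ℝ) {c : ℝ} (h0 : ∀ a, 0 ≤ f a)
    (h1 : ∀ a, f a ≤ c) :
    |∑ a, (P a).toReal * f a - ∑ a, (Q a).toReal * f a| ≤ 2 * c * statDist P Q := by
  rw [← Finset.sum_sub_distrib]
  calc |∑ a, ((P a).toReal * f a - (Q a).toReal * f a)|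
      ≤ ∑ a, |(P a).toReal * f a - (Q a).toReal * f a| := Finset.abs_sum_le_sum_abs _ _
    _ ≤ ∑ a, |(P a).toReal - (Q a).toReal| * c := by
        refine Finset.sum_le_sum fun a _ => ?_
        rw [← sub_mul, abs_mul, abs_of_nonneg (h0 a)]
        exact mul_le_mul_of_nonneg_left (h1 a) (abs_nonneg _)
    _ = 2 * c * statDist P Q := by rw [← Finset.sum_mul, statDist]; ring

theorem expect_eq_inv_mul_sum (f : T → ℝ) : 𝔼 t, f t = (Fintype.card T : ℝ)⁻¹ * ∑ t, f t := by
  rw [Fintype.expect_eq_sum_div_card, div_eq_inv_mul]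

theorem sum_uniform_map [Nonempty T] (g : T → A) (f : A → ℝ) :
    ∑ a, (((PMF.uniformOfFintype T).map g) a).toReal * f a = 𝔼 t, f (g t) := by
  classical
  have h : ∀ a, (((PMF.uniformOfFintype T).map g) a).toReal =
      ∑ t, if a = g t then (Fintype.card T : ℝ)⁻¹ else 0 := by
    intro a
    rw [PMF.map_apply, tsum_fintype, ENNReal.toReal_sum]
    · refine Finset.sum_congr rfl fun t _ => ?_
      split_ifs <;> simp
    · intro t _
      split_ifs
      · exact (PMF.apply_ne_top _ _)
      · simp
  simp only [h, Finset.sum_mul, ite_mul, zero_mul]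
  rw [Finset.sum_comm, expect_eq_inv_mul_sum, Finset.mul_sum]
  refine Finset.sum_congr rfl fun t _ => ?_
  simp

theorem sum_uniform [Nonempty T] (f : T → ℝ) :
    ∑ t, ((PMF.uniformOfFintype T) t).toReal * f t = 𝔼 t, f t := by
  rw [expect_eq_inv_mul_sum, Finset.mul_sum]
  simp

theorem expect_eq_of_map_eq [Nonempty S] [Nonempty T] {g : S → A} {h : T → A}
    (hgh : (PMF.uniformOfFintype S).map g = (PMF.uniformOfFintype T).map h) (f : A → ℝ) :
    𝔼 s, f (g s) = 𝔼 t, f (h t) := by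
  rw [← sum_uniform_map, ← sum_uniform_map, hgh]

theorem abs_expect_sub_le [Nonempty S] [Nonempty T] (g : S → A) (h : T → A) (f : A → ℝ) {c : ℝ}
    (h0 : ∀ a, 0 ≤ f a) (h1 : ∀ a, f a ≤ c) :
    |𝔼 s, f (g s) - 𝔼 t, f (h t)| ≤
      2 * c * statDist ((PMF.uniformOfFintype S).map g) ((PMF.uniformOfFintype T).map h) := by
  rw [← sum_uniform_map, ← sum_uniform_map]
  exact abs_sum_sub_le_statDist _ _ _ h0 h1

theorem expect_prod (f : S × T → ℝ) : 𝔼 p, f p = 𝔼 s, 𝔼 t, f (s, t) := by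
  rw [← Finset.univ_product_univ, Finset.expect_product]

theorem expect_prod_comm (f : S → T → ℝ) : 𝔼 s, 𝔼 t, f s t = 𝔼 t, 𝔼 s, f s t :=
  Finset.expect_comm _ _ _

theorem abs_expect_le (f : T → ℝ) : |𝔼 t, f t| ≤ 𝔼 t, |f t| := by
  rw [expect_eq_inv_mul_sum, expect_eq_inv_mul_sum, abs_mul, abs_of_nonneg (by positivity)]
  gcongr
  exact Finset.abs_sum_le_sum_abs _ _

theorem expect_le_of_le [Nonempty T] {f : T → ℝ} {c : ℝ} (h : ∀ t, f t ≤ c) : 𝔼 t, f t ≤ c :=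
  (Finset.expect_le_expect fun t _ => h t).trans_eq (Fintype.expect_const c)

/-- Resampling one of several independent uniform random variables. -/
theorem expect_update {I : Type} [Fintype I] [DecidableEq I] [Nonempty T] (i : I)
    (f : (I → T) → ℝ) : 𝔼 r, f r = 𝔼 r, 𝔼 t, f (Function.update r i t) := by
  classical
  have h : 𝔼 r : I → T, 𝔼 t, f (Function.update r i t) =
      𝔼 p : (I → T) × T, f (Function.update p.1 i p.2) :=
    (expect_prod (fun p : (I → T) × T => f (Function.update p.1 i p.2))).symm
  let e : (I → T) × T ≃ (I → T) × T :=
    ⟨fun p => (Function.update p.1 i p.2, p.1 i), fun p => (Function.update p.1 i p.2, p.1 i),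
      fun p => by simp, fun p => by simp⟩
  have h2 : 𝔼 p : (I → T) × T, f (Function.update p.1 i p.2) = 𝔼 p : (I → T) × T, f p.1 :=
    Fintype.expect_equiv e _ _ (fun p => rfl)
  rw [h, h2, expect_prod]
  exact Finset.expect_congr rfl fun r _ => (Fintype.expect_const _).symm

end Probability

/-! ### Acceptance probabilities -/

section Accept

variable {ω α β γ : Type} [Fintype ω] [DecidableEq ω] [Fintype α] [DecidableEq α]
  [Fintype β] [DecidableEq β] [Fintype γ] [DecidableEq γ]

/-- The final state of the answer qubit of a distinguisher. -/
noncomputable def Distinguisher.answer (D : Distinguisher ω) (ρ : Op ω) : Op Unit :=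
  traceRight (D.circ.apply (tens (zeroState Unit) (tens ρ (zeroState (Fin D.na)))))

theorem Distinguisher.implements_answer (D : Distinguisher ω) :
    Implements (1 + D.na + D.circ.length) (fun ρ : Op ω => ρ) (fun ρ => D.answer ρ) := by
  have h1 := (implements_tens_zeroState (α := ω) (β := Fin D.na)).tens_zeroState Unit
  have h2 := ((h1.reix (Equiv.sumComm _ _)).apply D.circ).traceRight
  refine (h2.mono (by simp [add_comm])).congr (fun _ => rfl) (fun ρ => ?_)
  rw [reix_sumComm]
  rfl

theorem Distinguisher.accept_sum {J : Type*} (S : Finset J) (D : Distinguisher ω)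
    (X : J → Op ω) : D.accept (∑ j ∈ S, X j) = ∑ j ∈ S, D.accept (X j) := by
  simp only [Distinguisher.accept, tens_sum_left, tens_sum_right, apply_sum, outcome_sum,
    Matrix.trace_sum, Complex.re_sum]

theorem Distinguisher.accept_smul (D : Distinguisher ω) (c : ℝ) (X : Op ω) :
    D.accept ((c : ℂ) • X) = c * D.accept X := by
  simp only [Distinguisher.accept, tens_smul_left, tens_smul_right, QCircuit.apply,
    Matrix.mul_smul, Matrix.smul_mul, outcome_smul, Matrix.trace_smul, smul_eq_mul,
    Complex.re_ofReal_mul]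

theorem posSemidef_zeroState : (zeroState α).PosSemidef := posSemidef_ketBra _

theorem Distinguisher.accept_nonneg (D : Distinguisher ω) {ρ : Op ω} (h : ρ.PosSemidef) :
    0 ≤ D.accept ρ :=
  re_trace_nonneg (posSemidef_outcome (posSemidef_apply _ (posSemidef_tens posSemidef_zeroState
    (posSemidef_tens h posSemidef_zeroState))) _)

theorem Distinguisher.accept_le (D : Distinguisher ω) {ρ : Op ω} (h : ρ.PosSemidef) :
    D.accept ρ ≤ ρ.trace.re := by
  set X := D.circ.apply (tens (zeroState Unit) (tens ρ (zeroState (Fin D.na))))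
  have hX : X.PosSemidef := posSemidef_apply _ (posSemidef_tens posSemidef_zeroState
    (posSemidef_tens h posSemidef_zeroState))
  have h1 : (∑ r, (outcome r X).trace).re = ρ.trace.re := by
    rw [sum_trace_outcome, trace_apply, trace_tens, trace_tens]
    simp [zeroState, trace_ketBra]
  rw [sum_unit, Complex.add_re] at h1
  have h2 : 0 ≤ (outcome (fun _ : Unit => false) X).trace.re :=
    re_trace_nonneg (posSemidef_outcome hX _)
  have h3 : D.accept ρ = (outcome (fun _ : Unit => true) X).trace.re := rfl
  linarith

end Accept

section ExecutionTrace

variable {Ω ι ο α β : Type} [Fintype Ω]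
  [Fintype ι] [DecidableEq ι] [Fintype ο] [DecidableEq ο]
  [Fintype α] [DecidableEq α] [Fintype β] [DecidableEq β] {nz nq no : ℕ}

theorem Adversary.posSemidef_step (A : Adversary α β nz nq no) (i : ℕ) (m : α → Bool)
    (r : β → Bool) {ρ : Op (Mem nz nq no A.na)} (h : ρ.PosSemidef) :
    (A.step i m r ρ).PosSemidef :=
  posSemidef_outcome (posSemidef_traceLeft (posSemidef_apply _ (posSemidef_tens
    (posSemidef_ketBra _) (posSemidef_tens posSemidef_zeroState h)))) _

theorem Adversary.sum_trace_step (A : Adversary α β nz nq no) (i : ℕ) (m : α → Bool)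
    (ρ : Op (Mem nz nq no A.na)) : ∑ r, (A.step i m r ρ).trace = ρ.trace := by
  simp only [Adversary.step]
  rw [sum_trace_outcome, trace_traceLeft, trace_apply, trace_tens, trace_tens]
  simp [zeroState, trace_ketBra]

theorem Adversary.sum_re_trace_step (A : Adversary α β nz nq no) (i : ℕ) (m : α → Bool)
    (ρ : Op (Mem nz nq no A.na)) : ∑ r, (A.step i m r ρ).trace.re = ρ.trace.re := by
  rw [← A.sum_trace_step i m ρ, Complex.re_sum]

theorem Adversary.posSemidef_start (A : Adversary α β nz nq no) (z : Bits nz) {ρ : Op (Fin nq)}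
    (h : ρ.PosSemidef) : (A.start z ρ).PosSemidef :=
  posSemidef_tens (posSemidef_ketBra _) (posSemidef_tens h
    (posSemidef_tens posSemidef_zeroState posSemidef_zeroState))

theorem Adversary.trace_start (A : Adversary α β nz nq no) (z : Bits nz) (ρ : Op (Fin nq)) :
    (A.start z ρ).trace = ρ.trace := by
  simp [Adversary.start, trace_tens, zeroState, trace_ketBra]

theorem Adversary.posSemidef_finish (A : Adversary α β nz nq no) {ρ : Op (Mem nz nq no A.na)}
    (h : ρ.PosSemidef) : (A.finish ρ).PosSemidef :=
  posSemidef_traceRight (posSemidef_traceLeft (posSemidef_traceLeft (posSemidef_apply _ h)))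

theorem Adversary.trace_finish (A : Adversary α β nz nq no) (ρ : Op (Mem nz nq no A.na)) :
    (A.finish ρ).trace = ρ.trace := by
  rw [Adversary.finish, trace_traceRight, trace_traceLeft, trace_traceLeft, trace_apply]

theorem Sampler.posSemidef_state (T : Sampler ι nz nq) (u : ι → Bool) (z : Bits nz) :
    (T.state u z).PosSemidef :=
  posSemidef_traceRight (posSemidef_outcome (posSemidef_outcome (posSemidef_apply _
    posSemidef_zeroState) _) _)

theorem Sampler.sum_trace_state (T : Sampler ι nz nq) :
    ∑ u, ∑ z, (T.state u z).trace = 1 := by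
  simp only [Sampler.state, trace_traceRight, sum_trace_outcome, trace_apply]
  exact trace_ketBra _

theorem Sampler.sum_re_trace_state (T : Sampler ι nz nq) :
    ∑ u, ∑ z, (T.state u z).trace.re = 1 := by
  have h := congrArg Complex.re T.sum_trace_state
  simpa only [Complex.re_sum, Complex.one_re] using h

end ExecutionTrace

/-! ### Families of bits computed by poly-size circuits -/

section BitCompMore

variable {α : Type} [Fintype α] [DecidableEq α] {s t : ℕ}

theorem BitComp.congr {f g : (α → Bool) → Bool} (hf : BitComp s f) (h : ∀ x, g x = f x) :
    BitComp s g := by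
  obtain rfl : g = f := funext h
  exact hf

theorem BitComp.not {f : (α → Bool) → Bool} (hf : BitComp s f) :
    BitComp (s + 4) (fun x => !f x) :=
  ((hf.nand (bitComp_const true)).mono (by omega)).congr (fun x => by simp)

theorem BitComp.and {f g : (α → Bool) → Bool} (hf : BitComp s f) (hg : BitComp t g) :
    BitComp (s + t + 6) (fun x => f x && g x) :=
  ((hf.nand hg).not.mono (by omega)).congr (fun x => by simp)

theorem BitComp.list_all {J : Type} (L : List J) {f : J → (α → Bool) → Bool}
    (hf : ∀ j, BitComp s (f j)) :
    BitComp (L.length * (s + 6) + 2) (fun x => L.all fun j => f j x) := by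
  induction L with
  | nil => exact ((bitComp_const true).mono (by simp)).congr (fun _ => rfl)
  | cons j L ih =>
    refine (((hf j).and ih).mono ?_).congr (fun x => by simp)
    simp only [List.length_cons]; ring_nf; omega

end BitCompMore

section PolyBits

variable {α β I I' J A B : ℕ → Type} [∀ κ, Fintype (α κ)] [∀ κ, DecidableEq (α κ)]
  [∀ κ, Fintype (β κ)] [∀ κ, DecidableEq (β κ)] [∀ κ, Fintype (J κ)]

/-- The bits `f κ i` of a classical register with the wires `α κ` are computed by circuits of
size polynomial in `κ`, uniformly in the index `i`. -/
def PolyBits (f : ∀ κ, I κ → (α κ → Bool) → Bool) : Prop :=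
  ∃ s : ℕ → ℕ, PolyBounded s ∧ ∀ κ i, BitComp (s κ) (f κ i)

theorem PolyBits.congr {f g : ∀ κ, I κ → (α κ → Bool) → Bool} (hf : PolyBits f)
    (h : ∀ κ i x, g κ i x = f κ i x) : PolyBits g := by
  obtain rfl : g = f := by funext κ i x; exact h κ i x
  exact hf

theorem PolyBits.comap {f : ∀ κ, I κ → (α κ → Bool) → Bool} (hf : PolyBits f)
    (φ : ∀ κ, I' κ → I κ) : PolyBits fun κ i => f κ (φ κ i) := by
  obtain ⟨s, hs, h⟩ := hf
  exact ⟨s, hs, fun κ i => h κ _⟩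

theorem polyBits_const (b : Bool) : PolyBits fun κ (_ : I κ) (_ : α κ → Bool) => b :=
  ⟨fun _ => 2, polyBounded_const _, fun _ _ => bitComp_const b⟩

theorem polyBits_var (v : ∀ κ, I κ → α κ) : PolyBits fun κ i (x : α κ → Bool) => x (v κ i) :=
  ⟨fun _ => 2, polyBounded_const _, fun _ _ => bitComp_var _⟩

theorem PolyBits.not {f : ∀ κ, I κ → (α κ → Bool) → Bool} (hf : PolyBits f) :
    PolyBits fun κ i x => !f κ i x := by
  obtain ⟨s, hs, h⟩ := hf
  exact ⟨_, hs.add (polyBounded_const 4), fun κ i => (h κ i).not⟩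

theorem PolyBits.and {f g : ∀ κ, I κ → (α κ → Bool) → Bool} (hf : PolyBits f) (hg : PolyBits g) :
    PolyBits fun κ i x => f κ i x && g κ i x := by
  obtain ⟨s, hs, h⟩ := hf
  obtain ⟨t, ht, h'⟩ := hg
  exact ⟨_, (hs.add ht).add (polyBounded_const 6), fun κ i => (h κ i).and (h' κ i)⟩

theorem PolyBits.or {f g : ∀ κ, I κ → (α κ → Bool) → Bool} (hf : PolyBits f) (hg : PolyBits g) :
    PolyBits fun κ i x => f κ i x || g κ i x :=
  (hf.not.and hg.not).not.congr fun κ i x => by simp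

theorem PolyBits.beq {f g : ∀ κ, I κ → (α κ → Bool) → Bool} (hf : PolyBits f) (hg : PolyBits g) :
    PolyBits fun κ i x => f κ i x == g κ i x :=
  ((hf.and hg).or (hf.not.and hg.not)).congr fun κ i x => by
    cases f κ i x <;> cases g κ i x <;> rfl

theorem PolyBits.all {f : ∀ κ, I κ → J κ → (α κ → Bool) → Bool}
    {F : ∀ κ, I κ → (α κ → Bool) → Bool} (hJ : PolyBounded fun κ => Fintype.card (J κ))
    (hf : PolyBits (I := fun κ => I κ × J κ) fun κ i => f κ i.1 i.2)
    (hF : ∀ κ i x, F κ i x = true ↔ ∀ j, f κ i j x = true) : PolyBits F := by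
  obtain ⟨s, hs, h⟩ := hf
  refine ⟨_, (hJ.mul (hs.add (polyBounded_const 6))).add (polyBounded_const 2), fun κ i => ?_⟩
  refine ((BitComp.list_all (Finset.univ : Finset (J κ)).toList
    (fun j => h κ (i, j))).mono (by simp)).congr (fun x => ?_)
  rw [Bool.eq_iff_iff, hF]
  simp

theorem PolyBits.sum {F : ∀ κ, I κ → A κ ⊕ B κ → (α κ → Bool) → Bool}
    (hA : PolyBits (I := fun κ => I κ × A κ) fun κ i => F κ i.1 (.inl i.2))
    (hB : PolyBits (I := fun κ => I κ × B κ) fun κ i => F κ i.1 (.inr i.2)) :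
    PolyBits (I := fun κ => I κ × (A κ ⊕ B κ)) fun κ i => F κ i.1 i.2 := by
  obtain ⟨s, hs, h⟩ := hA
  obtain ⟨t, ht, h'⟩ := hB
  refine ⟨_, hs.add ht, fun κ i => ?_⟩
  rcases i with ⟨i, a | b⟩
  · exact (h κ (i, a)).mono (Nat.le_add_right _ _)
  · exact (h' κ (i, b)).mono (Nat.le_add_left _ _)

theorem PolyBits.sum_index {F : ∀ κ, A κ ⊕ B κ → (α κ → Bool) → Bool}
    (hA : PolyBits fun κ a => F κ (.inl a)) (hB : PolyBits fun κ b => F κ (.inr b)) :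
    PolyBits F := by
  obtain ⟨s, hs, h⟩ := hA
  obtain ⟨t, ht, h'⟩ := hB
  refine ⟨_, hs.add ht, fun κ i => ?_⟩
  rcases i with a | b
  · exact (h κ a).mono (Nat.le_add_right _ _)
  · exact (h' κ b).mono (Nat.le_add_left _ _)

theorem PolySize.reindex [∀ κ, DecidableEq (A κ)] [∀ κ, DecidableEq (B κ)]
    {f : ∀ k, (A k → Bool) → (B k → Bool)} (hf : PolySize f) {l : ℕ → ℕ} (hl : PolyBounded l) :
    PolySize (α := fun κ => A (l κ)) (β := fun κ => B (l κ)) fun κ => f (l κ) := by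
  obtain ⟨p, hp⟩ := hf
  obtain ⟨p', hp'⟩ := hl.eval p
  refine ⟨p', fun κ => ?_⟩
  obtain ⟨W, hW, P, hP, h⟩ := hp (l κ)
  exact ⟨W, hW.trans (hp' κ), P, hP.trans (hp' κ), h⟩

/-- Bits computed by a poly-size Boolean program from poly-many bits. -/
theorem PolyBits.subst [∀ κ, Fintype (A κ)] [∀ κ, DecidableEq (A κ)] [∀ κ, Fintype (B κ)]
    [∀ κ, DecidableEq (B κ)] {g : ∀ κ, (A κ → Bool) → (B κ → Bool)} (hg : PolySize g)
    (hA : PolyBounded fun κ => Fintype.card (A κ)) (hB : PolyBounded fun κ => Fintype.card (B κ))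
    {f : ∀ κ, I κ → A κ → (α κ → Bool) → Bool}
    (hf : PolyBits (I := fun κ => I κ × A κ) fun κ i => f κ i.1 i.2) (b : ∀ κ, I κ → B κ) :
    PolyBits fun κ i x => g κ (fun a => f κ i a x) (b κ i) := by
  obtain ⟨s, hs, h⟩ := hf
  obtain ⟨p, hp⟩ := hg
  have hpp := polyBounded_id.eval p
  refine ⟨_, (hA.mul hs).add ((hB.add (hpp.add ((polyBounded_const 2).mul hpp))).add
    (polyBounded_const 2)), fun κ i => ?_⟩
  obtain ⟨W, hW, P, hP, hrun⟩ := hp κ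
  have h1 := implements_program P (f := g κ) (fun x b => hrun x (Set.mem_univ _) b)
  have h2 := h1.trans ((bitComp_var (b κ i)).value.comap (g κ))
  refine (BitComp.subst (fun a => h κ (i, a)) h2).mono ?_
  have : W ≤ p.eval κ := hW
  omega

end PolyBits

/-! ### Poly-size executions -/

section PolyExec

variable {ι ο α β χ : ℕ → Type}
  [∀ κ, Fintype (ι κ)] [∀ κ, DecidableEq (ι κ)] [∀ κ, Fintype (ο κ)] [∀ κ, DecidableEq (ο κ)]
  [∀ κ, Fintype (α κ)] [∀ κ, DecidableEq (α κ)] [∀ κ, Fintype (β κ)] [∀ κ, DecidableEq (β κ)]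
  [∀ κ, Fintype (χ κ)] [∀ κ, DecidableEq (χ κ)] {nz nq no : ℕ → ℕ}

/-- Executions with four rounds against a poly-size adversary have poly-size circuits if the
messages and the result of the system are computed by such circuits. -/
theorem poly_implements_exec4 (A : ∀ κ, Adversary (α κ) (β κ) (nz κ) (nq κ) (no κ))
    (hA : AdvPoly A) (M : ∀ κ, System (χ κ → Bool) (ι κ) (ο κ) (α κ) (β κ))
    (hα : PolyBounded fun κ => Fintype.card (α κ)) (hβ : PolyBounded fun κ => Fintype.card (β κ))
    (hο : PolyBounded fun κ => Fintype.card (ο κ)) (hχ : PolyBounded fun κ => Fintype.card (χ κ))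
    (h0 : PolyBits (α := fun κ => ι κ ⊕ χ κ) fun κ a x =>
      (M κ).send (x ∘ .inl) (x ∘ .inr) [] a)
    (h1 : PolyBits (α := fun κ => (ι κ ⊕ χ κ) ⊕ β κ) fun κ a x =>
      (M κ).send (x ∘ .inl ∘ .inl) (x ∘ .inl ∘ .inr) [x ∘ .inr] a)
    (h2 : PolyBits (α := fun κ => ((ι κ ⊕ χ κ) ⊕ β κ) ⊕ β κ) fun κ a x =>
      (M κ).send (x ∘ .inl ∘ .inl ∘ .inl) (x ∘ .inl ∘ .inl ∘ .inr)
        [x ∘ .inl ∘ .inr, x ∘ .inr] a)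
    (h3 : PolyBits (α := fun κ => (((ι κ ⊕ χ κ) ⊕ β κ) ⊕ β κ) ⊕ β κ) fun κ a x =>
      (M κ).send (x ∘ .inl ∘ .inl ∘ .inl ∘ .inl) (x ∘ .inl ∘ .inl ∘ .inl ∘ .inr)
        [x ∘ .inl ∘ .inl ∘ .inr, x ∘ .inl ∘ .inr, x ∘ .inr] a)
    (hr : PolyBits (α := fun κ => ((((ι κ ⊕ χ κ) ⊕ β κ) ⊕ β κ) ⊕ β κ) ⊕ β κ) fun κ o x =>
      (M κ).result (x ∘ .inl ∘ .inl ∘ .inl ∘ .inl ∘ .inl) (x ∘ .inl ∘ .inl ∘ .inl ∘ .inl ∘ .inr)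
        [x ∘ .inl ∘ .inl ∘ .inl ∘ .inr, x ∘ .inl ∘ .inl ∘ .inr, x ∘ .inl ∘ .inr, x ∘ .inr] o) :
    ∃ s, PolyBounded s ∧ ∀ κ, Implements (s κ)
      (fun p : (ι κ → Bool) × Bits (nz κ) × Op (Fin (nq κ)) =>
        tens (ketBra p.1) (tens (ketBra p.2.1) p.2.2))
      (fun p => (M κ).exec4 (A κ) p.1 ((A κ).start p.2.1 p.2.2)) := by
  obtain ⟨p, hp⟩ := hA
  obtain ⟨s0, hs0, h0⟩ := h0
  obtain ⟨s1, hs1, h1⟩ := h1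
  obtain ⟨s2, hs2, h2⟩ := h2
  obtain ⟨s3, hs3, h3⟩ := h3
  obtain ⟨sr, hsr, hr⟩ := hr
  have hs : PolyBounded fun κ => s0 κ + s1 κ + s2 κ + s3 κ + sr κ :=
    (((hs0.add hs1).add hs2).add hs3).add hsr
  have hpp := polyBounded_id.eval p
  have hc3 := polyBounded_const 3
  have hc4 := polyBounded_const 4
  refine ⟨_, ((hc4.mul hχ).add (hpp.add hpp)).add
    ((hc4.mul ((hα.mul hs).add ((hc3.mul hβ).add hpp))).add ((hο.mul hs).add hpp)),
    fun κ => ?_⟩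
  obtain ⟨-, -, p1, p2, p3, p4⟩ := hp κ
  refine (implements_exec4 (s := s0 κ + s1 κ + s2 κ + s3 κ + sr κ) (A κ) (M κ) p3
    (fun a => (h0 κ a).mono (by omega)) (fun a => (h1 κ a).mono (by omega))
    (fun a => (h2 κ a).mono (by omega)) (fun a => (h3 κ a).mono (by omega))
    (fun a => (hr κ a).mono (by omega))).mono ?_
  omega

end PolyExec

/-! ### The dishonest prover: acceptance and extraction -/

section ProverSystems

variable (W : WitnessEncoding) (C : CommitScheme) (κ k q : ℕ)

open Classical in
/-- The verifier's check of the opening `(b, r)` of the commitments `F` for the instance `x` and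
the challenge `s`. -/
noncomputable def acceptBit (pk : Bits κ) (s : Bits (W.sig k)) (x : Bits k)
    (F : Fin (W.n k) → Bits (C.clen κ)) (b : Bits (W.n k)) (r : Fin (W.n k) → Bits (C.rlen κ)) :
    Bool :=
  decide (∀ i ∈ W.S k s, C.commit κ pk (b i) (r i) = F i) && W.J k x s (restrict b (W.S k s))

/-- The verifier's judgment as a function of the coins and of the four replies of the prover. -/
noncomputable def proverAccept (pk : Bits κ) (s : Bits (W.sig k))
    (r₀ r₁ r₂ r₃ : FromProverW W C κ k → Bool) : Bool :=
  (r₀ (.inl ()) && r₁ (.inr (.inl (.inl ()))) && r₂ (.inl ()) && r₃ (.inr (.inr (.inl ())))) &&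
    acceptBit W C κ k pk s (fun i => r₁ (.inr (.inl (.inr (.inl i)))))
      (fun i j => r₁ (.inr (.inl (.inr (.inr (i, j)))))) (fun i => r₃ (.inr (.inr (.inr (.inl i)))))
      (fun i j => r₃ (.inr (.inr (.inr (.inr (i, j))))))

theorem realProver_result (u : Empty → Bool) (c : Bits κ × Bits (W.sig k))
    (r₀ r₁ r₂ r₃ : FromProverW W C κ k → Bool) :
    (realProver W C κ k).result u c [r₀, r₁, r₂, r₃] =
      Sum.elim (fun i => r₀ (.inl ()) && r₁ (.inr (.inl (.inr (.inl i)))))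
        (fun _ => proverAccept W C κ k c.1 c.2 r₀ r₁ r₂ r₃) := by
  simp only [realProver, verdict]
  rw [sum_elim_eq_iff]
  simp only [verifierOut, coin, ProverMsg.read, readOpening, proverAccept, acceptBit]
  cases r₀ (.inl ()) <;> cases r₁ (.inr (.inl (.inl ()))) <;> cases r₂ (.inl ()) <;>
    cases r₃ (.inr (.inr (.inl ()))) <;> simp

/-- The protocol with dishonest prover, with the key as input of the honest party. -/
noncomputable def keyProver : System (Fin (W.sig k) → Bool) (Fin κ) (OutW k) (ToProverW W κ k)
    (FromProverW W C κ k) where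
  rounds := 4
  send pk s hist := (realProver W C κ k).send Empty.elim (pk, s) hist
  result pk s hist := (realProver W C κ k).result Empty.elim (pk, s) hist

/-- The bits that the prover committed to, extracted with the secret key. -/
def extractedBits (t : Bits (C.bcoins κ)) (r₁ : FromProverW W C κ k → Bool) : Bits (W.n k) :=
  fun i => C.xtr κ (C.genB κ t).2 (fun j => r₁ (.inr (.inl (.inr (.inr (i, j))))))

/-- The input that the simulator of a dishonest prover sends to the functionality: the extracted
witness if the verifier accepts, and an invalid witness otherwise. -/
noncomputable def simInput (t : Bits (C.bcoins κ)) (s : Bits (W.sig k))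
    (r₀ r₁ r₂ r₃ : FromProverW W C κ k → Bool) : InW k q → Bool :=
  Sum.elim (fun i => r₀ (.inl ()) && r₁ (.inr (.inl (.inr (.inl i)))))
    (fun a => proverAccept W C κ k (C.genB κ t).1 s r₀ r₁ r₂ r₃ &&
      encodeWit q (W.D k (fun i => r₁ (.inr (.inl (.inr (.inl i)))))
        (extractedBits W C κ k t r₁)) a)

/-- The simulated protocol with dishonest prover: the key comes with a secret key, and the honest
output is replaced by the simulator's input to the functionality. -/
noncomputable def simProver : System ((Fin (C.bcoins κ) ⊕ Fin (W.sig k)) → Bool) Empty (InW k q)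
    (ToProverW W κ k) (FromProverW W C κ k) where
  rounds := 4
  send _ c hist := (realProver W C κ k).send Empty.elim ((C.genB κ (c ∘ .inl)).1, c ∘ .inr) hist
  result _ c hist := match hist with
    | [r₀, r₁, r₂, r₃] => simInput W C κ k q (c ∘ .inl) (c ∘ .inr) r₀ r₁ r₂ r₃
    | _ => fun _ => false

theorem realProver_send_two (u : Empty → Bool) (c : Bits κ × Bits (W.sig k))
    (r₀ r₁ : FromProverW W C κ k → Bool) :
    (realProver W C κ k).send u c [r₀, r₁] =
      Sum.elim (fun _ => false) (fun i => (r₀ (.inl ()) && r₁ (.inr (.inl (.inl ())))) && c.2 i) := by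
  simp only [realProver, ProverMsg.read]
  cases r₀ (.inl ()) <;> cases r₁ (.inr (.inl (.inl ()))) <;> simp

theorem fill_restrict {n : ℕ} (e : Bits n) (S : Finset (Fin n)) :
    fill S (restrict e S) = fun i => decide (i ∈ S) && e i := by
  funext i
  by_cases h : i ∈ S <;> simp [fill, restrict, h]

end ProverSystems

/-! ### Circuits for the judgment and the extraction -/

section ProverPoly

variable {R : Set (List Bool × List Bool)} {W : WitnessEncoding} {C : CommitScheme} {q ℓ : ℕ → ℕ}
  {ω : ℕ → Type} [∀ κ, Fintype (ω κ)] [∀ κ, DecidableEq (ω κ)] {I : ℕ → Type}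

theorem PolyBits.elim {A B : ℕ → Type} {f : ∀ κ, A κ → (ω κ → Bool) → Bool}
    {g : ∀ κ, B κ → (ω κ → Bool) → Bool} (hf : PolyBits f) (hg : PolyBits g) :
    PolyBits (I := fun κ => A κ ⊕ B κ) fun κ i x =>
      Sum.elim (fun a => f κ a x) (fun b => g κ b x) i :=
  PolyBits.sum_index (F := fun κ i x => Sum.elim (fun a => f κ a x) (fun b => g κ b x) i) hf hg

theorem polyBits_mem_S (hW : W.IsPoly R q) (hℓ : PolyBounded ℓ)
    {s : ∀ κ, Fin (W.sig (ℓ κ)) → (ω κ → Bool) → Bool} (hs : PolyBits s)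
    (b : ∀ κ, I κ → Fin (W.n (ℓ κ))) :
    PolyBits fun κ i x => decide (b κ i ∈ W.S (ℓ κ) (fun a => s κ a x)) :=
  PolyBits.subst (hW.S_poly.reindex hℓ) (by simpa using hW.sig_poly.comp hℓ)
    (by simpa using hW.n_poly.comp hℓ) (I := I) (f := fun κ _ a x => s κ a x)
    (hs.comap fun κ (i : I κ × _) => i.2) b

theorem polyBits_commit (hC : C.IsMixed) {pk : ∀ κ, Fin κ → (ω κ → Bool) → Bool}
    (hpk : PolyBits pk) {b : ∀ κ, I κ → (ω κ → Bool) → Bool} (hb : PolyBits b)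
    {r : ∀ κ, I κ → Fin (C.rlen κ) → (ω κ → Bool) → Bool}
    (hr : PolyBits (I := fun κ => I κ × Fin (C.rlen κ)) fun κ i => r κ i.1 i.2)
    (j : ∀ κ, I κ → Fin (C.clen κ)) :
    PolyBits fun κ i x =>
      C.commit κ (fun a => pk κ a x) (b κ i x) (fun a => r κ i a x) (j κ i) := by
  refine (PolyBits.subst hC.commit_poly ?_ ?_ (I := I)
    (f := fun κ i a x => Sum.elim (fun a => pk κ a x)
      (Sum.elim (fun _ => b κ i x) (fun a => r κ i a x)) a) ?_ j).congr (fun κ i x => rfl)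
  · simpa using polyBounded_id.add ((polyBounded_const 1).add hC.rlen_poly)
  · simpa using hC.clen_poly
  · refine PolyBits.sum (F := fun κ i a x => Sum.elim (fun a => pk κ a x)
      (Sum.elim (fun _ => b κ i x) (fun a => r κ i a x)) a)
      (hpk.comap fun κ (i : I κ × _) => i.2) ?_
    exact PolyBits.sum (F := fun κ i a x => Sum.elim (fun _ => b κ i x) (fun a => r κ i a x) a)
      (hb.comap fun κ (i : I κ × _) => i.1) hr

theorem polyBits_accept (hW : W.IsPoly R q) (hℓ : PolyBounded ℓ) (hC : C.IsMixed)
    {pk : ∀ κ, Fin κ → (ω κ → Bool) → Bool} (hpk : PolyBits pk)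
    {s : ∀ κ, Fin (W.sig (ℓ κ)) → (ω κ → Bool) → Bool} (hs : PolyBits s)
    {y : ∀ κ, Fin (ℓ κ) → (ω κ → Bool) → Bool} (hy : PolyBits y)
    {F : ∀ κ, Fin (W.n (ℓ κ)) × Fin (C.clen κ) → (ω κ → Bool) → Bool} (hF : PolyBits F)
    {b : ∀ κ, Fin (W.n (ℓ κ)) → (ω κ → Bool) → Bool} (hb : PolyBits b)
    {r : ∀ κ, Fin (W.n (ℓ κ)) × Fin (C.rlen κ) → (ω κ → Bool) → Bool} (hr : PolyBits r) :
    PolyBits (I := fun _ => Unit) fun κ _ x => acceptBit W C κ (ℓ κ) (fun a => pk κ a x)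
      (fun a => s κ a x) (fun a => y κ a x) (fun i j => F κ (i, j) x) (fun i => b κ i x)
      (fun i j => r κ (i, j) x) := by
  have hn := hW.n_poly.comp hℓ
  -- the commitments selected by the challenge are opened correctly
  have h1 : PolyBits (I := fun κ => Fin (W.n (ℓ κ)) × Fin (C.clen κ)) fun κ i x =>
      C.commit κ (fun a => pk κ a x) (b κ i.1 x) (fun a => r κ (i.1, a) x) i.2 == F κ i x :=
    (polyBits_commit hC hpk (hb.comap fun κ (i : Fin (W.n (ℓ κ)) × _) => i.1)
      (r := fun κ i a => r κ (i.1, a)) (hr.comap fun κ (i : (Fin (W.n (ℓ κ)) × Fin (C.clen κ)) × _) => (i.1.1, i.2)) _).beq hF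
  classical
  have h2 : PolyBits (I := fun κ => Fin (W.n (ℓ κ))) fun κ i x =>
      decide (C.commit κ (fun a => pk κ a x) (b κ i x) (fun a => r κ (i, a) x) =
        fun j => F κ (i, j) x) :=
    PolyBits.all (by simpa using hC.clen_poly) (f := fun κ i j x =>
      C.commit κ (fun a => pk κ a x) (b κ i x) (fun a => r κ (i, a) x) j == F κ (i, j) x) h1
      (fun κ i x => by simp [funext_iff])
  have h3 : PolyBits (I := fun _ => Unit) fun κ _ x => decide (∀ i ∈ W.S (ℓ κ) (fun a => s κ a x),
      C.commit κ (fun a => pk κ a x) (b κ i x) (fun a => r κ (i, a) x) = fun j => F κ (i, j) x) :=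
    PolyBits.all (J := fun κ => Fin (W.n (ℓ κ))) (by simpa using hn)
      (f := fun κ _ i x => !decide (i ∈ W.S (ℓ κ) (fun a => s κ a x)) ||
        decide (C.commit κ (fun a => pk κ a x) (b κ i x) (fun a => r κ (i, a) x) =
          fun j => F κ (i, j) x))
      (((polyBits_mem_S hW hℓ hs (fun κ i => i)).not.or h2).comap
        fun κ (i : Unit × Fin (W.n (ℓ κ))) => i.2)
      (fun κ i x => by simp [imp_iff_not_or])
  obtain ⟨f, hf, hJ⟩ := hW.J_poly
  have h4 : PolyBits (I := fun _ => Unit) fun κ _ x => f (ℓ κ) (fun a => (fun κ (_ : Unit)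
      (a : Fin (ℓ κ) ⊕ (Fin (W.sig (ℓ κ)) ⊕ Fin (W.n (ℓ κ)))) (x : ω κ → Bool) =>
      Sum.elim (fun a => y κ a x) (Sum.elim (fun a => s κ a x) (fun i =>
        decide (i ∈ W.S (ℓ κ) (fun a => s κ a x)) && b κ i x)) a) κ () a x) () := by
    refine PolyBits.subst (hf.reindex hℓ) ?_ ?_ ?_ (fun _ _ => ())
    · simpa using hℓ.add ((hW.sig_poly.comp hℓ).add hn)
    · simpa using polyBounded_const 1
    · refine PolyBits.sum (F := fun κ (_ : Unit) a x => Sum.elim (fun a => y κ a x)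
        (Sum.elim (fun a => s κ a x) (fun i =>
          decide (i ∈ W.S (ℓ κ) (fun a => s κ a x)) && b κ i x)) a) (hy.comap fun κ (i : Unit × _) => i.2) ?_
      exact PolyBits.sum (F := fun κ _ a x => Sum.elim (fun a => s κ a x) (fun i =>
        decide (i ∈ W.S (ℓ κ) (fun a => s κ a x)) && b κ i x) a) (hs.comap fun κ (i : Unit × _) => i.2)
        (((polyBits_mem_S hW hℓ hs (fun κ i => i)).and hb).comap fun κ (i : Unit × _) => i.2)
  refine (h3.and h4).congr fun κ i x => ?_
  rw [acceptBit, ← hJ, fill_restrict]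

theorem polyBits_proverAccept (hW : W.IsPoly R q) (hℓ : PolyBounded ℓ) (hC : C.IsMixed)
    {pk : ∀ κ, Fin κ → (ω κ → Bool) → Bool} (hpk : PolyBits pk)
    {s : ∀ κ, Fin (W.sig (ℓ κ)) → (ω κ → Bool) → Bool} (hs : PolyBits s)
    {r₀ r₁ r₂ r₃ : ∀ κ, FromProverW W C κ (ℓ κ) → (ω κ → Bool) → Bool} (h₀ : PolyBits r₀)
    (h₁ : PolyBits r₁) (h₂ : PolyBits r₂) (h₃ : PolyBits r₃) :
    PolyBits (I := fun _ => Unit) fun κ _ x => proverAccept W C κ (ℓ κ) (fun a => pk κ a x)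
      (fun a => s κ a x) (fun a => r₀ κ a x) (fun a => r₁ κ a x) (fun a => r₂ κ a x)
      (fun a => r₃ κ a x) :=
  ((((h₀.comap fun _ _ => .inl ()).and (h₁.comap fun _ _ => .inr (.inl (.inl ())))).and
    (h₂.comap fun _ _ => .inl ())).and (h₃.comap fun _ _ => .inr (.inr (.inl ())))).and
    (polyBits_accept hW hℓ hC hpk hs (h₁.comap fun _ i => .inr (.inl (.inr (.inl i))))
      (h₁.comap fun _ i => .inr (.inl (.inr (.inr i))))
      (h₃.comap fun _ i => .inr (.inr (.inr (.inl i))))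
      (h₃.comap fun _ i => .inr (.inr (.inr (.inr i)))))

theorem polyBits_send_two {s : ∀ κ, Fin (W.sig (ℓ κ)) → (ω κ → Bool) → Bool} (hs : PolyBits s)
    {r₀ r₁ : ∀ κ, FromProverW W C κ (ℓ κ) → (ω κ → Bool) → Bool} (h₀ : PolyBits r₀)
    (h₁ : PolyBits r₁) {pk : ∀ κ, (ω κ → Bool) → Bits κ} :
    PolyBits fun κ i x => (realProver W C κ (ℓ κ)).send Empty.elim (pk κ x, fun a => s κ a x)
      [fun a => r₀ κ a x, fun a => r₁ κ a x] i := by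
  have h := PolyBits.elim (A := fun κ => Fin κ) (polyBits_const false)
    (((h₀.comap fun κ (_ : Fin (W.sig (ℓ κ))) => .inl ()).and
      (h₁.comap fun κ _ => .inr (.inl (.inl ())))).and hs)
  exact h.congr fun κ i x => congrFun (realProver_send_two W C κ (ℓ κ) Empty.elim _ _ _) i

theorem polyBits_result (hW : W.IsPoly R q) (hℓ : PolyBounded ℓ) (hC : C.IsMixed)
    {pk : ∀ κ, Fin κ → (ω κ → Bool) → Bool} (hpk : PolyBits pk)
    {s : ∀ κ, Fin (W.sig (ℓ κ)) → (ω κ → Bool) → Bool} (hs : PolyBits s)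
    {r₀ r₁ r₂ r₃ : ∀ κ, FromProverW W C κ (ℓ κ) → (ω κ → Bool) → Bool} (h₀ : PolyBits r₀)
    (h₁ : PolyBits r₁) (h₂ : PolyBits r₂) (h₃ : PolyBits r₃) :
    PolyBits fun κ i x => (realProver W C κ (ℓ κ)).result Empty.elim
      (fun a => pk κ a x, fun a => s κ a x) [fun a => r₀ κ a x, fun a => r₁ κ a x,
        fun a => r₂ κ a x, fun a => r₃ κ a x] i := by
  have h := PolyBits.elim ((h₀.comap fun κ (_ : Fin (ℓ κ)) => .inl ()).and
    (h₁.comap fun κ i => .inr (.inl (.inr (.inl i)))))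
    (polyBits_proverAccept hW hℓ hC hpk hs h₀ h₁ h₂ h₃)
  exact h.congr fun κ i x => congrFun (realProver_result W C κ (ℓ κ) Empty.elim _ _ _ _ _) i

theorem card_FromProverW (hW : W.IsPoly R q) (hℓ : PolyBounded ℓ) (hC : C.IsMixed) :
    PolyBounded fun κ => Fintype.card (FromProverW W C κ (ℓ κ)) := by
  have hn := hW.n_poly.comp hℓ
  simpa using (polyBounded_const 1).add (((polyBounded_const 1).add
    (hℓ.add (hn.mul hC.clen_poly))).add ((polyBounded_const 1).add (hn.add (hn.mul hC.rlen_poly))))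

theorem card_ToProverW (hW : W.IsPoly R q) (hℓ : PolyBounded ℓ) :
    PolyBounded fun κ => Fintype.card (ToProverW W κ (ℓ κ)) := by
  simpa using polyBounded_id.add (hW.sig_poly.comp hℓ)

variable {nz nq no : ℕ → ℕ}

set_option synthInstance.maxSize 1000 in
theorem poly_implements_keyProver (hW : W.IsPoly R q) (hℓ : PolyBounded ℓ) (hC : C.IsMixed)
    (A : ∀ κ, Adversary (ToProverW W κ (ℓ κ)) (FromProverW W C κ (ℓ κ)) (nz κ) (nq κ) (no κ))
    (hA : AdvPoly A) :
    ∃ s, PolyBounded s ∧ ∀ κ, Implements (s κ)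
      (fun p : Bits κ × Bits (nz κ) × Op (Fin (nq κ)) =>
        tens (ketBra p.1) (tens (ketBra p.2.1) p.2.2))
      (fun p => (keyProver W C κ (ℓ κ)).exec4 (A κ) p.1 ((A κ).start p.2.1 p.2.2)) := by
  refine poly_implements_exec4 A hA (fun κ => keyProver W C κ (ℓ κ)) (card_ToProverW hW hℓ)
    (card_FromProverW hW hℓ hC) (by simpa using hℓ.add (polyBounded_const 1))
    (by simpa using hW.sig_poly.comp hℓ) ?_ (polyBits_const false) ?_ (polyBits_const false) ?_
  · have h := (polyBits_var (α := fun κ => Fin κ ⊕ Fin (W.sig (ℓ κ))) (I := fun κ => Fin κ)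
      fun κ i => .inl i).elim (B := fun κ => Fin (W.sig (ℓ κ))) (polyBits_const false)
    exact h
  · have h := polyBits_send_two (W := W) (C := C) (ω := fun κ => ((Fin κ ⊕ Fin (W.sig (ℓ κ))) ⊕
      FromProverW W C κ (ℓ κ)) ⊕ FromProverW W C κ (ℓ κ))
      (polyBits_var fun κ i => .inl (.inl (.inr i))) (polyBits_var fun κ i => .inl (.inr i))
      (polyBits_var fun κ i => .inr i) (pk := fun κ x i => x (.inl (.inl (.inl i))))
    exact h
  · have h := polyBits_result (ω := fun κ => ((((Fin κ ⊕ Fin (W.sig (ℓ κ))) ⊕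
      FromProverW W C κ (ℓ κ)) ⊕ FromProverW W C κ (ℓ κ)) ⊕ FromProverW W C κ (ℓ κ)) ⊕
      FromProverW W C κ (ℓ κ)) hW hℓ hC
      (polyBits_var fun κ i => .inl (.inl (.inl (.inl (.inl i)))))
      (polyBits_var fun κ i => .inl (.inl (.inl (.inl (.inr i)))))
      (polyBits_var fun κ i => .inl (.inl (.inl (.inr i))))
      (polyBits_var fun κ i => .inl (.inl (.inr i)))
      (polyBits_var fun κ i => .inl (.inr i))
      (polyBits_var fun κ i => .inr i)
    exact h

theorem polyBits_genB (hC : C.IsMixed) {t : ∀ κ, Fin (C.bcoins κ) → (ω κ → Bool) → Bool}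
    (ht : PolyBits t) :
    PolyBits (I := fun κ => Fin κ) (fun κ i x => (C.genB κ (fun a => t κ a x)).1 i) ∧
      PolyBits (I := fun κ => Fin (C.sklen κ)) fun κ i x =>
        (C.genB κ (fun a => t κ a x)).2 i := by
  have h1 : PolyBounded fun κ => Fintype.card (Fin (C.bcoins κ)) := by
    simpa using hC.bcoins_poly
  have h2 : PolyBounded fun κ => Fintype.card (Fin κ ⊕ Fin (C.sklen κ)) := by
    simpa using polyBounded_id.add hC.sklen_poly
  constructor
  · exact PolyBits.subst hC.genB_poly h1 h2 (I := fun κ => Fin κ) (f := fun κ _ a x => t κ a x)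
      (ht.comap fun κ (i : _ × _) => i.2) (fun κ i => .inl i)
  · exact PolyBits.subst hC.genB_poly h1 h2 (I := fun κ => Fin (C.sklen κ))
      (f := fun κ _ a x => t κ a x) (ht.comap fun κ (i : _ × _) => i.2) (fun κ i => .inr i)

theorem polyBits_extractedBits (hC : C.IsMixed)
    {t : ∀ κ, Fin (C.bcoins κ) → (ω κ → Bool) → Bool} (ht : PolyBits t)
    {r₁ : ∀ κ, FromProverW W C κ (ℓ κ) → (ω κ → Bool) → Bool} (h₁ : PolyBits r₁) :
    PolyBits (I := fun κ => Fin (W.n (ℓ κ))) fun κ i x =>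
      extractedBits W C κ (ℓ κ) (fun a => t κ a x) (fun a => r₁ κ a x) i := by
  refine PolyBits.subst hC.xtr_poly (by simpa using hC.sklen_poly.add hC.clen_poly)
    (by simpa using polyBounded_const 1) (I := fun κ => Fin (W.n (ℓ κ)))
    (f := fun κ i a x => Sum.elim (fun i => (C.genB κ (fun a => t κ a x)).2 i)
      (fun j => r₁ κ (.inr (.inl (.inr (.inr (i, j))))) x) a) ?_ (fun _ _ => ())
  refine PolyBits.sum (F := fun κ i a x => Sum.elim (fun i => (C.genB κ (fun a => t κ a x)).2 i)
      (fun j => r₁ κ (.inr (.inl (.inr (.inr (i, j))))) x) a)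
    ((polyBits_genB hC ht).2.comap fun κ (i : Fin (W.n (ℓ κ)) × Fin (C.sklen κ)) => i.2) ?_
  exact h₁.comap fun κ (i : Fin (W.n (ℓ κ)) × Fin (C.clen κ)) => .inr (.inl (.inr (.inr i)))

theorem polyBits_simInput (hq : PolyBounded q) (hW : W.IsPoly R q) (hℓ : PolyBounded ℓ)
    (hC : C.IsMixed) {t : ∀ κ, Fin (C.bcoins κ) → (ω κ → Bool) → Bool} (ht : PolyBits t)
    {s : ∀ κ, Fin (W.sig (ℓ κ)) → (ω κ → Bool) → Bool} (hs : PolyBits s)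
    {r₀ r₁ r₂ r₃ : ∀ κ, FromProverW W C κ (ℓ κ) → (ω κ → Bool) → Bool} (h₀ : PolyBits r₀)
    (h₁ : PolyBits r₁) (h₂ : PolyBits r₂) (h₃ : PolyBits r₃) :
    PolyBits (I := fun κ => InW (ℓ κ) (q (ℓ κ))) fun κ i x =>
      simInput W C κ (ℓ κ) (q (ℓ κ)) (fun a => t κ a x) (fun a => s κ a x) (fun a => r₀ κ a x)
        (fun a => r₁ κ a x) (fun a => r₂ κ a x) (fun a => r₃ κ a x) i := by
  have hacc := polyBits_proverAccept hW hℓ hC (polyBits_genB hC ht).1 hs h₀ h₁ h₂ h₃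
  have hd : PolyBits (I := fun κ => Fin (q (ℓ κ) + 1)) fun κ i x => encodeWit (q (ℓ κ))
      (W.D (ℓ κ) (fun i => r₁ κ (.inr (.inl (.inr (.inl i)))) x)
        (extractedBits W C κ (ℓ κ) (fun a => t κ a x) (fun a => r₁ κ a x))) i := by
    refine PolyBits.subst (hW.D_poly.reindex hℓ) (by simpa using hℓ.add (hW.n_poly.comp hℓ))
      (by simpa using (hq.comp hℓ).add (polyBounded_const 1)) (I := fun κ => Fin (q (ℓ κ) + 1))
      (f := fun κ _ a x => Sum.elim (fun i => r₁ κ (.inr (.inl (.inr (.inl i)))) x)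
        (extractedBits W C κ (ℓ κ) (fun a => t κ a x) (fun a => r₁ κ a x)) a) ?_ (fun κ i => i)
    refine PolyBits.comap (f := fun κ a x => Sum.elim
      (fun i => r₁ κ (.inr (.inl (.inr (.inl i)))) x)
      (fun i => extractedBits W C κ (ℓ κ) (fun a => t κ a x) (fun a => r₁ κ a x) i) a) ?_
      fun κ (i : Fin (q (ℓ κ) + 1) × _) => i.2
    exact PolyBits.elim (h₁.comap fun κ (i : Fin (ℓ κ)) => .inr (.inl (.inr (.inl i))))
      (polyBits_extractedBits hC ht h₁)
  exact PolyBits.elim ((h₀.comap fun κ (_ : Fin (ℓ κ)) => .inl ()).and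
    (h₁.comap fun κ i => .inr (.inl (.inr (.inl i))))) ((hacc.comap fun _ _ => ()).and hd)

set_option synthInstance.maxSize 1000 in
theorem poly_implements_simProver (hq : PolyBounded q) (hW : W.IsPoly R q) (hℓ : PolyBounded ℓ)
    (hC : C.IsMixed)
    (A : ∀ κ, Adversary (ToProverW W κ (ℓ κ)) (FromProverW W C κ (ℓ κ)) (nz κ) (nq κ) (no κ))
    (hA : AdvPoly A) :
    ∃ s, PolyBounded s ∧ ∀ κ, Implements (s κ)
      (fun p : (Empty → Bool) × Bits (nz κ) × Op (Fin (nq κ)) =>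
        tens (ketBra p.1) (tens (ketBra p.2.1) p.2.2))
      (fun p => (simProver W C κ (ℓ κ) (q (ℓ κ))).exec4 (A κ) p.1 ((A κ).start p.2.1 p.2.2)) := by
  refine poly_implements_exec4 A hA (fun κ => simProver W C κ (ℓ κ) (q (ℓ κ)))
    (card_ToProverW hW hℓ) (card_FromProverW hW hℓ hC)
    (by simpa using hℓ.add ((hq.comp hℓ).add (polyBounded_const 1)))
    (by simpa using hC.bcoins_poly.add (hW.sig_poly.comp hℓ)) ?_ (polyBits_const false) ?_
    (polyBits_const false) ?_
  · have h := (polyBits_genB (ω := fun κ => Empty ⊕ (Fin (C.bcoins κ) ⊕ Fin (W.sig (ℓ κ)))) hC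
      (polyBits_var fun κ i => .inr (.inl i))).1.elim
      (B := fun κ => Fin (W.sig (ℓ κ))) (polyBits_const false)
    exact h
  · have h := polyBits_send_two (W := W) (C := C) (ω := fun κ => ((Empty ⊕ (Fin (C.bcoins κ) ⊕
      Fin (W.sig (ℓ κ)))) ⊕ FromProverW W C κ (ℓ κ)) ⊕ FromProverW W C κ (ℓ κ))
      (polyBits_var fun κ i => .inl (.inl (.inr (.inr i)))) (polyBits_var fun κ i => .inl (.inr i))
      (polyBits_var fun κ i => .inr i)
      (pk := fun κ x => (C.genB κ fun i => x (.inl (.inl (.inr (.inl i))))).1)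
    exact h
  · have h := polyBits_simInput (ω := fun κ => ((((Empty ⊕ (Fin (C.bcoins κ) ⊕
      Fin (W.sig (ℓ κ)))) ⊕ FromProverW W C κ (ℓ κ)) ⊕ FromProverW W C κ (ℓ κ)) ⊕
      FromProverW W C κ (ℓ κ)) ⊕ FromProverW W C κ (ℓ κ)) hq hW hℓ hC
      (polyBits_var fun κ i => .inl (.inl (.inl (.inl (.inr (.inl i))))))
      (polyBits_var fun κ i => .inl (.inl (.inl (.inl (.inr (.inr i))))))
      (polyBits_var fun κ i => .inl (.inl (.inl (.inr i))))
      (polyBits_var fun κ i => .inl (.inl (.inr i)))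
      (polyBits_var fun κ i => .inl (.inr i))
      (polyBits_var fun κ i => .inr i)
    exact h

end ProverPoly

/-! ### The dishonest verifier: simulated view -/

section VerifierSystems

variable (R : Set (List Bool × List Bool)) (W : WitnessEncoding) (C : CommitScheme) (κ k q : ℕ)

/-- The messages to a dishonest verifier as a function of his earlier replies: `x` is the instance,
`j` says whether the prover continues after sending it, `F` are the commitments and `(e, r)` their
openings, of which only the positions selected by the challenge `s` are used. -/
def verifierView (j : Bool) (x : Bits k) (pk : Bits κ) (s : Bits (W.sig k)) (e : Bits (W.n k))
    (F : Fin (W.n k) → Bits (C.clen κ)) (r : Fin (W.n k) → Bits (C.rlen κ)) :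
    List (Unit → Bool) → (ToVerifierW W C κ k → Bool)
  | [] => Sum.elim pk (fun _ => false)
  | [r₀] => Sum.elim (fun _ => false) (Sum.elim (fun _ => false) (Sum.elim
      (Sum.elim (fun _ => r₀ () && j) (Sum.elim (fun i => r₀ () && x i)
        (fun i => (r₀ () && j) && F i.1 i.2))) (fun _ => false)))
  | [r₀, _] => Sum.elim (fun _ => false) (Sum.elim (fun i => (r₀ () && j) && s i) (fun _ => false))
  | [r₀, _, r₂] => Sum.elim (fun _ => false) (Sum.elim (fun _ => false) (Sum.elim (fun _ => false)
      (Sum.elim (fun _ => (r₀ () && j) && r₂ ())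
        (Sum.elim (fun i => ((r₀ () && j) && r₂ ()) && (decide (i ∈ W.S k s) && e i))
          (fun i => ((r₀ () && j) && r₂ ()) && (decide (i.1 ∈ W.S k s) && r i.1 i.2))))))
  | _ => fun _ => false

/-- The view of a dishonest verifier in which the committed bits are `e`. -/
def committedView (j : Bool) (x : Bits k) (pk : Bits κ) (s : Bits (W.sig k)) (e : Bits (W.n k))
    (r : Fin (W.n k) → Bits (C.rlen κ)) : List (Unit → Bool) → (ToVerifierW W C κ k → Bool) :=
  verifierView W C κ k j x pk s e (fun i => C.commit κ pk (e i) (r i)) r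

theorem realVerifier_send_of_none {u : InW k q → Bool} (hu : validWit R u = none)
    (c : Bits κ × Bits (W.sig k) × ProverCoins W C κ k) (e : Bits (W.n k)) :
    (realVerifier R W C κ k q).send u c =
      committedView W C κ k false (fun i => u (.inl i)) c.1 c.2.1 e c.2.2.2 := by
  funext hist
  rcases hist with _ | ⟨r₀, _ | ⟨r₁, _ | ⟨r₂, _ | ⟨r₃, hist⟩⟩⟩⟩
  · rfl
  · cases h : r₀ () <;>
      simp [realVerifier, committedView, verifierView, proverMsg, hu, coin, ProverMsg.write, h]
  · cases h : r₀ () <;>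
      simp [realVerifier, committedView, verifierView, proverMsg, hu, coin, h]
  · cases h : r₀ () <;>
      simp [realVerifier, committedView, verifierView, proverOpen, hu, coin, writeOpening, h]
  · rfl

theorem realVerifier_send_of_some {u : InW k q → Bool} {w : List Bool}
    (hu : validWit R u = some w) (c : Bits κ × Bits (W.sig k) × ProverCoins W C κ k) :
    (realVerifier R W C κ k q).send u c =
      committedView W C κ k true (fun i => u (.inl i)) c.1 c.2.1
        (W.E k (fun i => u (.inl i)) w c.2.2.1) c.2.2.2 := by
  funext hist
  rcases hist with _ | ⟨r₀, _ | ⟨r₁, _ | ⟨r₂, _ | ⟨r₃, hist⟩⟩⟩⟩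
  · rfl
  · cases h : r₀ () <;>
      simp [realVerifier, committedView, verifierView, proverMsg, hu, coin, ProverMsg.write, h]
  · cases h : r₀ () <;>
      simp [realVerifier, committedView, verifierView, proverMsg, hu, coin, h]
  · cases h : r₀ () <;> cases h2 : r₂ () <;>
      simp [realVerifier, committedView, verifierView, proverOpen, hu, coin, writeOpening, h, h2]
    funext i
    rcases i with i | i | i | i | i | i <;> simp <;> split_ifs with hi <;> simp [hi]
  · rfl

/-- The coins of the simulator of a dishonest verifier: a key, a challenge, random bits for `Ê` and
for the commitments. -/
abbrev SimCoins : Type :=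
  Fin κ ⊕ (Fin (W.sig k) ⊕ (Fin (W.mhat k) ⊕ (Fin (W.n k) × Fin (C.rlen κ))))

/-- The bits that the simulator commits to: simulated bits of an encoding in the positions selected
by the challenge, and zeros elsewhere. -/
def simBits (x : Bits k) (s : Bits (W.sig k)) (t : Bits (W.mhat k)) : Bits (W.n k) :=
  fill _ (W.Ehat k x s t)

/-- The simulated protocol with dishonest verifier: it knows the challenge in advance, and its input
is the output `(x, j)` of the functionality. -/
def simVerifier : System (SimCoins W C κ k → Bool) (OutW k) Empty (ToVerifierW W C κ k) Unit where
  rounds := 4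
  send v c := committedView W C κ k (v (.inr ())) (fun i => v (.inl i)) (fun i => c (.inl i))
    (fun i => c (.inr (.inl i)))
    (simBits W k (fun i => v (.inl i)) (fun i => c (.inr (.inl i)))
      (fun i => c (.inr (.inr (.inl i)))))
    (fun i a => c (.inr (.inr (.inr (i, a)))))
  result _ _ _ := Empty.elim

end VerifierSystems

section Hybrid

variable {R : Set (List Bool × List Bool)} {W : WitnessEncoding} {C : CommitScheme} {κ k q : ℕ}

/-- The joint distribution of a hiding key and a commitment to `m`. -/
noncomputable def commitDist (C : CommitScheme) (κ : ℕ) (m : Bool) :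
    PMF (Bits κ × Bits (C.clen κ)) :=
  (PMF.uniformOfFintype (Bits (C.hcoins κ) × Bits (C.rlen κ))).map
    fun t => (C.genH κ t.1, C.commit κ (C.genH κ t.1) m t.2)

/-- The statistical distance between commitments to different bits, summed over all pairs
of bits. -/
noncomputable def hidingError (C : CommitScheme) (κ : ℕ) : ℝ :=
  ∑ m : Bool × Bool, statDist (commitDist C κ m.1) (commitDist C κ m.2)

/-- The statistical distance of hiding keys from uniform. -/
noncomputable def keyError (C : CommitScheme) (κ : ℕ) : ℝ :=
  statDist (PMF.uniformOfFintype (Bits κ)) ((PMF.uniformOfFintype (Bits (C.hcoins κ))).map (C.genH κ))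

theorem statDist_comm {A : Type} [Fintype A] (P Q : PMF A) : statDist P Q = statDist Q P := by
  simp only [statDist, abs_sub_comm]

theorem negl_keyError (hC : C.IsMixed) : Negl (keyError C) := by
  have h : keyError C = fun κ => statDist
      ((PMF.uniformOfFintype (Bits (C.hcoins κ))).map (C.genH κ)) (PMF.uniformOfFintype (Bits κ)) :=
    funext fun κ => statDist_comm _ _
  rw [h]
  exact hC.key_uniform

theorem hidingError_nonneg : 0 ≤ hidingError C κ :=
  Finset.sum_nonneg fun _ _ => statDist_nonneg _ _

theorem negl_hidingError (hC : C.IsMixed) : Negl (hidingError C) := by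
  have h : ∀ m m', Negl fun κ => statDist (commitDist C κ m) (commitDist C κ m') := hC.hides
  have h2 := ((h true true).add (h true false)).add ((h false true).add (h false false))
  refine h2.of_abs_le fun κ => ?_
  rw [abs_of_nonneg hidingError_nonneg, hidingError, Fintype.sum_prod_type, Fintype.sum_bool,
    Fintype.sum_bool, Fintype.sum_bool]

theorem statDist_le_hidingError (m m' : Bool) :
    statDist (commitDist C κ m) (commitDist C κ m') ≤ hidingError C κ := by
  have h := fun m m' => statDist_nonneg (commitDist C κ m) (commitDist C κ m')
  have h1 := h true true
  have h2 := h true false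
  have h3 := h false true
  have h4 := h false false
  rw [hidingError, Fintype.sum_prod_type, Fintype.sum_bool, Fintype.sum_bool, Fintype.sum_bool]
  cases m <;> cases m' <;> linarith

/-- Replacing uniform keys by hiding keys. -/
theorem abs_expect_key_sub_le {p : ℝ} (f : Bits κ → ℝ) (h0 : ∀ v, 0 ≤ f v) (h1 : ∀ v, f v ≤ p) :
    |𝔼 pk, f pk - 𝔼 t, f (C.genH κ t)| ≤ 2 * p * keyError C κ := by
  rw [← sum_uniform, ← sum_uniform_map]
  exact abs_sum_sub_le_statDist _ _ _ h0 h1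

theorem verifierView_congr {j : Bool} {x : Bits k} {pk : Bits κ} {s : Bits (W.sig k)}
    {e e' : Bits (W.n k)} {F : Fin (W.n k) → Bits (C.clen κ)}
    {r r' : Fin (W.n k) → Bits (C.rlen κ)} (he : ∀ i ∈ W.S k s, e i = e' i)
    (hr : ∀ i ∈ W.S k s, r i = r' i) :
    verifierView W C κ k j x pk s e F r = verifierView W C κ k j x pk s e' F r' := by
  have h1 : ∀ i, (decide (i ∈ W.S k s) && e i) = (decide (i ∈ W.S k s) && e' i) := by
    intro i
    by_cases h : i ∈ W.S k s <;> simp [h, he]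
  have h2 : ∀ i a, (decide (i ∈ W.S k s) && r i a) = (decide (i ∈ W.S k s) && r' i a) := by
    intro i a
    by_cases h : i ∈ W.S k s <;> simp [h, hr]
  funext hist
  rcases hist with _ | ⟨r₀, _ | ⟨r₁, _ | ⟨r₂, _ | ⟨r₃, hist⟩⟩⟩⟩ <;> try rfl
  simp only [verifierView, h1, h2]

/-- Changing a committed bit that is never opened is not noticed, under hiding keys: the randomness
of this commitment is independent of the rest of the view. -/
theorem abs_expect_update_sub_le {p : ℝ}
    (f : (List (Unit → Bool) → (ToVerifierW W C κ k → Bool)) → ℝ) (h0 : ∀ v, 0 ≤ f v)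
    (h1 : ∀ v, f v ≤ p) (j : Bool) (x : Bits k) (s : Bits (W.sig k)) (e : Bits (W.n k))
    {i : Fin (W.n k)} (hi : i ∉ W.S k s) (b : Bool) :
    |𝔼 t, 𝔼 r, f (committedView W C κ k j x (C.genH κ t) s e r) -
      𝔼 t, 𝔼 r, f (committedView W C κ k j x (C.genH κ t) s (Function.update e i b) r)| ≤
      2 * p * hidingError C κ := by
  have hp : 0 ≤ p := (h0 fun _ _ => false).trans (h1 _)
  -- the view as a function of the key and of the commitment in position `i`
  let G : (Fin (W.n k) → Bits (C.rlen κ)) → Bits κ × Bits (C.clen κ) → ℝ := fun r a =>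
    f (verifierView W C κ k j x a.1 s e
      (Function.update (fun i => C.commit κ a.1 (e i) (r i)) i a.2) r)
  have key : ∀ b' : Bool, 𝔼 t, 𝔼 r,
      f (committedView W C κ k j x (C.genH κ t) s (Function.update e i b') r) =
      𝔼 r, 𝔼 t : Bits (C.hcoins κ) × Bits (C.rlen κ),
        G r (C.genH κ t.1, C.commit κ (C.genH κ t.1) b' t.2) := by
    intro b'
    calc _ = 𝔼 t, 𝔼 r, 𝔼 ρ, f (committedView W C κ k j x (C.genH κ t) s (Function.update e i b')
          (Function.update r i ρ)) := Finset.expect_congr rfl fun t _ => expect_update i (fun r =>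
          f (committedView W C κ k j x (C.genH κ t) s (Function.update e i b') r))
      _ = 𝔼 t, 𝔼 r, 𝔼 ρ, G r (C.genH κ t, C.commit κ (C.genH κ t) b' ρ) := by
        refine Finset.expect_congr rfl fun t _ => Finset.expect_congr rfl fun r _ =>
          Finset.expect_congr rfl fun ρ _ => congrArg f ?_
        have hF : (fun i' => C.commit κ (C.genH κ t) (Function.update e i b' i')
            (Function.update r i ρ i')) =
            Function.update (fun i => C.commit κ (C.genH κ t) (e i) (r i)) i
              (C.commit κ (C.genH κ t) b' ρ) := by
          funext i'
          rcases eq_or_ne i' i with rfl | h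
          · simp
          · simp [h]
        rw [committedView, hF]
        refine verifierView_congr (fun i' h' => ?_) (fun i' h' => ?_) <;>
          · rw [Function.update_of_ne]
            rintro rfl
            exact hi h'
      _ = _ := by
        rw [expect_prod_comm]
        exact Finset.expect_congr rfl fun r _ => (expect_prod
          (fun t : Bits (C.hcoins κ) × Bits (C.rlen κ) =>
            G r (C.genH κ t.1, C.commit κ (C.genH κ t.1) b' t.2))).symm
  have he := key (e i)
  rw [Function.update_eq_self] at he
  rw [he, key b, ← Finset.expect_sub_distrib]
  refine (abs_expect_le _).trans (expect_le_of_le fun r => ?_)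
  refine (abs_expect_sub_le _ _ (G r) (fun a => h0 _) (fun a => h1 _)).trans ?_
  exact mul_le_mul_of_nonneg_left (statDist_le_hidingError _ _) (by positivity)

/-- Changing the committed bits that are never opened, one after the other. -/
theorem abs_expect_committed_sub_le {p : ℝ}
    (f : (List (Unit → Bool) → (ToVerifierW W C κ k → Bool)) → ℝ) (h0 : ∀ v, 0 ≤ f v)
    (h1 : ∀ v, f v ≤ p) (j : Bool) (x : Bits k) (s : Bits (W.sig k)) {e e' : Bits (W.n k)}
    (he : ∀ i ∈ W.S k s, e i = e' i) :
    |𝔼 t, 𝔼 r, f (committedView W C κ k j x (C.genH κ t) s e r) -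
      𝔼 t, 𝔼 r, f (committedView W C κ k j x (C.genH κ t) s e' r)| ≤
      W.n k * (2 * p * hidingError C κ) := by
  have key : ∀ T : Finset (Fin (W.n k)),
      |𝔼 t, 𝔼 r, f (committedView W C κ k j x (C.genH κ t) s e r) -
        𝔼 t, 𝔼 r, f (committedView W C κ k j x (C.genH κ t) s (T.piecewise e' e) r)| ≤
        T.card * (2 * p * hidingError C κ) := by
    intro T
    induction T using Finset.induction_on with
    | empty => simp
    | insert i T hi ih =>
      rw [Finset.piecewise_insert, Finset.card_insert_of_notMem hi, Nat.cast_succ, add_one_mul]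
      refine (abs_sub_le _ (𝔼 t, 𝔼 r, f (committedView W C κ k j x (C.genH κ t) s
        (T.piecewise e' e) r)) _).trans (add_le_add ih ?_)
      by_cases hS : i ∈ W.S k s
      · rw [← he i hS, Function.update_eq_self_iff.mpr, sub_self, abs_zero]
        · have hp : 0 ≤ p := (h0 fun _ _ => false).trans (h1 _)
          have := hidingError_nonneg (C := C) (κ := κ)
          positivity
        · simp [hi]
      · exact abs_expect_update_sub_le f h0 h1 j x s _ hS _
  simpa using key Finset.univ

/-- For a valid instance, the real view of a dishonest verifier is statistically close to the
simulated one. -/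
theorem abs_expect_real_sub_sim_le (hsim : W.Simulatable R) {p : ℝ}
    (f : (List (Unit → Bool) → (ToVerifierW W C κ k → Bool)) → ℝ) (h0 : ∀ v, 0 ≤ f v)
    (h1 : ∀ v, f v ≤ p) {x : Bits k} {w : List Bool} (hw : (List.ofFn x, w) ∈ R) :
    |𝔼 pk, 𝔼 s, 𝔼 t, 𝔼 r, f (committedView W C κ k true x pk s (W.E k x w t) r) -
      𝔼 pk, 𝔼 s, 𝔼 t, 𝔼 r, f (committedView W C κ k true x pk s (simBits W k x s t) r)| ≤
      p * (4 * keyError C κ + 2 * (W.n k * hidingError C κ)) := by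
  have hE : ∀ {T : Type} [Fintype T] [Nonempty T] (g : T → ℝ), (∀ t, 0 ≤ g t) → 0 ≤ 𝔼 t, g t :=
    fun g h => Finset.expect_nonneg fun t _ => h t
  have k1 := abs_expect_key_sub_le (C := C) (p := p)
    (fun pk => 𝔼 s, 𝔼 t, 𝔼 r, f (committedView W C κ k true x pk s (W.E k x w t) r))
    (fun pk => hE _ fun s => hE _ fun t => hE _ fun r => h0 _)
    (fun pk => expect_le_of_le fun s => expect_le_of_le fun t => expect_le_of_le fun r => h1 _)
  have k2 := abs_expect_key_sub_le (C := C) (p := p)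
    (fun pk => 𝔼 s, 𝔼 t, 𝔼 r, f (committedView W C κ k true x pk s (simBits W k x s t) r))
    (fun pk => hE _ fun s => hE _ fun t => hE _ fun r => h0 _)
    (fun pk => expect_le_of_le fun s => expect_le_of_le fun t => expect_le_of_le fun r => h1 _)
  have k3 : |𝔼 y, 𝔼 s, 𝔼 t, 𝔼 r,
        f (committedView W C κ k true x (C.genH κ y) s (W.E k x w t) r) -
      𝔼 y, 𝔼 s, 𝔼 t, 𝔼 r,
        f (committedView W C κ k true x (C.genH κ y) s (simBits W k x s t) r)| ≤
      W.n k * (2 * p * hidingError C κ) := by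
    rw [expect_prod_comm (fun y s => 𝔼 t, 𝔼 r,
        f (committedView W C κ k true x (C.genH κ y) s (W.E k x w t) r)),
      expect_prod_comm (fun y s => 𝔼 t, 𝔼 r,
        f (committedView W C κ k true x (C.genH κ y) s (simBits W k x s t) r)),
      ← Finset.expect_sub_distrib]
    refine (abs_expect_le _).trans (expect_le_of_le fun s => ?_)
    rw [expect_prod_comm (fun y t => 𝔼 r,
        f (committedView W C κ k true x (C.genH κ y) s (W.E k x w t) r)),
      expect_prod_comm (fun y t => 𝔼 r,
        f (committedView W C κ k true x (C.genH κ y) s (simBits W k x s t) r))]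
    -- the simulated bits are distributed as the opened bits of an encoding
    have h2 := expect_eq_of_map_eq (hsim k x w s hw) (fun a => 𝔼 y, 𝔼 r,
      f (committedView W C κ k true x (C.genH κ y) s (fill _ a) r))
    simp only [simBits]
    rw [← h2, ← Finset.expect_sub_distrib]
    refine (abs_expect_le _).trans (expect_le_of_le fun t => ?_)
    refine abs_expect_committed_sub_le f h0 h1 true x s fun i hi => ?_
    simp [fill, restrict, hi]
  rw [abs_le] at *
  constructor <;> linarith [k1.1, k1.2, k2.1, k2.2, k3.1, k3.2]

end Hybrid

/-! ### Circuits for the simulated view -/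

section VerifierPoly

variable {R : Set (List Bool × List Bool)} {W : WitnessEncoding} {C : CommitScheme} {q ℓ : ℕ → ℕ}
  {ω : ℕ → Type} [∀ κ, Fintype (ω κ)] [∀ κ, DecidableEq (ω κ)] {I : ℕ → Type}

theorem polyBits_simBits (hW : W.IsPoly R q) (hℓ : PolyBounded ℓ)
    {s : ∀ κ, Fin (W.sig (ℓ κ)) → (ω κ → Bool) → Bool} (hs : PolyBits s)
    {y : ∀ κ, Fin (ℓ κ) → (ω κ → Bool) → Bool} (hy : PolyBits y)
    {t : ∀ κ, Fin (W.mhat (ℓ κ)) → (ω κ → Bool) → Bool} (ht : PolyBits t) :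
    PolyBits (I := fun κ => Fin (W.n (ℓ κ))) fun κ i x =>
      simBits W (ℓ κ) (fun a => y κ a x) (fun a => s κ a x) (fun a => t κ a x) i := by
  refine PolyBits.subst (hW.Ehat_poly.reindex hℓ)
    (by simpa using hℓ.add ((hW.sig_poly.comp hℓ).add (hW.mhat_poly.comp hℓ)))
    (by simpa using hW.n_poly.comp hℓ) (I := fun κ => Fin (W.n (ℓ κ)))
    (f := fun κ _ a x => Sum.elim (fun a => y κ a x) (fun b => Sum.elim (fun a => s κ a x)
      (fun a => t κ a x) b) a) ?_ (fun κ i => i)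
  exact (hy.elim (hs.elim ht)).comap fun κ (i : Fin (W.n (ℓ κ)) × _) => i.2

/-- The replies of the dishonest verifier in the first three rounds are the wires `v₀`, `v₁`
and `v₂`. -/
theorem polyBits_committedView (hW : W.IsPoly R q) (hℓ : PolyBounded ℓ) (hC : C.IsMixed)
    {j : ∀ κ, (ω κ → Bool) → Bool} (hj : PolyBits (I := fun _ => Unit) fun κ _ => j κ)
    {y : ∀ κ, Fin (ℓ κ) → (ω κ → Bool) → Bool} (hy : PolyBits y)
    {pk : ∀ κ, Fin κ → (ω κ → Bool) → Bool} (hpk : PolyBits pk)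
    {s : ∀ κ, Fin (W.sig (ℓ κ)) → (ω κ → Bool) → Bool} (hs : PolyBits s)
    {e : ∀ κ, Fin (W.n (ℓ κ)) → (ω κ → Bool) → Bool} (he : PolyBits e)
    {r : ∀ κ, Fin (W.n (ℓ κ)) × Fin (C.rlen κ) → (ω κ → Bool) → Bool} (hr : PolyBits r)
    (v₀ v₁ v₂ : ∀ κ, ω κ) :
    let V := fun κ (x : ω κ → Bool) => committedView W C κ (ℓ κ) (j κ x) (fun a => y κ a x)
      (fun a => pk κ a x) (fun a => s κ a x) (fun a => e κ a x) (fun i a => r κ (i, a) x)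
    PolyBits (fun κ a x => V κ x [] a) ∧
      PolyBits (fun κ a x => V κ x [fun _ => x (v₀ κ)] a) ∧
      PolyBits (fun κ a x => V κ x [fun _ => x (v₀ κ), fun _ => x (v₁ κ)] a) ∧
      PolyBits (fun κ a x => V κ x [fun _ => x (v₀ κ), fun _ => x (v₁ κ), fun _ => x (v₂ κ)] a) := by
  have h0 : PolyBits (I := fun _ => Unit) fun κ _ (x : ω κ → Bool) => x (v₀ κ) :=
    polyBits_var fun κ _ => v₀ κ
  have h2 : PolyBits (I := fun _ => Unit) fun κ _ (x : ω κ → Bool) => x (v₂ κ) :=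
    polyBits_var fun κ _ => v₂ κ
  have h0j := h0.and hj
  have h02 := h0j.and h2
  have hF : PolyBits (I := fun κ => Fin (W.n (ℓ κ)) × Fin (C.clen κ)) fun κ i x =>
      C.commit κ (fun a => pk κ a x) (e κ i.1 x) (fun a => r κ (i.1, a) x) i.2 :=
    polyBits_commit hC hpk (he.comap fun κ (i : Fin (W.n (ℓ κ)) × Fin (C.clen κ)) => i.1)
      (r := fun κ i a => r κ (i.1, a))
      (hr.comap fun κ (i : (Fin (W.n (ℓ κ)) × Fin (C.clen κ)) × _) => (i.1.1, i.2)) _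
  have hS := polyBits_mem_S hW hℓ hs (I := fun κ => Fin (W.n (ℓ κ))) (fun κ i => i)
  have hf : ∀ {A : ℕ → Type}, PolyBits (I := A) fun κ _ (_ : ω κ → Bool) => false :=
    fun {A} => polyBits_const false
  refine ⟨?_, ?_, ?_, ?_⟩
  · have h := hpk.elim (B := fun κ => Fin (W.sig (ℓ κ)) ⊕ (MsgW (ℓ κ) (W.n (ℓ κ)) (C.clen κ) ⊕
      OpenW (W.n (ℓ κ)) (C.rlen κ))) hf
    exact h
  · have h := (hf (A := fun κ => Fin κ)).elim ((hf (A := fun κ => Fin (W.sig (ℓ κ)))).elim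
      ((h0j.elim (((h0.comap fun κ (_ : Fin (ℓ κ)) => ()).and hy).elim
        ((h0j.comap fun κ (_ : Fin (W.n (ℓ κ)) × Fin (C.clen κ)) => ()).and hF))).elim
        (hf (A := fun κ => OpenW (W.n (ℓ κ)) (C.rlen κ)))))
    exact h
  · have h := (hf (A := fun κ => Fin κ)).elim
      (((h0j.comap fun κ (_ : Fin (W.sig (ℓ κ))) => ()).and hs).elim
        (hf (A := fun κ => MsgW (ℓ κ) (W.n (ℓ κ)) (C.clen κ) ⊕ OpenW (W.n (ℓ κ)) (C.rlen κ))))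
    exact h
  · have h := (hf (A := fun κ => Fin κ)).elim ((hf (A := fun κ => Fin (W.sig (ℓ κ)))).elim
      ((hf (A := fun κ => MsgW (ℓ κ) (W.n (ℓ κ)) (C.clen κ))).elim (h02.elim
        (((h02.comap fun κ (_ : Fin (W.n (ℓ κ))) => ()).and (hS.and he)).elim
          ((h02.comap fun κ (_ : Fin (W.n (ℓ κ)) × Fin (C.rlen κ)) => ()).and
            ((hS.comap fun κ (i : Fin (W.n (ℓ κ)) × Fin (C.rlen κ)) => i.1).and hr))))))
    exact h

theorem card_ToVerifierW (hW : W.IsPoly R q) (hℓ : PolyBounded ℓ) (hC : C.IsMixed) :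
    PolyBounded fun κ => Fintype.card (ToVerifierW W C κ (ℓ κ)) := by
  have hn := hW.n_poly.comp hℓ
  simpa using polyBounded_id.add ((hW.sig_poly.comp hℓ).add (((polyBounded_const 1).add
    (hℓ.add (hn.mul hC.clen_poly))).add ((polyBounded_const 1).add (hn.add (hn.mul hC.rlen_poly)))))

variable {nz nq no : ℕ → ℕ}

set_option synthInstance.maxSize 1000 in
theorem poly_implements_simVerifier (hW : W.IsPoly R q) (hℓ : PolyBounded ℓ) (hC : C.IsMixed)
    (A : ∀ κ, Adversary (ToVerifierW W C κ (ℓ κ)) Unit (nz κ) (nq κ) (no κ)) (hA : AdvPoly A) :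
    ∃ s, PolyBounded s ∧ ∀ κ, Implements (s κ)
      (fun p : (OutW (ℓ κ) → Bool) × Bits (nz κ) × Op (Fin (nq κ)) =>
        tens (ketBra p.1) (tens (ketBra p.2.1) p.2.2))
      (fun p => (simVerifier W C κ (ℓ κ)).exec4 (A κ) p.1 ((A κ).start p.2.1 p.2.2)) := by
  have hn := hW.n_poly.comp hℓ
  have key : ∀ {ω : ℕ → Type} [∀ κ, Fintype (ω κ)] [∀ κ, DecidableEq (ω κ)]
      (a : ∀ κ, OutW (ℓ κ) ⊕ SimCoins W C κ (ℓ κ) → ω κ) (v₀ v₁ v₂ : ∀ κ, ω κ), _ :=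
    fun a v₀ v₁ v₂ => polyBits_committedView hW hℓ hC
      (j := fun κ x => x (a κ (.inl (.inr ())))) (polyBits_var fun κ _ => a κ (.inl (.inr ())))
      (polyBits_var fun κ i => a κ (.inl (.inl i)))
      (polyBits_var fun κ i => a κ (.inr (.inl i)))
      (polyBits_var fun κ i => a κ (.inr (.inr (.inl i))))
      (polyBits_simBits hW hℓ (polyBits_var fun κ i => a κ (.inr (.inr (.inl i))))
        (polyBits_var fun κ i => a κ (.inl (.inl i)))
        (polyBits_var fun κ i => a κ (.inr (.inr (.inr (.inl i))))))
      (polyBits_var fun κ i => a κ (.inr (.inr (.inr (.inr i))))) v₀ v₁ v₂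
  refine poly_implements_exec4 A hA (fun κ => simVerifier W C κ (ℓ κ)) (card_ToVerifierW hW hℓ hC)
    (by simpa using polyBounded_const 1) (by simpa using polyBounded_const 0)
    (by simpa using polyBounded_id.add ((hW.sig_poly.comp hℓ).add ((hW.mhat_poly.comp hℓ).add
      (hn.mul hC.rlen_poly)))) ?_ ?_ ?_ ?_ ?_
  · exact (key (ω := fun κ => OutW (ℓ κ) ⊕ SimCoins W C κ (ℓ κ)) (fun κ => id)
      (fun κ => .inl (.inr ())) (fun κ => .inl (.inr ())) (fun κ => .inl (.inr ()))).1
  · exact (key (ω := fun κ => (OutW (ℓ κ) ⊕ SimCoins W C κ (ℓ κ)) ⊕ Unit) (fun κ => .inl)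
      (fun κ => .inr ()) (fun κ => .inr ()) (fun κ => .inr ())).2.1
  · exact (key (ω := fun κ => ((OutW (ℓ κ) ⊕ SimCoins W C κ (ℓ κ)) ⊕ Unit) ⊕ Unit)
      (fun κ a => .inl (.inl a)) (fun κ => .inl (.inr ())) (fun κ => .inr ())
      (fun κ => .inr ())).2.2.1
  · exact (key (ω := fun κ => (((OutW (ℓ κ) ⊕ SimCoins W C κ (ℓ κ)) ⊕ Unit) ⊕ Unit) ⊕ Unit)
      (fun κ a => .inl (.inl (.inl a))) (fun κ => .inl (.inl (.inr ())))
      (fun κ => .inl (.inr ())) (fun κ => .inr ())).2.2.2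
  · exact ⟨fun _ => 0, polyBounded_const 0, fun κ i => i.elim⟩

end VerifierPoly

/-! ### Security against a dishonest verifier -/

section ViewAccept

variable {Ω ι ο α β : Type} [Fintype Ω] [Nonempty Ω]
  [Fintype ι] [DecidableEq ι] [Fintype ο] [DecidableEq ο]
  [Fintype α] [DecidableEq α] [Fintype β] [DecidableEq β] {nz nq no : ℕ}

theorem expect_sumArrow {A B : Type} [Fintype A] [DecidableEq A] [Fintype B] [DecidableEq B]
    (f : (A ⊕ B → Bool) → ℝ) : 𝔼 c, f c = 𝔼 a, 𝔼 b, f (Sum.elim a b) := by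
  rw [← expect_prod (fun p : (A → Bool) × (B → Bool) => f (Sum.elim p.1 p.2))]
  exact Fintype.expect_equiv (Equiv.sumArrowEquivProdArrow A B Bool) _ _ fun c => by
    simp [Equiv.sumArrowEquivProdArrow]

/-- The probability that a distinguisher accepts the joint output, in an execution with four rounds
in which the messages to the dishonest party are the function `v` of the earlier replies and `y` is
the honest output. -/
noncomputable def viewAccept (D : Distinguisher (ι ⊕ (Fin nz ⊕ (ο ⊕ Fin no))))
    (A : Adversary α β nz nq no) (u : ι → Bool) (z : Bits nz) (ρ : Op (Mem nz nq no A.na))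
    (y : (β → Bool) → (β → Bool) → (β → Bool) → (β → Bool) → (ο → Bool))
    (v : List (β → Bool) → (α → Bool)) : ℝ :=
  ∑ r₀, ∑ r₁, ∑ r₂, ∑ r₃, D.accept (tens (ketBra u) (tens (ketBra z)
    (tens (ketBra (y r₀ r₁ r₂ r₃)) (A.finish (A.step 3 (v [r₀, r₁, r₂]) r₃
      (A.step 2 (v [r₀, r₁]) r₂ (A.step 1 (v [r₀]) r₁ (A.step 0 (v []) r₀ ρ))))))))

theorem accept_exec4 (D : Distinguisher (ι ⊕ (Fin nz ⊕ (ο ⊕ Fin no)))) {ι' : Type}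
    (M : System Ω ι' ο α β) (A : Adversary α β nz nq no) (u : ι → Bool) (u' : ι' → Bool)
    (z : Bits nz) (ρ : Op (Mem nz nq no A.na)) :
    D.accept (tens (ketBra u) (tens (ketBra z) (M.exec4 A u' ρ))) =
      𝔼 c, viewAccept D A u z ρ (fun r₀ r₁ r₂ r₃ => M.result u' c [r₀, r₁, r₂, r₃])
        (M.send u' c) := by
  have h : (Fintype.card Ω : ℂ)⁻¹ = (((Fintype.card Ω : ℝ)⁻¹ : ℝ) : ℂ) := by simp
  rw [System.exec4, tens_smul_right, tens_smul_right, h, D.accept_smul, expect_eq_inv_mul_sum]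
  congr 1
  simp only [tens_sum_right, D.accept_sum]
  rfl

theorem viewAccept_nonneg (D : Distinguisher (ι ⊕ (Fin nz ⊕ (ο ⊕ Fin no))))
    (A : Adversary α β nz nq no) (u : ι → Bool) (z : Bits nz) {ρ : Op (Mem nz nq no A.na)}
    (hρ : ρ.PosSemidef)
    (y : (β → Bool) → (β → Bool) → (β → Bool) → (β → Bool) → (ο → Bool))
    (v : List (β → Bool) → (α → Bool)) : 0 ≤ viewAccept D A u z ρ y v :=
  Finset.sum_nonneg fun _ _ => Finset.sum_nonneg fun _ _ => Finset.sum_nonneg fun _ _ =>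
    Finset.sum_nonneg fun _ _ => D.accept_nonneg (posSemidef_tens (posSemidef_ketBra _)
      (posSemidef_tens (posSemidef_ketBra _) (posSemidef_tens (posSemidef_ketBra _)
        (A.posSemidef_finish (A.posSemidef_step _ _ _ (A.posSemidef_step _ _ _
          (A.posSemidef_step _ _ _ (A.posSemidef_step _ _ _ hρ))))))))

theorem accept_outputs_le (D : Distinguisher (ι ⊕ (Fin nz ⊕ (ο ⊕ Fin no))))
    (A : Adversary α β nz nq no) (u : ι → Bool) (z : Bits nz) (y : ο → Bool)
    {ρ : Op (Mem nz nq no A.na)} (hρ : ρ.PosSemidef) :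
    D.accept (tens (ketBra u) (tens (ketBra z) (tens (ketBra y) (A.finish ρ)))) ≤ ρ.trace.re := by
  refine (D.accept_le (posSemidef_tens (posSemidef_ketBra _) (posSemidef_tens
    (posSemidef_ketBra _) (posSemidef_tens (posSemidef_ketBra _) (A.posSemidef_finish hρ))))).trans
    (le_of_eq ?_)
  rw [trace_tens, trace_tens, trace_tens, trace_ketBra, trace_ketBra, trace_ketBra, A.trace_finish,
    one_mul, one_mul, one_mul]

theorem viewAccept_le (D : Distinguisher (ι ⊕ (Fin nz ⊕ (ο ⊕ Fin no))))
    (A : Adversary α β nz nq no) (u : ι → Bool) (z : Bits nz) {ρ : Op (Mem nz nq no A.na)}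
    (hρ : ρ.PosSemidef)
    (y : (β → Bool) → (β → Bool) → (β → Bool) → (β → Bool) → (ο → Bool))
    (v : List (β → Bool) → (α → Bool)) : viewAccept D A u z ρ y v ≤ ρ.trace.re := by
  calc viewAccept D A u z ρ y v ≤ ∑ r₀, ∑ r₁, ∑ r₂, ∑ r₃, (A.step 3 (v [r₀, r₁, r₂]) r₃
      (A.step 2 (v [r₀, r₁]) r₂ (A.step 1 (v [r₀]) r₁ (A.step 0 (v []) r₀ ρ)))).trace.re :=
        Finset.sum_le_sum fun _ _ => Finset.sum_le_sum fun _ _ => Finset.sum_le_sum fun _ _ =>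
          Finset.sum_le_sum fun _ _ => accept_outputs_le D A u z _ (A.posSemidef_step _ _ _
            (A.posSemidef_step _ _ _ (A.posSemidef_step _ _ _ (A.posSemidef_step _ _ _ hρ))))
    _ = ρ.trace.re := by simp only [Adversary.sum_re_trace_step]

theorem sum_ketBra_outcome_empty (X : Op (Empty ⊕ α)) (y : (Empty → Bool) → (Empty → Bool)) :
    ∑ r : Empty → Bool, tens (ketBra (y r)) (outcome r X) = X := by
  rw [Fintype.sum_unique]
  refine Op.ext_elim fun a b a' b' => ?_
  rw [tens_apply_elim, ketBra_apply, if_pos ⟨Subsingleton.elim _ _, Subsingleton.elim _ _⟩, one_mul,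
    outcome]
  congr! 2

end ViewAccept

section VerifierSecurity

variable {R : Set (List Bool × List Bool)} {W : WitnessEncoding} {C : CommitScheme} {κ k q : ℕ}

/-- If the prover aborts, nothing depends on the commitments. -/
theorem committedView_false (x : Bits k) (pk : Bits κ) (s : Bits (W.sig k)) (e e' : Bits (W.n k))
    (r r' : Fin (W.n k) → Bits (C.rlen κ)) :
    committedView W C κ k false x pk s e r = committedView W C κ k false x pk s e' r' := by
  funext hist
  rcases hist with _ | ⟨r₀, _ | ⟨r₁, _ | ⟨r₂, _ | ⟨r₃, hist⟩⟩⟩⟩ <;>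
    simp [committedView, verifierView]

theorem expect_simVerifier_send (f : (List (Unit → Bool) → (ToVerifierW W C κ k → Bool)) → ℝ)
    (v : OutW k → Bool) :
    𝔼 c, f ((simVerifier W C κ k).send v c) = 𝔼 pk, 𝔼 s, 𝔼 t, 𝔼 r,
      f (committedView W C κ k (v (.inr ())) (fun i => v (.inl i)) pk s
        (simBits W k (fun i => v (.inl i)) s t) r) := by
  rw [expect_sumArrow]
  refine Finset.expect_congr rfl fun pk _ => ?_
  rw [expect_sumArrow]
  refine Finset.expect_congr rfl fun s _ => ?_
  rw [expect_sumArrow]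
  refine Finset.expect_congr rfl fun t _ => ?_
  exact Fintype.expect_equiv (Equiv.curry _ _ _) _ _ fun r => rfl

theorem expect_coins (f : Bits κ × Bits (W.sig k) × ProverCoins W C κ k → ℝ) :
    𝔼 c, f c = 𝔼 pk, 𝔼 s, 𝔼 t, 𝔼 r, f (pk, s, t, r) := by
  rw [expect_prod]
  refine Finset.expect_congr rfl fun pk _ => ?_
  rw [expect_prod]
  refine Finset.expect_congr rfl fun s _ => ?_
  rw [expect_prod]

theorem validWit_mem {u : InW k q → Bool} {w : List Bool} (h : validWit R u = some w) :
    (List.ofFn (fun i => u (.inl i)), w) ∈ R := by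
  unfold validWit at h
  split at h
  · simp at h
  · split_ifs at h with h'
    obtain rfl := Option.some_injective _ h
    exact h'

theorem abs_expect_realVerifier_sub_le (hsim : W.Simulatable R) {p : ℝ}
    (f : (List (Unit → Bool) → (ToVerifierW W C κ k → Bool)) → ℝ) (h0 : ∀ v, 0 ≤ f v)
    (h1 : ∀ v, f v ≤ p) (u : InW k q → Bool) :
    |𝔼 c, f ((realVerifier R W C κ k q).send u c) -
      𝔼 c, f ((simVerifier W C κ k).send (verdict (funcZKPK R u)) c)| ≤
      p * (4 * keyError C κ + 2 * (W.n k * hidingError C κ)) := by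
  rw [expect_simVerifier_send, expect_coins]
  rcases hu : validWit R u with _ | w
  · -- without a valid witness, the real and the simulated view are the same
    have hp : 0 ≤ p := (h0 fun _ _ => false).trans (h1 _)
    have hk : 0 ≤ keyError C κ := statDist_nonneg _ _
    have hh := hidingError_nonneg (C := C) (κ := κ)
    have hb : 0 ≤ p * (4 * keyError C κ + 2 * (W.n k * hidingError C κ)) := by positivity
    simp only [realVerifier_send_of_none R W C κ k q hu _ (fun _ => false), verdict, funcZKPK, hu,
      Sum.elim_inr, Sum.elim_inl, Option.isSome_none,
      committedView_false (W := W) (C := C) _ _ _ _ (fun _ => false) _ (fun _ _ => false),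
      Fintype.expect_const, sub_self, abs_zero]
    exact hb
  · simp only [realVerifier_send_of_some R W C κ k q hu, verdict, funcZKPK, hu, Sum.elim_inr,
      Sum.elim_inl, Option.isSome_some]
    exact abs_expect_real_sub_sim_le hsim f h0 h1 (validWit_mem hu)

/-- The simulator obtains `(x, j)` in one round and runs the dishonest verifier on a view with bits
of `Ê` for a challenge of its own. -/
theorem secureAgainst_verifier {q ℓ : ℕ → ℕ} (hW : W.IsPoly R q) (hsim : W.Simulatable R)
    (hC : C.IsMixed) (hℓ : PolyBounded ℓ) :
    SecureAgainst (fun κ => realVerifier R W C κ (ℓ κ) (q (ℓ κ)))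
      (fun κ => idealVerifier R (ℓ κ) (q (ℓ κ))) := by
  intro nz nq no A hA
  obtain ⟨s, hs, himp⟩ := poly_implements_simVerifier hW hℓ hC A hA
  choose A' hna hcirc hlast hA' using fun κ => (himp κ).exists_adversary
  refine ⟨A', ?_, fun T hT _ => ?_⟩
  · obtain ⟨p, hp⟩ := hA
    obtain ⟨p', hp'⟩ := hs
    refine ⟨p + p', fun κ => ?_⟩
    obtain ⟨p1, p2, p3, -⟩ := hp κ
    have := hp' κ
    rw [Polynomial.eval_add]
    refine ⟨by omega, by omega, by omega, (hna κ).trans (by omega), fun i => (hcirc κ i).trans ?_,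
      by rw [hlast κ]; omega⟩
    simp only [Fintype.card_empty]
    omega
  · intro D _ _
    have hbound : Negl fun κ => 4 * keyError C κ + 2 * (W.n (ℓ κ) * hidingError C κ) :=
      ((negl_keyError hC).const_mul 4).add
        (((negl_hidingError hC).polyBounded_mul (hW.n_poly.comp hℓ)).const_mul 2)
    refine hbound.of_abs_le fun κ => ?_
    rw [abs_abs]
    set δ := 4 * keyError C κ + 2 * (W.n (ℓ κ) * hidingError C κ)
    change |(D κ).accept ((realVerifier R W C κ (ℓ κ) (q (ℓ κ))).out (A κ) (T κ)) -
      (D κ).accept ((idealVerifier R (ℓ κ) (q (ℓ κ))).out (A' κ) (T κ))| ≤ δ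
    rw [System.out_four _ rfl, System.out_one _ rfl]
    simp only [idealVerifier, Finset.sum_const, Finset.card_univ, Fintype.card_unit, Nat.cast_one,
      inv_one, one_smul, hA', sum_ketBra_outcome_empty, Distinguisher.accept_sum, accept_exec4,
      ← Finset.sum_sub_distrib]
    calc _ ≤ ∑ u, ∑ z, ((T κ).state u z).trace.re * δ := by
          refine (Finset.abs_sum_le_sum_abs _ _).trans (Finset.sum_le_sum fun u _ => ?_)
          refine (Finset.abs_sum_le_sum_abs _ _).trans (Finset.sum_le_sum fun z _ => ?_)
          have hρ := (A κ).posSemidef_start z ((T κ).posSemidef_state u z)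
          have h := abs_expect_realVerifier_sub_le (C := C) (κ := κ) hsim
            (p := ((T κ).state u z).trace.re)
            (viewAccept (D κ) (A κ) u z ((A κ).start z ((T κ).state u z))
              (fun _ _ _ _ => Empty.elim)) (viewAccept_nonneg _ _ _ _ hρ _)
            (fun v => by
              have h := viewAccept_le (D κ) (A κ) u z hρ (fun _ _ _ _ => Empty.elim) v
              rwa [Adversary.trace_start] at h) u
          exact h
      _ = δ := by
          simp only [← Finset.sum_mul]
          rw [Sampler.sum_re_trace_state, one_mul]

end VerifierSecurity

/-! ### Correctness -/

section Correctness

variable {R : Set (List Bool × List Bool)} {W : WitnessEncoding} {C : CommitScheme} {κ k q : ℕ}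

theorem honestZKPK_eq_pure (hcomplete : W.Complete R) (u : InW k q → Bool) :
    honestZKPK R W C κ k q u = PMF.pure (funcZKPK R u) := by
  have h : ∀ c : Bits κ × Bits (W.sig k) × ProverCoins W C κ k,
      verifierOut W C κ k (some c.1) (proverMsg R W C κ k q u (some c.1) c.2.2) (some c.2.1)
        (proverOpen R W C κ k q u (some c.1) (some c.2.1) c.2.2) = funcZKPK R u := by
    intro c
    rcases hu : validWit R u with _ | w
    · simp [verifierOut, proverMsg, funcZKPK, hu]
    · have hJ := hcomplete k _ w c.2.2.1 c.2.1 (validWit_mem hu)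
      have hr : restrict (fun i => (if i ∈ W.S k c.2.1 then
          (W.E k (fun i => u (.inl i)) w c.2.2.1 i, c.2.2.2 i) else (false, fun _ => false)).1)
          (W.S k c.2.1) = restrict (W.E k (fun i => u (.inl i)) w c.2.2.1) (W.S k c.2.1) := by
        funext i
        simp [restrict]
      simp only [verifierOut, proverMsg, proverOpen, funcZKPK, hu, hr, hJ]
      simp +contextual
  rw [honestZKPK]
  simp only [h]
  exact PMF.map_const _ _

theorem correct_zkpk (hcomplete : W.Complete R) (q ℓ : ℕ → ℕ) :
    Correct (A := fun κ => InW (ℓ κ) (q (ℓ κ)) → Bool) (B := fun κ => Bits (ℓ κ) × Bool)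
      (fun κ => honestZKPK R W C κ (ℓ κ) (q (ℓ κ))) (fun _ u => PMF.pure (funcZKPK R u)) := by
  intro P
  simp only [honestZKPK_eq_pure hcomplete]
  have h : ∀ {A : ℕ → Type} [∀ κ, Fintype (A κ)] (Q : ∀ κ, PMF (A κ)), StatIndist Q Q := by
    intro A _ Q
    simp only [StatIndist, statDist, sub_self, abs_zero, Finset.sum_const_zero, zero_div]
    exact Asymptotics.superpolynomialDecay_zero _ _
  exact h _

end Correctness

/-! ### Encoding of witnesses -/

theorem ofFn_encodeWit {q : ℕ} {w : List Bool} (h : w.length ≤ q) :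
    List.ofFn (encodeWit q w) = w ++ true :: List.replicate (q - w.length) false := by
  refine List.ext_getElem (by simp; omega) fun i h1 h2 => ?_
  rw [List.getElem_ofFn, encodeWit, List.getD_eq_getElem?_getD]
  rcases lt_trichotomy i w.length with hi | hi | hi
  · simp [List.getElem?_append_left, List.getElem_append_left, hi]
  · subst hi
    simp
  · rw [List.getElem?_eq_none (by simp; omega), List.getElem_append_right (by omega)]
    rw [List.getElem_cons, dif_neg (by omega)]
    simp

theorem decodeWit_encodeWit {q : ℕ} {w : List Bool} (h : w.length ≤ q) :
    decodeWit (encodeWit q w) = some w := by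
  have h1 : (List.ofFn (encodeWit q w)).reverse.dropWhile (fun b => !b) = true :: w.reverse := by
    rw [ofFn_encodeWit h, List.reverse_append, List.reverse_cons, List.reverse_replicate,
      List.append_assoc, List.dropWhile_append_of_pos (by simp)]
    simp
  rw [decodeWit, h1]
  simp

theorem decodeWit_false (k : ℕ) : decodeWit (fun _ : Fin k => false) = none := by
  have h1 : (List.ofFn fun _ : Fin k => false).reverse.dropWhile (fun b => !b) = [] := by
    simp
  rw [decodeWit, h1]

/-! ### Distinguishing keys with an execution of the protocol -/

section KeyDistinguisher

variable {ι χ γ : Type} [Fintype ι] [DecidableEq ι] [Fintype χ] [DecidableEq χ]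
  [Fintype γ] [DecidableEq γ] {nz nq s : ℕ}

/-- A sampler prepares the state of its classical outcomes `u`, `z` next to its quantum output. -/
theorem implements_sampler (T : Sampler ι nz nq) :
    Implements (3 * Fintype.card ι + 3 * nz + nq + T.na + T.circ.length) (fun ρ : Op γ => ρ)
      (fun ρ => tens ρ (∑ u, tens (ketBra u) (∑ z, tens (ketBra z) (T.state u z)))) := by
  have hz : Implements (2 * nz) (fun X : Op (Fin nz ⊕ (Fin nq ⊕ Fin T.na)) => X)
      (fun X => ∑ z, tens (ketBra z) (traceRight (outcome z X))) :=
    (Implements.bind (f := fun X z => (ketBra z, outcome z X)) implements_measureLeft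
      ((implements_traceRight (α := Fin nq) (β := Fin T.na)).frameLeft (δ := Fin nz))).mono
      (by simp)
  have hu : Implements (2 * Fintype.card ι + 2 * nz)
      (fun X : Op (ι ⊕ (Fin nz ⊕ (Fin nq ⊕ Fin T.na))) => X)
      (fun X => ∑ u, tens (ketBra u)
        (∑ z, tens (ketBra z) (traceRight (outcome z (outcome u X))))) :=
    Implements.bind (f := fun X u => (ketBra u, outcome u X)) implements_measureLeft
      (hz.frameLeft (δ := ι))
  have h := ((implements_apply T.circ).trans (hu.comap fun X => T.circ.apply X)).frameLeft (δ := γ)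
  exact (implements_tens_zeroState.trans (h.comap fun ρ : Op γ => (ρ, zeroState _))).mono
    (by simp; omega)

/-- Exchange of the first register with the next two. -/
def moveLeft (α β γ δ : Type) : α ⊕ (β ⊕ (γ ⊕ δ)) ≃ β ⊕ (γ ⊕ (α ⊕ δ)) where
  toFun := Sum.elim (fun a => .inr (.inr (.inl a))) (Sum.elim .inl
    (Sum.elim (fun c => .inr (.inl c)) (fun d => .inr (.inr (.inr d)))))
  invFun := Sum.elim (fun b => .inr (.inl b)) (Sum.elim (fun c => .inr (.inr (.inl c)))
    (Sum.elim .inl (fun d => .inr (.inr (.inr d)))))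
  left_inv x := by rcases x with x | x | x | x <;> rfl
  right_inv x := by rcases x with x | x | x | x <;> rfl

theorem reix_moveLeft {α β γ δ : Type} (ρ : Op α) (τ : Op β) (υ : Op γ) (η : Op δ) :
    reix (moveLeft α β γ δ) (tens ρ (tens τ (tens υ η))) = tens τ (tens υ (tens ρ η)) := by
  ext p q
  change ρ _ _ * (τ _ _ * (υ _ _ * η _ _)) = τ _ _ * (υ _ _ * (ρ _ _ * η _ _))
  rw [mul_left_comm, mul_left_comm (ρ _ _)]
  rfl

/-- Sampling the inputs and running an experiment on a classical input `x`, the sampled `Z` and the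
sampled quantum input. -/
theorem implements_experiment (T : Sampler ι nz nq)
    {out : (χ → Bool) × Bits nz × Op (Fin nq) → Op γ}
    (h : Implements s (fun p : (χ → Bool) × Bits nz × Op (Fin nq) =>
      tens (ketBra p.1) (tens (ketBra p.2.1) p.2.2)) out) :
    Implements (3 * Fintype.card ι + 5 * nz + nq + T.na + T.circ.length + s)
      (fun x : χ → Bool => ketBra x)
      (fun x => ∑ u, ∑ z, tens (ketBra u) (tens (ketBra z) (out (x, z, T.state u z)))) := by
  -- a copy of `Z` is kept for the joint output
  have hcopy : Implements (nz * 2) (fun p : Bits nz × Op (Fin nq) => tens (ketBra p.1) p.2)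
      (fun p => tens (ketBra p.1) (tens (ketBra p.1) p.2)) :=
    ((((implements_bits (fun b : Fin nz => bitComp_var b)).frame (δ := Fin nq)).reix
      (Equiv.sumAssoc _ _ _)).mono (by simp)).congr (fun _ => rfl) (fun p => by
        rw [← reix_sumAssoc, tens_ketBra])
  have h1 := ((hcopy.frameLeft (δ := ι)).frameLeft (δ := χ)).reix (moveLeft χ ι (Fin nz) _)
  have h2 := ((h.frameLeft (δ := Fin nz)).frameLeft (δ := ι))
  have h3 : Implements (nz * 2 + s)
      (fun p : (χ → Bool) × (ι → Bool) × Bits nz × Op (Fin nq) =>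
        tens (ketBra p.1) (tens (ketBra p.2.1) (tens (ketBra p.2.2.1) p.2.2.2)))
      (fun p => tens (ketBra p.2.1) (tens (ketBra p.2.2.1) (out (p.1, p.2.2.1, p.2.2.2)))) := by
    refine (h1.comap fun p : (χ → Bool) × (ι → Bool) × Bits nz × Op (Fin nq) =>
      (ketBra p.1, ketBra p.2.1, p.2.2.1, p.2.2.2)).trans ?_
    refine (h2.comap fun p : (χ → Bool) × (ι → Bool) × Bits nz × Op (Fin nq) =>
      (ketBra p.2.1, ketBra p.2.2.1, p.1, p.2.2.1, p.2.2.2)).congr (fun p => ?_) (fun p => rfl)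
    exact reix_moveLeft _ _ _ _
  have h4 := (h3.sum (K := (χ → Bool) × (ι → Bool)) (J := Bits nz)
    (fun p z => (p.1, p.2, z, T.state p.2 z))).sum (K := χ → Bool) (J := ι → Bool)
    (fun x u => (x, u))
  have h5 := (implements_sampler (γ := χ) T).comap fun x : χ → Bool => ketBra x
  refine ((h5.trans (h4.congr (fun x => ?_) (fun x => rfl))).mono ?_).congr (fun _ => rfl)
    (fun x => rfl)
  · simp only [tens_sum_right]
  · omega

/-- A poly-size experiment on a classical input `x` whose output goes to a poly-size distinguisher
is a poly-size distinguisher of distributions of `x`. -/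
theorem negl_accept_sub_of_qIndist {χ ι γ : ℕ → Type} [∀ κ, Fintype (χ κ)]
    [∀ κ, DecidableEq (χ κ)] [∀ κ, Fintype (ι κ)] [∀ κ, DecidableEq (ι κ)] [∀ κ, Fintype (γ κ)]
    [∀ κ, DecidableEq (γ κ)] {nz nq s : ℕ → ℕ} {P Q : ∀ κ, PMF (χ κ → Bool)}
    (hPQ : QIndist (fun κ => classicalState (P κ)) (fun κ => classicalState (Q κ)))
    (T : ∀ κ, Sampler (ι κ) (nz κ) (nq κ)) (hT : SamplerPoly T)
    (hι : PolyBounded fun κ => Fintype.card (ι κ)) (hz : PolyBounded nz) (hq : PolyBounded nq)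
    (hs : PolyBounded s) {out : ∀ κ, (χ κ → Bool) × Bits (nz κ) × Op (Fin (nq κ)) → Op (γ κ)}
    (h : ∀ κ, Implements (s κ) (fun p : (χ κ → Bool) × Bits (nz κ) × Op (Fin (nq κ)) =>
      tens (ketBra p.1) (tens (ketBra p.2.1) p.2.2)) (out κ))
    (D : ∀ κ, Distinguisher (ι κ ⊕ (Fin (nz κ) ⊕ γ κ))) (hD : PolyBounded fun κ => (D κ).na)
    (hD' : PolyBounded fun κ => (D κ).circ.length) :
    let f := fun κ x => (D κ).accept (∑ u, ∑ z,
      tens (ketBra u) (tens (ketBra z) (out κ (x, z, (T κ).state u z))))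
    Negl fun κ => |∑ x, (P κ x).toReal * f κ x - ∑ x, (Q κ x).toReal * f κ x| := by
  intro f
  choose D' hna hlen hacc using fun κ => ((implements_experiment (T κ) (h κ)).trans
    ((D κ).implements_answer.comap _)).exists_distinguisher
  obtain ⟨p, hp⟩ := hT
  have hTp := polyBounded_id.eval p
  have hb : PolyBounded fun κ => (3 * Fintype.card (ι κ) + 5 * nz κ + nq κ + (T κ).na +
      (T κ).circ.length + s κ) + (1 + (D κ).na + (D κ).circ.length) :=
    (((((((polyBounded_const 3).mul hι).add ((polyBounded_const 5).mul hz)).add hq).add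
      (hTp.mono fun κ => (hp κ).1)).add (hTp.mono fun κ => (hp κ).2)).add hs).add
      (((polyBounded_const 1).add hD).add hD')
  have hkey : ∀ κ (P : PMF (χ κ → Bool)),
      (D' κ).accept (classicalState P) = ∑ x, (P x).toReal * f κ x := by
    intro κ P
    have hc : classicalState P = ∑ x, ((P x).toReal : ℂ) • ketBra x := by
      ext a b
      simp only [classicalState, Matrix.diagonal_apply, Matrix.sum_apply, Matrix.smul_apply,
        ketBra_apply, smul_eq_mul]
      rw [Finset.sum_eq_single a]
      · by_cases hab : a = b <;> simp [hab]
      · intro x _ hx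
        rw [if_neg (fun h => hx h.1), mul_zero]
      · simp
    rw [hc, Distinguisher.accept_sum]
    refine Finset.sum_congr rfl fun x _ => ?_
    rw [Distinguisher.accept_smul, hacc]
    rfl
  have hneg := hPQ D' (hb.mono hna) ((hb.add (polyBounded_const 1)).mono hlen)
  simpa only [hkey] using hneg

end KeyDistinguisher

/-! ### Security against a dishonest prover -/

section Systems

variable {Ω ι ο ο' α β : Type} [Fintype Ω] [Nonempty Ω]
  [Fintype ι] [DecidableEq ι] [Fintype ο] [DecidableEq ο] [Fintype ο'] [DecidableEq ο']
  [Fintype α] [DecidableEq α] [Fintype β] [DecidableEq β] {nz nq no : ℕ}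

/-- Postprocessing of the honest party's output. -/
def System.mapResult (M : System Ω ι ο α β) (g : (ο → Bool) → (ο' → Bool)) :
    System Ω ι ο' α β where
  rounds := M.rounds
  send := M.send
  result u c hist := g (M.result u c hist)

theorem sum_tens_ketBra_map (g : (ο → Bool) → (ο' → Bool)) (m : ο → Bool) (X : Op α) :
    ∑ r, tens (ketBra (g r)) (if m = r then X else 0) = tens (ketBra (g m)) X := by
  rw [Finset.sum_eq_single m]
  · rw [if_pos rfl]
  · intro y _ hy; rw [if_neg (Ne.symm hy), tens_zero_right]
  · simp

theorem System.sum_outcome_exec4 (M : System Ω ι ο α β) (g : (ο → Bool) → (ο' → Bool))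
    (A : Adversary α β nz nq no) (u : ι → Bool) (ρ : Op (Mem nz nq no A.na)) :
    ∑ r, tens (ketBra (g r)) (outcome r (M.exec4 A u ρ)) = (M.mapResult g).exec4 A u ρ := by
  simp only [System.exec4, outcome_smul, outcome_sum, outcome_tens_ketBra, tens_smul_right,
    tens_sum_right, ← Finset.smul_sum]
  congr 1
  rw [Finset.sum_comm]; refine Finset.sum_congr rfl fun c _ => ?_
  rw [Finset.sum_comm]; refine Finset.sum_congr rfl fun r₀ _ => ?_
  rw [Finset.sum_comm]; refine Finset.sum_congr rfl fun r₁ _ => ?_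
  rw [Finset.sum_comm]; refine Finset.sum_congr rfl fun r₂ _ => ?_
  rw [Finset.sum_comm]; refine Finset.sum_congr rfl fun r₃ _ => ?_
  rw [sum_tens_ketBra_map]
  rfl

/-- Two executions in which the messages are the same and the honest outputs differ only if an event
occurs that is determined by the first two replies. -/
theorem abs_viewAccept_sub_le (D : Distinguisher (ι ⊕ (Fin nz ⊕ (ο ⊕ Fin no))))
    (A : Adversary α β nz nq no) (u : ι → Bool) (z : Bits nz) {ρ : Op (Mem nz nq no A.na)}
    (hρ : ρ.PosSemidef)
    {y y' : (β → Bool) → (β → Bool) → (β → Bool) → (β → Bool) → (ο → Bool)}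
    (v : List (β → Bool) → (α → Bool)) {c : (β → Bool) → (β → Bool) → ℝ}
    (hc0 : ∀ r₀ r₁, 0 ≤ c r₀ r₁)
    (hc : ∀ r₀ r₁ r₂ r₃, y r₀ r₁ r₂ r₃ ≠ y' r₀ r₁ r₂ r₃ → 1 ≤ c r₀ r₁) :
    |viewAccept D A u z ρ y v - viewAccept D A u z ρ y' v| ≤
      ∑ r₀, ∑ r₁, (A.step 1 (v [r₀]) r₁ (A.step 0 (v []) r₀ ρ)).trace.re * c r₀ r₁ := by
  calc |viewAccept D A u z ρ y v - viewAccept D A u z ρ y' v|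
      ≤ ∑ r₀, ∑ r₁, ∑ r₂, ∑ r₃, (A.step 3 (v [r₀, r₁, r₂]) r₃
        (A.step 2 (v [r₀, r₁]) r₂ (A.step 1 (v [r₀]) r₁ (A.step 0 (v []) r₀ ρ)))).trace.re *
          c r₀ r₁ := by
        simp only [viewAccept, ← Finset.sum_sub_distrib]
        refine (Finset.abs_sum_le_sum_abs _ _).trans (Finset.sum_le_sum fun r₀ _ => ?_)
        refine (Finset.abs_sum_le_sum_abs _ _).trans (Finset.sum_le_sum fun r₁ _ => ?_)
        refine (Finset.abs_sum_le_sum_abs _ _).trans (Finset.sum_le_sum fun r₂ _ => ?_)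
        refine (Finset.abs_sum_le_sum_abs _ _).trans (Finset.sum_le_sum fun r₃ _ => ?_)
        have hσ := A.posSemidef_step 3 (v [r₀, r₁, r₂]) r₃ (A.posSemidef_step 2 (v [r₀, r₁]) r₂
          (A.posSemidef_step 1 (v [r₀]) r₁ (A.posSemidef_step 0 (v []) r₀ hρ)))
        have ht := re_trace_nonneg hσ
        by_cases h : y r₀ r₁ r₂ r₃ = y' r₀ r₁ r₂ r₃
        · rw [h, sub_self, abs_zero]
          exact mul_nonneg ht (hc0 _ _)
        · have hnn : ∀ y, 0 ≤ D.accept (tens (ketBra u) (tens (ketBra z) (tens (ketBra y)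
              (A.finish (A.step 3 (v [r₀, r₁, r₂]) r₃ (A.step 2 (v [r₀, r₁]) r₂
                (A.step 1 (v [r₀]) r₁ (A.step 0 (v []) r₀ ρ)))))))) := fun y =>
            D.accept_nonneg (posSemidef_tens (posSemidef_ketBra _) (posSemidef_tens
              (posSemidef_ketBra _) (posSemidef_tens (posSemidef_ketBra _)
                (A.posSemidef_finish hσ))))
          refine (abs_sub_le_of_nonneg_of_le (hnn _) (accept_outputs_le D A u z _ hσ) (hnn _)
            (accept_outputs_le D A u z _ hσ)).trans ?_
          exact le_mul_of_one_le_right ht (hc _ _ _ _ h)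
    _ = _ := by simp only [← Finset.sum_mul, Adversary.sum_re_trace_step]

end Systems

section Extraction

variable {R : Set (List Bool × List Bool)} {W : WitnessEncoding} {C : CommitScheme} {κ k : ℕ}
  {q : ℕ → ℕ}

/-- The event that the simulator of a dishonest prover fails: the judgment on the committed bits is
positive for the challenge `s`, but they do not decode to a witness. -/
def ExtractionFails (R : Set (List Bool × List Bool)) (W : WitnessEncoding) {k : ℕ} (x : Bits k)
    (e : Bits (W.n k)) (s : Bits (W.sig k)) : Prop :=
  W.J k x s (restrict e (W.S k s)) = true ∧ (List.ofFn x, W.D k x e) ∉ R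

open Classical in
/-- Extraction fails for at most one challenge, since otherwise the committed bits are admissible. -/
theorem expect_extractionFails_le (hextract : W.Extractable R) (x : Bits k) (e : Bits (W.n k)) :
    𝔼 s, (if ExtractionFails R W x e s then (1 : ℝ) else 0) ≤ 2⁻¹ ^ W.sig k := by
  have h : ∑ s, (if ExtractionFails R W x e s then (1 : ℝ) else 0) ≤ 1 := by
    rw [Finset.sum_boole, ← Nat.cast_one, Nat.cast_le, Finset.card_le_one]
    intro s hs s' hs'
    simp only [Finset.mem_filter, Finset.mem_univ, true_and] at hs hs'
    by_contra hne
    exact hs.2 (hextract k x e ⟨s, s', hne, hs.1, hs'.1⟩)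
  rw [expect_eq_inv_mul_sum]
  calc _ ≤ (Fintype.card (Bits (W.sig k)) : ℝ)⁻¹ * 1 :=
        mul_le_mul_of_nonneg_left h (by positivity)
    _ = 2⁻¹ ^ W.sig k := by simp

theorem validWit_of_decode_none {q : ℕ} {u : InW k q → Bool}
    (h : decodeWit (fun i => u (.inr i)) = none) : validWit R u = none := by
  rw [validWit, h]

theorem isSome_validWit_of_decode_some {q : ℕ} {u : InW k q → Bool} {w : List Bool}
    (h : decodeWit (fun i => u (.inr i)) = some w) :
    (validWit R u).isSome = true ↔ (List.ofFn (fun i => u (.inl i)), w) ∈ R := by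
  rw [validWit, h]
  by_cases hR : (List.ofFn (fun i => u (.inl i)), w) ∈ R <;> simp [hR]

/-- Unless extraction fails, the output of the functionality on the simulator's input is the output
of the verifier. -/
theorem result_eq_of_not_extractionFails (hW : W.IsPoly R q) (hC : C.IsMixed)
    (t : Bits (C.bcoins κ)) (s : Bits (W.sig k)) (r₀ r₁ r₂ r₃ : FromProverW W C κ k → Bool)
    (h : ¬ ExtractionFails R W (fun i => r₁ (.inr (.inl (.inr (.inl i)))))
      (extractedBits W C κ k t r₁) s) :
    (realProver W C κ k).result Empty.elim ((C.genB κ t).1, s) [r₀, r₁, r₂, r₃] =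
      verdict (funcZKPK R (simInput W C κ k (q k) t s r₀ r₁ r₂ r₃)) := by
  rw [realProver_result, verdict, sum_elim_eq_iff]
  refine ⟨rfl, funext fun _ => ?_⟩
  change proverAccept W C κ k (C.genB κ t).1 s r₀ r₁ r₂ r₃ =
    (validWit R (simInput W C κ k (q k) t s r₀ r₁ r₂ r₃)).isSome
  rcases hacc : proverAccept W C κ k (C.genB κ t).1 s r₀ r₁ r₂ r₃ with _ | _
  · rw [validWit_of_decode_none]
    · rfl
    · simp only [simInput, hacc, Sum.elim_inr, Bool.false_and]
      exact decodeWit_false _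
  · symm
    rw [isSome_validWit_of_decode_some (w := W.D k (fun i => r₁ (.inr (.inl (.inr (.inl i)))))
      (extractedBits W C κ k t r₁))]
    · by_contra hR
      refine h ⟨?_, ?_⟩
      · simp only [proverAccept, acceptBit, Bool.and_eq_true, decide_eq_true_eq] at hacc
        obtain ⟨-, hcom, hJ⟩ := hacc
        rw [← hJ]
        congr 1
        funext i
        rw [restrict, restrict, extractedBits, ← hcom i i.2, hC.extract]
      · simp only [proverAccept, Bool.and_eq_true] at hacc
        simpa only [simInput, Sum.elim_inl, hacc.1.1.1.1, Bool.true_and] using hR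
    · simp only [simInput, hacc, Sum.elim_inr, Bool.true_and]
      exact decodeWit_encodeWit (hW.D_length k _ _)

variable {ι : Type} [Fintype ι] [DecidableEq ι] {nz nq no : ℕ}

/-- With extractable keys, replacing the verifier's output by the output of the functionality on the
simulator's input changes the joint output by at most the knowledge error. -/
theorem abs_expect_extraction_sub_le (hW : W.IsPoly R q) (hextract : W.Extractable R)
    (hC : C.IsMixed) (D : Distinguisher (ι ⊕ (Fin nz ⊕ (OutW k ⊕ Fin no))))
    (A : Adversary (ToProverW W κ k) (FromProverW W C κ k) nz nq no) (u : ι → Bool) (z : Bits nz)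
    {ρ : Op (Mem nz nq no A.na)} (hρ : ρ.PosSemidef) (t : Bits (C.bcoins κ)) :
    |𝔼 s, viewAccept D A u z ρ (fun r₀ r₁ r₂ r₃ => (realProver W C κ k).result Empty.elim
        ((C.genB κ t).1, s) [r₀, r₁, r₂, r₃])
        ((realProver W C κ k).send Empty.elim ((C.genB κ t).1, s)) -
      𝔼 s, viewAccept D A u z ρ
        (fun r₀ r₁ r₂ r₃ => verdict (funcZKPK R (simInput W C κ k (q k) t s r₀ r₁ r₂ r₃)))
        ((realProver W C κ k).send Empty.elim ((C.genB κ t).1, s))| ≤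
      ρ.trace.re * 2⁻¹ ^ W.sig k := by
  classical
  let m₀ : ToProverW W κ k → Bool := Sum.elim (C.genB κ t).1 (fun _ => false)
  let τ : (FromProverW W C κ k → Bool) → (FromProverW W C κ k → Bool) → ℝ := fun r₀ r₁ =>
    (A.step 1 (fun _ => false) r₁ (A.step 0 m₀ r₀ ρ)).trace.re
  let c : Bits (W.sig k) → (FromProverW W C κ k → Bool) → ℝ := fun s r₁ =>
    if ExtractionFails R W (fun i => r₁ (.inr (.inl (.inr (.inl i)))))
      (extractedBits W C κ k t r₁) s then 1 else 0
  have hτ : ∀ r₀ r₁, 0 ≤ τ r₀ r₁ := fun r₀ r₁ =>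
    re_trace_nonneg (A.posSemidef_step _ _ _ (A.posSemidef_step _ _ _ hρ))
  rw [← Finset.expect_sub_distrib]
  calc _ ≤ 𝔼 s, ∑ r₀, ∑ r₁, τ r₀ r₁ * c s r₁ := by
        refine (abs_expect_le _).trans (Finset.expect_le_expect fun s _ => ?_)
        refine abs_viewAccept_sub_le D A u z hρ _ (c := fun _ r₁ => c s r₁)
          (fun _ r₁ => ?_) (fun r₀ r₁ r₂ r₃ hne => ?_)
        · dsimp only [c]
          split_ifs <;> norm_num
        · by_contra hlt
          refine hne (result_eq_of_not_extractionFails hW hC t s r₀ r₁ r₂ r₃ fun hbad => hlt ?_)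
          simp only [c, if_pos hbad, le_refl]
    _ = ∑ r₀, ∑ r₁, τ r₀ r₁ * 𝔼 s, c s r₁ := by
        rw [Finset.expect_sum_comm]
        refine Finset.sum_congr rfl fun r₀ _ => ?_
        rw [Finset.expect_sum_comm]
        refine Finset.sum_congr rfl fun r₁ _ => ?_
        rw [Finset.mul_expect]
    _ ≤ ∑ r₀, ∑ r₁, τ r₀ r₁ * 2⁻¹ ^ W.sig k :=
        Finset.sum_le_sum fun r₀ _ => Finset.sum_le_sum fun r₁ _ =>
          mul_le_mul_of_nonneg_left (expect_extractionFails_le hextract _ _) (hτ _ _)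
    _ = ρ.trace.re * 2⁻¹ ^ W.sig k := by
        simp only [← Finset.sum_mul, τ, Adversary.sum_re_trace_step]

end Extraction

section ProverSecurity

variable {R : Set (List Bool × List Bool)} {W : WitnessEncoding} {C : CommitScheme}
  {q ℓ : ℕ → ℕ}

/-- The acceptance probability in an execution with a dishonest prover in which the key is `pk`. -/
noncomputable def keyAccept (W : WitnessEncoding) (C : CommitScheme) (κ k : ℕ) {nz nq no : ℕ}
    (A : Adversary (ToProverW W κ k) (FromProverW W C κ k) nz nq no) (T : Sampler Empty nz nq)
    (D : Distinguisher (Empty ⊕ (Fin nz ⊕ (OutW k ⊕ Fin no)))) (pk : Bits κ) : ℝ :=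
  D.accept (∑ u, ∑ z, tens (ketBra u) (tens (ketBra z)
    ((keyProver W C κ k).exec4 A pk (A.start z (T.state u z)))))

section Fixed

variable {κ k : ℕ} {nz nq no : ℕ}
  (A : Adversary (ToProverW W κ k) (FromProverW W C κ k) nz nq no) (T : Sampler Empty nz nq)
  (D : Distinguisher (Empty ⊕ (Fin nz ⊕ (OutW k ⊕ Fin no))))

theorem keyAccept_eq (pk : Bits κ) :
    keyAccept W C κ k A T D pk = ∑ u, ∑ z, 𝔼 s, viewAccept D A u z (A.start z (T.state u z))
      (fun r₀ r₁ r₂ r₃ => (realProver W C κ k).result Empty.elim (pk, s) [r₀, r₁, r₂, r₃])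
      ((realProver W C κ k).send Empty.elim (pk, s)) := by
  simp only [keyAccept, Distinguisher.accept_sum, accept_exec4]
  rfl

theorem keyAccept_nonneg (pk : Bits κ) : 0 ≤ keyAccept W C κ k A T D pk := by
  rw [keyAccept_eq]
  exact Finset.sum_nonneg fun u _ => Finset.sum_nonneg fun z _ => Finset.expect_nonneg fun s _ =>
    viewAccept_nonneg _ _ _ _ (A.posSemidef_start z (T.posSemidef_state u z)) _ _

theorem keyAccept_le_one (pk : Bits κ) : keyAccept W C κ k A T D pk ≤ 1 := by
  rw [keyAccept_eq, ← T.sum_re_trace_state]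
  refine Finset.sum_le_sum fun u _ => Finset.sum_le_sum fun z _ => expect_le_of_le fun s => ?_
  have h := viewAccept_le D A u z (A.posSemidef_start z (T.posSemidef_state u z))
    (fun r₀ r₁ r₂ r₃ => (realProver W C κ k).result Empty.elim (pk, s) [r₀, r₁, r₂, r₃])
    ((realProver W C κ k).send Empty.elim (pk, s))
  rwa [Adversary.trace_start] at h

theorem accept_realProver :
    D.accept ((realProver W C κ k).out A T) = 𝔼 pk, keyAccept W C κ k A T D pk := by
  rw [System.out_four _ rfl]
  simp only [keyAccept_eq, Distinguisher.accept_sum, accept_exec4]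
  rw [Finset.expect_sum_comm]
  refine Finset.sum_congr rfl fun u _ => ?_
  rw [Finset.expect_sum_comm]
  refine Finset.sum_congr rfl fun z _ => ?_
  rw [expect_prod]
  rfl

theorem accept_idealProver {q : ℕ} (A' : Adversary Empty (InW k q) nz nq no)
    (hA' : ∀ m z ρ r i, A'.finish (A'.step i m r (A'.start z ρ)) =
      outcome r ((simProver W C κ k q).exec4 A m (A.start z ρ))) :
    D.accept ((idealProver R k q).out A' T) = 𝔼 t, ∑ u, ∑ z, 𝔼 s,
      viewAccept D A u z (A.start z (T.state u z))
        (fun r₀ r₁ r₂ r₃ => verdict (funcZKPK R (simInput W C κ k q t s r₀ r₁ r₂ r₃)))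
        ((realProver W C κ k).send Empty.elim ((C.genB κ t).1, s)) := by
  rw [System.out_one _ rfl]
  simp only [idealProver, Finset.sum_const, Finset.card_univ, Fintype.card_unit, Nat.cast_one,
    inv_one, one_smul, hA', System.sum_outcome_exec4 (g := fun v => verdict (funcZKPK R v)),
    Distinguisher.accept_sum, accept_exec4]
  rw [Finset.expect_sum_comm]
  refine Finset.sum_congr rfl fun u _ => ?_
  rw [Finset.expect_sum_comm]
  refine Finset.sum_congr rfl fun z _ => ?_
  rw [expect_sumArrow]
  rfl

/-- The distance of the real and the ideal execution, up to the distance of hiding and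
extractable keys. -/
theorem abs_accept_prover_sub_le {q : ℕ → ℕ} (hW : W.IsPoly R q) (hextract : W.Extractable R)
    (hC : C.IsMixed) (A' : Adversary Empty (InW k (q k)) nz nq no)
    (hA' : ∀ m z ρ r i, A'.finish (A'.step i m r (A'.start z ρ)) =
      outcome r ((simProver W C κ k (q k)).exec4 A m (A.start z ρ))) :
    |D.accept ((realProver W C κ k).out A T) - D.accept ((idealProver R k (q k)).out A' T)| ≤
      2 * keyError C κ +
      |𝔼 t, keyAccept W C κ k A T D (C.genB κ t).1 - 𝔼 t, keyAccept W C κ k A T D (C.genH κ t)| +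
      2⁻¹ ^ W.sig k := by
  rw [accept_realProver, accept_idealProver A T D A' hA']
  have h1 := abs_expect_key_sub_le (C := C) (keyAccept W C κ k A T D) (keyAccept_nonneg A T D)
    (keyAccept_le_one A T D)
  have h2 : |𝔼 t, keyAccept W C κ k A T D (C.genB κ t).1 - 𝔼 t, ∑ u, ∑ z, 𝔼 s,
      viewAccept D A u z (A.start z (T.state u z))
        (fun r₀ r₁ r₂ r₃ => verdict (funcZKPK R (simInput W C κ k (q k) t s r₀ r₁ r₂ r₃)))
        ((realProver W C κ k).send Empty.elim ((C.genB κ t).1, s))| ≤ 2⁻¹ ^ W.sig k := by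
    rw [← Finset.expect_sub_distrib]
    refine (abs_expect_le _).trans (expect_le_of_le fun t => ?_)
    rw [keyAccept_eq, ← Finset.sum_sub_distrib]
    calc _ ≤ ∑ u, ∑ z, (T.state u z).trace.re * 2⁻¹ ^ W.sig k := by
          refine (Finset.abs_sum_le_sum_abs _ _).trans (Finset.sum_le_sum fun u _ => ?_)
          rw [← Finset.sum_sub_distrib]
          refine (Finset.abs_sum_le_sum_abs _ _).trans (Finset.sum_le_sum fun z _ => ?_)
          have h := abs_expect_extraction_sub_le hW hextract hC D A u z
            (A.posSemidef_start z (T.posSemidef_state u z)) t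
          rwa [Adversary.trace_start] at h
      _ = 2⁻¹ ^ W.sig k := by
          simp only [← Finset.sum_mul]
          rw [Sampler.sum_re_trace_state, one_mul]
  have h3 := abs_sub_comm (𝔼 t, keyAccept W C κ k A T D (C.genB κ t).1)
    (𝔼 t, keyAccept W C κ k A T D (C.genH κ t))
  refine (abs_sub_le _ (𝔼 t, keyAccept W C κ k A T D (C.genB κ t).1) _).trans
    (add_le_add ?_ h2)
  refine (abs_sub_le _ (𝔼 t, keyAccept W C κ k A T D (C.genH κ t)) _).trans ?_
  rw [h3]
  exact add_le_add (by simpa using h1) le_rfl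

end Fixed

/-- The simulator sends the extracted witness in one round, after running the dishonest prover under
a binding key. -/
theorem secureAgainst_prover (hq : PolyBounded q) (hW : W.IsPoly R q)
    (hextract : W.Extractable R) (hC : C.IsMixed) (hℓ : PolyBounded ℓ)
    (herr : Negl fun κ => (2 : ℝ)⁻¹ ^ W.sig (ℓ κ)) :
    SecureAgainst (fun κ => realProver W C κ (ℓ κ))
      (fun κ => idealProver R (ℓ κ) (q (ℓ κ))) := by
  intro nz nq no A hA
  obtain ⟨s, hs, himp⟩ := poly_implements_simProver hq hW hℓ hC A hA
  obtain ⟨s', hs', himp'⟩ := poly_implements_keyProver hW hℓ hC A hA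
  choose A' hna hcirc hlast hA' using fun κ => (himp κ).exists_adversary
  obtain ⟨p, hp⟩ := hA
  have hpp := polyBounded_id.eval p
  refine ⟨A', ?_, fun T hT _ => ?_⟩
  · obtain ⟨p', hp'⟩ := hs.add (hℓ.add (hq.comp hℓ))
    refine ⟨p + p' + 1, fun κ => ?_⟩
    obtain ⟨p1, p2, p3, -⟩ := hp κ
    have : s κ + (ℓ κ + q (ℓ κ)) ≤ p'.eval κ := hp' κ
    rw [Polynomial.eval_add, Polynomial.eval_add, Polynomial.eval_one]
    refine ⟨by omega, by omega, by omega, (hna κ).trans (by omega), fun i => (hcirc κ i).trans ?_,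
      by rw [hlast κ]; omega⟩
    simp only [Fintype.card_sum, Fintype.card_fin]
    omega
  · intro D hD hD'
    have hkey := negl_accept_sub_of_qIndist hC.key_indist T hT
      (by simpa using polyBounded_const 0) (hpp.mono fun κ => (hp κ).1)
      (hpp.mono fun κ => (hp κ).2.1) hs' himp' D hD hD'
    simp only [sum_uniform_map] at hkey
    refine ((((negl_keyError hC).const_mul 2).add hkey).add herr).of_abs_le fun κ => ?_
    rw [abs_abs]
    exact abs_accept_prover_sub_le (A κ) (T κ) (D κ) hW hextract hC (A' κ) (hA' κ)

end ProverSecurity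

end QZK

theorem theorem3
    (R : Set (List Bool × List Bool)) (q : ℕ → ℕ) (hq : QZK.PolyBounded q)
    (hR : ∀ x w : List Bool, (x, w) ∈ R → w.length ≤ q x.length)
    (W : QZK.WitnessEncoding) (hW : W.IsPoly R q)
    (hcomplete : W.Complete R) (hextract : W.Extractable R) (hsim : W.Simulatable R)
    (C : QZK.CommitScheme) (hC : C.IsMixed)
    (ℓ : ℕ → ℕ) (hℓ : QZK.PolyBounded ℓ)
    (herr : QZK.Negl fun κ => (2 : ℝ)⁻¹ ^ W.sig (ℓ κ)) :
    QZK.SecurelyImplementsZKPK R W C q ℓ :=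
  ⟨QZK.correct_zkpk hcomplete q ℓ, QZK.secureAgainst_prover hq hW hextract hC hℓ herr,
    QZK.secureAgainst_verifier hW hsim hC hℓ⟩
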